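/- **Multiple windows with $w=\Omega(\log k)$.** Fix integers $z>1$ (number of windows) and $c\ge 2z$ (number of parity symbols), and a constant $A>0$. There is a constant $B>0$, depending only on $z,c,A$, such that the following holds for all integers $1\le w\le k$ with $w\ge A\log_2 k$. Put $\ell=w$, $q=2^{w}$, $K=\lceil k/w\rceil$. *The code.* Split a message $\mathbf u\in\{0,1\}^k$ into $K$ blocks of $w$ bits (the last one padded with zeros), read as symbols $U_1,\dots,U_K$ of $GF(q)$, the field being given by an irreducible polynomial of degree $w$ over $GF(2)$ and symbols being written in the basis $1,X,\dots,X^{w-1}$. Encode $(U_1,\dots,U_K)$ by a systematic $(K+c,K)$ MDS code over $GF(q)$. The Guess & Check (GC) codeword $\mathbf x$ is $\mathbf u$ followed by the bits of the $c$ parity symbols, each of these bits repeated $zw+1$ times. The code is any one of these, its field polynomial and parity coefficients being given; if $K+c\le 2^w$, such codes exist, with the parity coefficients forming a Cauchy matrix over $GF(q)$. *The decoder.* From the received string the decoder first recovers the parity symbols. It then goes through all cases, a case being a choice of the blocks in which the $z$ windows start, together with numbers between $0$ and $w$ of message bits deleted in these windows. In each case it chunks the received string accordingly, regards every block in which a window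 starts, and the block following it, as erased, solves for the $e\le 2z$ erased symbols by means of the first $e$ parities, and calls the case possible if the decoded string is consistent with all $c$ parities and the decoded symbols of every maximal run of consecutive erased blocks form a supersequence of the received sub-block of that run. It outputs the decoded string if all possible cases yield the same one, and otherwise declares a decoding failure. *Properties.* For each such code: 1. the redundancy is $n-k=c(zw+1)w$ bits, where $n$ is the length of $\mathbf x$; 2. the encoder computes $\mathbf x$ in at most $B\,kw$ elementary steps (i.e. $\mathcal O(kw)$); 3. let $\delta\le w$ and let $D$ be any set of positions of $\mathbf x$ contained in the union of $z$ windows (intervals of at most $w$ consecutive positions), with at most $\delta$ elements of $D$ in each window. If the bits of $\mathbf x$ in the positions $D$ are deleted, then for every message $\mathbf u$ the decoder either outputs $\mathbf u$ or declares a decoding failure, and it uses at most $B\,k^{z+1}w$ elementary steps (i.e. $\mathcal O(k^{z+1}w)$); 4. for every such $D$, fixed independently of the message, the probability over a uniformly random $\mathbf u\in\{0,1\}^k$ of a decoding failure satisfies $$\Pr(F)\le B\,k^{z}\,2^{-w(c-3z)}\qquad\text{(i.e. }\Pr(F)=\mathcal O(k^z2^{-w(c-3z)})\text{)}.$$ An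 elementary step is one call of a recursive procedure that handles one bit or one list cell and does a bounded number of operations on counters; the arithmetic of $GF(q)$ is carried out on bits. -/

import Mathlib

open Polynomial

namespace GC

/-! ### Step counting

A `Timed α` is a value together with the number of elementary steps spent on producing it.
Every procedure below is a recursion on lists and counters, and each call of a procedure is
charged one step. What a single call does by itself is bounded: it inspects or produces one bit
(or one list cell) and does a bounded number of operations on counters. All work on data of
growing length is done by further calls, hence is paid for; in particular symbols of
`GF(2^w)` are lists of `w` bits and the field arithmetic is carried out bit by bit. -/

/-- A value with the number of steps used to compute it. -/
structure Timed (α : Type) where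
  val : α
  cost : ℕ

instance : Monad Timed where
  pure a := ⟨a, 0⟩
  bind x f := ⟨(f x.val).val, x.cost + (f x.val).cost⟩

/-- One elementary step. -/
def tick : Timed Unit := ⟨(), 1⟩

abbrev Bits := List Bool

/-! ### Elementary list procedures -/

/-- Concatenation. -/
def appendT : Bits → Bits → Timed Bits
  | [], l => do
    tick
    return l
  | a :: as, l => do
    tick
    let r ← appendT as l
    return a :: r

/-- Concatenation of a list of strings. -/
def flattenT : List Bits → Timed Bits
  | [] => do
    tick
    return []
  | b :: bs => do
    tick
    let r ← flattenT bs
    appendT b r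

/-- Remove the first `n` entries. -/
def dropT : ℕ → Bits → Timed Bits
  | 0, l => do
    tick
    return l
  | _ + 1, [] => do
    tick
    return []
  | n + 1, _ :: l => do
    tick
    dropT n l

/-- Split off the first `n` entries (fewer, if the list is shorter). -/
def splitT {α : Type} : ℕ → List α → Timed (List α × List α)
  | 0, l => do
    tick
    return ([], l)
  | _ + 1, [] => do
    tick
    return ([], [])
  | n + 1, a :: l => do
    tick
    let r ← splitT n l
    return (a :: r.1, r.2)

/-- Split off the first `n` bits, padding with zeros if the string is shorter. -/
def splitPadT : ℕ → Bits → Timed (Bits × Bits)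
  | 0, l => do
    tick
    return ([], l)
  | n + 1, [] => do
    tick
    let r ← splitPadT n []
    return (false :: r.1, [])
  | n + 1, a :: l => do
    tick
    let r ← splitPadT n l
    return (a :: r.1, r.2)

/-- Chunk a string into a given number of blocks of `w` bits, padding the end with zeros. -/
def blocksT (w : ℕ) : ℕ → Bits → Timed (List Bits)
  | 0, _ => do
    tick
    return []
  | K + 1, l => do
    tick
    let s ← splitPadT w l
    let r ← blocksT w K s.2
    return s.1 :: r

/-- Prepend `n` copies of a bit. -/
def replicateT (b : Bool) : ℕ → Bits → Timed Bits
  | 0, l => do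
    tick
    return l
  | n + 1, l => do
    tick
    let r ← replicateT b n l
    return b :: r

/-- Repetition code: every bit is repeated `n` times. -/
def repeatT (n : ℕ) : Bits → Timed Bits
  | [] => do
    tick
    return []
  | b :: l => do
    tick
    let r ← repeatT n l
    replicateT b n r

/-- Read one bit at the start of each of the first `j` intervals of length `n`. -/
def unrepeatT (n : ℕ) : ℕ → Bits → Timed Bits
  | 0, _ => do
    tick
    return []
  | _ + 1, [] => do
    tick
    return []
  | j + 1, b :: l => do
    tick
    let l' ← dropT n (b :: l)
    let r ← unrepeatT n j l'
    return b :: r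

/-- Equality of strings. -/
def eqT : Bits → Bits → Timed Bool
  | [], [] => do
    tick
    return true
  | a :: as, b :: bs => do
    tick
    let r ← eqT as bs
    return (a == b) && r
  | _, _ => do
    tick
    return false

/-- Is the second string a supersequence of the first one? (Greedy matching.) -/
def supersequenceT : Bits → Bits → Timed Bool
  | [], _ => do
    tick
    return true
  | _ :: _, [] => do
    tick
    return false
  | a :: as, b :: bs => do
    tick
    if a == b then supersequenceT as bs else supersequenceT (a :: as) bs

/-! ### Arithmetic in `GF(2^w)`

A symbol is the list of its `w` coordinates in the basis `1, X, …, X^(w-1)`, lowest first, and `m`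
is the list of the `w` lower coefficients of the monic irreducible modulus. -/

/-- The zero symbol of the same length. -/
def zeroT : Bits → Timed Bits
  | [] => do
    tick
    return []
  | _ :: m => do
    tick
    let r ← zeroT m
    return false :: r

/-- The symbol one. -/
def oneT : Bits → Timed Bits
  | [] => do
    tick
    return []
  | _ :: m => do
    tick
    let r ← zeroT m
    return true :: r

/-- Addition (which is also subtraction). -/
def addT : Bits → Bits → Timed Bits
  | a :: as, b :: bs => do
    tick
    let r ← addT as bs
    return xor a b :: r
  | _, _ => do
    tick
    return []

/-- Shift the coordinates up by one, returning the coordinate that was shifted out. -/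
def shiftT : Bool → Bits → Timed (Bits × Bool)
  | carry, [] => do
    tick
    return ([], carry)
  | carry, b :: bs => do
    tick
    let r ← shiftT b bs
    return (carry :: r.1, r.2)

/-- Multiplication by `X`. -/
def mulXT (m a : Bits) : Timed Bits := do
  tick
  let s ← shiftT false a
  if s.2 then addT s.1 m else return s.1

/-- Multiplication (Horner scheme in the first factor). -/
def mulT (m : Bits) : Bits → Bits → Timed Bits
  | [], _ => do
    tick
    zeroT m
  | a :: as, b => do
    tick
    let r ← mulT m as b
    let s ← mulXT m r
    if a then addT s b else return s

/-- `acc * (a^2 * a^4 * ⋯ * a^(2^n))`. -/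
def frobeniusProdT (m : Bits) : ℕ → Bits → Bits → Timed Bits
  | 0, _, acc => do
    tick
    return acc
  | n + 1, a, acc => do
    tick
    let s ← mulT m a a
    let acc' ← mulT m acc s
    frobeniusProdT m n s acc'

/-- Inversion: `a⁻¹ = a^(2^w - 2)`. -/
def invT (w : ℕ) (m a : Bits) : Timed Bits := do
  tick
  let e ← oneT m
  frobeniusProdT m (w - 1) a e

/-- Inner product of two vectors of symbols. -/
def dotT (m : Bits) : List Bits → List Bits → Timed Bits
  | g :: gs, u :: us => do
    tick
    let p ← mulT m g u
    let r ← dotT m gs us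
    addT p r
  | _, _ => do
    tick
    zeroT m

/-- The MDS parity symbols of a vector of symbols: one inner product for every row of `G`. -/
def paritiesT (m : Bits) : List (List Bits) → List Bits → Timed (List Bits)
  | [], _ => do
    tick
    return []
  | g :: G, U => do
    tick
    let p ← dotT m g U
    let r ← paritiesT m G U
    return p :: r

/-- Remove the entry at position `j`. -/
def removeT : ℕ → List Bits → Timed (List Bits)
  | _, [] => do
    tick
    return []
  | 0, _ :: l => do
    tick
    return l
  | j + 1, a :: l => do
    tick
    let r ← removeT j l
    return a :: r

/-- Remove column `j` of a matrix (a list of rows). -/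
def removeColT (j : ℕ) : List (List Bits) → Timed (List (List Bits))
  | [] => do
    tick
    return []
  | r :: M => do
    tick
    let r' ← removeT j r
    let M' ← removeColT j M
    return r' :: M'

/-- Laplace expansion along a first row, `M` being the remaining rows (there are no signs in
characteristic two). -/
def laplaceT (m : Bits) (det : List (List Bits) → Timed Bits) (M : List (List Bits)) :
    ℕ → List Bits → Timed Bits
  | _, [] => do
    tick
    zeroT m
  | j, a :: as => do
    tick
    let M' ← removeColT j M
    let d ← det M'
    let t ← mulT m a d
    let s ← laplaceT m det M (j + 1) as
    addT t s

/-- Determinant of a square matrix with `n` rows. -/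
def detT (m : Bits) : ℕ → List (List Bits) → Timed Bits
  | n + 1, r :: M => do
    tick
    laplaceT m (detT m n) M 0 r
  | _, _ => do
    tick
    oneT m

/-- Replace the entry at position `j`. -/
def setT (s : Bits) : ℕ → List Bits → Timed (List Bits)
  | _, [] => do
    tick
    return []
  | 0, _ :: l => do
    tick
    return s :: l
  | j + 1, a :: l => do
    tick
    let r ← setT s j l
    return a :: r

/-- Replace column `j` of a matrix. -/
def setColT (j : ℕ) : List (List Bits) → List Bits → Timed (List (List Bits))
  | r :: M, s :: ss => do
    tick
    let r' ← setT s j r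
    let M' ← setColT j M ss
    return r' :: M'
  | _, _ => do
    tick
    return []

/-- The unknowns of number `j, …, j + i - 1` of the linear system `M x = s` with `e` equations, by
the rule of Cramer; `dinv` is the inverse of the determinant of `M`. -/
def cramerT (m : Bits) (e : ℕ) (M : List (List Bits)) (dinv : Bits) (s : List Bits) :
    ℕ → ℕ → Timed (List Bits)
  | 0, _ => do
    tick
    return []
  | i + 1, j => do
    tick
    let M' ← setColT j M s
    let d ← detT m e M'
    let x ← mulT m dinv d
    let r ← cramerT m e M dinv s i (j + 1)
    return x :: r

/-! ### Guesses -/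

/-- Prepend a number to each tuple in a list, in front of further tuples. -/
def consAllT (a : ℕ) : List (List ℕ) → List (List ℕ) → Timed (List (List ℕ))
  | [], l => do
    tick
    return l
  | t :: ts, l => do
    tick
    let r ← consAllT a ts l
    return (a :: t) :: r

/-- All tuples whose first entry is `< N` and whose remainder is in `ts`. -/
def extendT (ts : List (List ℕ)) : ℕ → Timed (List (List ℕ))
  | 0 => do
    tick
    return []
  | N + 1 => do
    tick
    let r ← extendT ts N
    consAllT N ts r

/-- All tuples of length `z` with entries `< N`. -/
def tuplesT (N : ℕ) : ℕ → Timed (List (List ℕ))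
  | 0 => do
    tick
    return [[]]
  | z + 1 => do
    tick
    let ts ← tuplesT N z
    extendT ts N

/-- Is block `b` affected, if the windows start in the blocks `bs`? A window of at most `w` bits
that starts in block `a` can only meet the blocks `a` and `a + 1`. -/
def affectedT (b : ℕ) : List ℕ → Timed Bool
  | [] => do
    tick
    return false
  | a :: bs => do
    tick
    let r ← affectedT b bs
    return (b == a) || (b == a + 1) || r

/-- The affected ones among the blocks `b, …, b + K - 1`. -/
def flagsT (bs : List ℕ) : ℕ → ℕ → Timed (List Bool)
  | 0, _ => do
    tick
    return []
  | K + 1, b => do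
    tick
    let a ← affectedT b bs
    let r ← flagsT bs K (b + 1)
    return a :: r

/-- Number of deletions in windows that start in block `b`, if the windows start in the blocks `bs`
and contain the numbers `ds` of deleted message bits. -/
def deletedT (b : ℕ) : List ℕ → List ℕ → Timed ℕ
  | a :: bs, d :: ds => do
    tick
    let r ← deletedT b bs ds
    return if b == a then d + r else r
  | _, _ => do
    tick
    return 0

/-- The same numbers for the blocks `b, …, b + K - 1`. -/
def deletionsT (bs ds : List ℕ) : ℕ → ℕ → Timed (List ℕ)
  | 0, _ => do
    tick
    return []
  | K + 1, b => do
    tick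
    let a ← deletedT b bs ds
    let r ← deletionsT bs ds K (b + 1)
    return a :: r

/-- Number of affected blocks. -/
def countT : List Bool → Timed ℕ
  | [] => do
    tick
    return 0
  | a :: l => do
    tick
    let r ← countT l
    return if a then r + 1 else r

/-- The entries of a vector at the affected blocks. -/
def selectT : List Bool → List Bits → Timed (List Bits)
  | a :: l, x :: xs => do
    tick
    let r ← selectT l xs
    return if a then x :: r else r
  | _, _ => do
    tick
    return []

/-- The columns of a matrix at the affected blocks. -/
def selectColsT (flags : List Bool) : List (List Bits) → Timed (List (List Bits))
  | [] => do
    tick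
    return []
  | r :: M => do
    tick
    let r' ← selectT flags r
    let M' ← selectColsT flags M
    return r' :: M'

/-- A piece of the received string: a block regarded as intact, or the sub-block which remains of
`g` consecutive blocks that are regarded as erased. -/
inductive Piece where
  | known (b : Bits)
  | erased (g : ℕ) (sub : Bits)

/-- Chunk the received string according to a guess. The arguments are: the affected blocks; the
numbers of deletions; the number of message bits that are still to come; the number of blocks, of
message bits and of deletions in the current run of affected blocks; the received bits that are
still to come. The result is `none` if the guess requires more deletions than there are bits. -/
def chunkT (w : ℕ) :
    List Bool → List ℕ → ℕ → ℕ → ℕ → ℕ → Bits → Timed (Option (List Piece))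
  | true :: fl, d :: ds, n, g, L, D, y => do
    tick
    chunkT w fl ds (n - w) (g + 1) (L + min w n) (D + d) y
  | false :: fl, _ :: ds, n, g, L, D, y => do
    tick
    if L < D then
      return none
    else do
      let s ← splitT (L - D) y
      let b ← splitT (min w n) s.2
      let r ← chunkT w fl ds (n - w) 0 0 0 b.2
      return r.map fun ps => Piece.erased g s.1 :: Piece.known b.1 :: ps
  | _, _, _, g, L, D, y => do
    tick
    if L < D then
      return none
    else do
      let s ← splitT (L - D) y
      return some [Piece.erased g s.1]

/-- Prepend `g` zero symbols. -/
def zerosT (m : Bits) : ℕ → List Bits → Timed (List Bits)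
  | 0, l => do
    tick
    return l
  | g + 1, l => do
    tick
    let o ← zeroT m
    let r ← zerosT m g l
    return o :: r

/-- The vector of symbols with the erased symbols set to zero. -/
def knownSymbolsT (w : ℕ) (m : Bits) : List Piece → Timed (List Bits)
  | [] => do
    tick
    return []
  | Piece.known b :: ps => do
    tick
    let s ← splitPadT w b
    let r ← knownSymbolsT w m ps
    return s.1 :: r
  | Piece.erased g _ :: ps => do
    tick
    let r ← knownSymbolsT w m ps
    zerosT m g r

/-- Parity symbols minus the contribution of the known symbols. -/
def syndromesT (m : Bits) : List (List Bits) → List Bits → List Bits → Timed (List Bits)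
  | g :: G, p :: ps, U => do
    tick
    let q ← dotT m g U
    let s ← addT p q
    let r ← syndromesT m G ps U
    return s :: r
  | _, _, _ => do
    tick
    return []

/-- Insert the decoded erasures `X`. The result is `none` if the decoded erasures of some run are
not a supersequence of the corresponding sub-block. -/
def fillT : List Piece → List Bits → Timed (Option Bits)
  | [], _ => do
    tick
    return some []
  | Piece.known b :: ps, X => do
    tick
    let r ← fillT ps X
    match r with
    | none => return none
    | some v => do
      let v' ← appendT b v
      return some v'
  | Piece.erased g sub :: ps, X => do
    tick
    let s ← splitT g X
    let b ← flattenT s.1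
    let ok ← supersequenceT sub b
    if ok then do
      let r ← fillT ps s.2
      match r with
      | none => return none
      | some v => do
        let v' ← appendT b v
        return some v'
    else
      return none

/-! ### The code -/

/-- Number of blocks of `w` bits of a message of `k` bits. -/
def numBlocks (k w : ℕ) : ℕ := (k + w - 1) / w

/-- The monic polynomial of degree `w` over `GF(2)` with lower coefficients `m`. -/
noncomputable def modulusPoly {w : ℕ} (m : Fin w → Bool) : (ZMod 2)[X] :=
  X ^ w + ∑ i : Fin w, if m i then X ^ (i : ℕ) else 0

/-- The element of `GF(2)[X] / (modulus)` with coordinates `b`. -/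
noncomputable def symbol {w : ℕ} (m b : Fin w → Bool) : AdjoinRoot (modulusPoly m) :=
  ∑ i : Fin w, if b i then AdjoinRoot.root (modulusPoly m) ^ (i : ℕ) else 0

open Classical in
/-- The systematic code `U ↦ (U, P U)` of length `K + c` and dimension `K` is MDS: its minimum
distance is at least `c + 1`. -/
def IsSystematicMDS {F : Type} [CommRing F] {K c : ℕ} (P : Matrix (Fin c) (Fin K) F) : Prop :=
  ∀ U V : Fin K → F, U ≠ V → c + 1 ≤ hammingDist U V + hammingDist (P.mulVec U) (P.mulVec V)

/-- The data of a Guess & Check code with chunking length `w` for messages of `k` bits: a field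
`GF(2^w)`, given by an irreducible polynomial of degree `w`, and a systematic
`(⌈k/w⌉ + c, ⌈k/w⌉)` MDS code over it, given by the bits of the coefficients of the `c` parity
symbols. -/
structure Code (k w c : ℕ) where
  modulus : Fin w → Bool
  irreducible_modulus : Irreducible (modulusPoly modulus)
  coeff : Fin c → Fin (numBlocks k w) → Fin w → Bool
  mds : IsSystematicMDS
    (Matrix.of fun (r : Fin c) (i : Fin (numBlocks k w)) => symbol modulus (coeff r i))

namespace Code

variable {k w c : ℕ} (C : Code k w c)

/-- The parity coefficients form a Cauchy matrix `1 / (x i + y r)`. -/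
def IsCauchy : Prop :=
  ∃ (x : Fin (numBlocks k w) → AdjoinRoot (modulusPoly C.modulus))
    (y : Fin c → AdjoinRoot (modulusPoly C.modulus)),
    Function.Injective x ∧ Function.Injective y ∧
      ∀ r i, symbol C.modulus (C.coeff r i) * (x i + y r) = 1

/-- The `q`-ary message: block `i` of the message, padded with zeros, as a symbol. -/
noncomputable def messageSymbol (u : Fin k → Bool) (i : Fin (numBlocks k w)) :
    AdjoinRoot (modulusPoly C.modulus) :=
  symbol C.modulus fun j : Fin w => if h : i * w + j < k then u ⟨i * w + j, h⟩ else false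

/-- `x` is the codeword of `u`: the message itself, followed by the bits of the `c` MDS parity
symbols, every one of these bits being repeated `z * w + 1` times. -/
def IsCodeword (z : ℕ) (u : Fin k → Bool) (x : Bits) : Prop :=
  ∃ p : Fin c → Fin w → Bool,
    (∀ r, symbol C.modulus (p r) =
      ∑ i, symbol C.modulus (C.coeff r i) * C.messageSymbol u i) ∧
    x = List.ofFn u ++
      (List.ofFn fun r =>
        (List.ofFn fun j => List.replicate (z * w + 1) (p r j)).flatten).flatten

/-- The modulus and the coefficients as lists. -/
def modulusBits : Bits := List.ofFn C.modulus

def coeffBits : List (List Bits) :=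
  List.ofFn fun r => List.ofFn fun i => List.ofFn (C.coeff r i)

/-! ### Encoder -/

/-- The encoder. -/
def encode (z : ℕ) (u : Bits) : Timed Bits := do
  tick
  let U ← blocksT w (numBlocks k w) u
  let p ← paritiesT C.modulusBits C.coeffBits U
  let b ← flattenT p
  let r ← repeatT (z * w + 1) b
  appendT u r

/-! ### Decoder -/

/-- Check whether a string is consistent with all the parities. -/
def consistentT (p : List Bits) (v : Bits) : Timed Bool := do
  tick
  let U ← blocksT w (numBlocks k w) v
  let q ← paritiesT C.modulusBits C.coeffBits U
  let pb ← flattenT p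
  let qb ← flattenT q
  eqT pb qb

/-- One case: the windows start in the blocks `bs` and contain `ds` deleted message bits. Here `p`
are the parity symbols, `flags` the affected blocks, `e` their number, `G` the first `e` rows of the
coefficients of the parities, `M` the columns of `G` at the affected blocks, and `dinv` the inverse
of the determinant of `M`. The result is the decoded string if the case is possible. -/
def caseT (p : List Bits) (y : Bits) (bs : List ℕ) (flags : List Bool) (e : ℕ)
    (G M : List (List Bits)) (dinv : Bits) (ds : List ℕ) : Timed (Option Bits) := do
  tick
  let dl ← deletionsT bs ds (numBlocks k w) 0
  let pieces ← chunkT w flags dl k 0 0 0 y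
  match pieces with
  | none => return none
  | some ps => do
    let U ← knownSymbolsT w C.modulusBits ps
    let s ← syndromesT C.modulusBits G p U
    let X ← cramerT C.modulusBits e M dinv s e 0
    let filled ← fillT ps X
    match filled with
    | none => return none
    | some v => do
      let v' ← splitT k v
      let ok ← C.consistentT p v'.1
      if ok then return some v'.1 else return none

end Code

/-- The decoded strings of the possible cases found so far. -/
inductive Verdict where
  | nothing
  | unique (v : Bits)
  | conflict

/-- Take a further possible case into account. -/
def updateT : Verdict → Option Bits → Timed Verdict
  | s, none => do
    tick
    return s
  | Verdict.nothing, some v => do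
    tick
    return Verdict.unique v
  | Verdict.unique v', some v => do
    tick
    let ok ← eqT v' v
    if ok then return Verdict.unique v' else return Verdict.conflict
  | Verdict.conflict, some _ => do
    tick
    return Verdict.conflict

/-- Run through a list of cases. -/
def casesT (f : List ℕ → Timed (Option Bits)) : List (List ℕ) → Verdict → Timed Verdict
  | [], s => do
    tick
    return s
  | ds :: dss, s => do
    tick
    let o ← f ds
    let s' ← updateT s o
    casesT f dss s'

namespace Code

variable {k w c : ℕ} (C : Code k w c)

/-- All the cases in which the windows start in the blocks `bs`. -/
def positionT (p : List Bits) (y : Bits) (dss : List (List ℕ)) (bs : List ℕ) (s : Verdict) :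
    Timed Verdict := do
  tick
  let flags ← flagsT bs (numBlocks k w) 0
  let e ← countT flags
  let G ← splitT e C.coeffBits
  let M ← selectColsT flags G.1
  let d ← detT C.modulusBits e M
  let dinv ← invT w C.modulusBits d
  casesT (C.caseT p y bs flags e G.1 M dinv) dss s

/-- All the cases for a list of possible positions of the windows. -/
def positionsT (p : List Bits) (y : Bits) (dss : List (List ℕ)) :
    List (List ℕ) → Verdict → Timed Verdict
  | [], s => do
    tick
    return s
  | bs :: bss, s => do
    tick
    let s' ← C.positionT p y dss bs s
    positionsT p y dss bss s'

/-- The decoder: recover the parities from the repetition code, go through all the guesses for the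
blocks in which the `z` windows start and for the numbers (at most `w`) of message bits deleted in
each of them, and output the decoded string if all possible cases agree on it. The output
`none` is the declaration of a decoding failure. -/
def decode (z : ℕ) (y : Bits) : Timed (Option Bits) := do
  tick
  let t ← dropT k y
  let pb ← unrepeatT (z * w + 1) (c * w) t
  let p ← blocksT w c pb
  let bss ← tuplesT (numBlocks k w) z
  let dss ← tuplesT (w + 1) z
  let s ← C.positionsT p y dss bss Verdict.nothing
  match s with
  | Verdict.unique v => return some v
  | _ => return none

end Code

/-! ### Deletions -/

/-- `D` is a set of positions in a string of length `n`, localized in `z` windows of size at most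
`w` each, with at most `δ` deletions in each window. -/
def Localized (n z w δ : ℕ) (D : Finset ℕ) : Prop :=
  D ⊆ Finset.range n ∧ ∃ start size : Fin z → ℕ,
    (∀ i, size i ≤ w) ∧
    (∀ i, (D ∩ Finset.Ico (start i) (start i + size i)).card ≤ δ) ∧
    ∀ j ∈ D, ∃ i, j ∈ Finset.Ico (start i) (start i + size i)

/-- The string that remains of `x` when the positions in `D` (counted from zero) are deleted. -/
def deleteAt (D : Finset ℕ) (x : Bits) : Bits :=
  (x.zipIdx.filter fun a => a.2 ∉ D).map Prod.fst

namespace Code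

variable {k w c : ℕ} (C : Code k w c)

/-- The string received when `u` is sent and the positions in `D` are deleted. -/
def received (z : ℕ) (D : Finset ℕ) (u : Fin k → Bool) : Bits :=
  deleteAt D (C.encode z (List.ofFn u)).val

/-- Probability of a decoding failure for a uniform message of `k` bits and deleted positions `D`. -/
noncomputable def failureProb (z : ℕ) (D : Finset ℕ) : ℝ :=
  ((Finset.univ.filter fun u : Fin k → Bool =>
    (C.decode z (C.received z D u)).val = none).card : ℝ) / 2 ^ k

end Code

end GC

/-! Write `K` for the number of blocks. Two facts give correctness. First, at most `z * w` bits are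
lost, so the bit read `(z * w + 1) * i` places after position `k` of the received string still
belongs to the `i`-th run of `z * w + 1` repetitions, and the parities are recovered without error
(`Code.recovered_parities`). Second, the guess with the true starting blocks and the true numbers of
deletions chunks the received string correctly. By the MDS property the linear system for the erased
symbols is regular, so this guess returns the message (`Code.exists_guessResult_eq`). The message is
therefore always among the possible strings, and a failure means that some other guess is possible
and yields a wrong string (`Code.exists_wrong_of_decode_eq_none`).

The failure probability is a union bound over the `(K * (w + 1)) ^ z ≤ (4 * k) ^ z` guesses and the
two values `β` of the first parity bit. For a fixed guess and a fixed `β`, `IsShift.card_bad_le`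
bounds the number of bad messages by `2 ^ (k + 3 * z * w - c * w)`. In an intact block the decoded
bit `v i` is the codeword bit at the position `source i`, which does not depend on the message. This
position is below `k + z * w`, so outside the message it hits a copy of the first parity bit, that
is `β`.

For a bad message `u` with decoded string `v`, the error `d = u xor v` has zero parities. It
vanishes on the set `F` of intact positions fixed by `source`; let `S` be the complement of `F`.
More than `c` blocks meet `S`, since otherwise the MDS property forces `d = 0`. Choose `c` complete
ones among them. By the MDS property again, `d` is determined by its bits on `S` outside the chosen
blocks. Moreover `d`, together with the bits of `u` on `F` and on the erased blocks, determines `u`: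
elsewhere `u i` is the sum of `d i` and the bit of `u` at `source i`, and a strictly increasing map
cannot stay inside a finite set without having fixed points there (`IsShift.eq_of_agree`). The
number of free bits is at most `k - c * w`, plus `2 * z * w` for the erased positions, plus the
number of fixed positions in the chosen blocks.

The last number is at most `z * w` (`IsShift.card_fixed_le`). In a block which is not entirely
fixed, the interval of fixed points ends next to a deletion in the same block. Sending a fixed point
to the window of such a deletion and to its own residue modulo `w` is injective: two fixed points
with the same image would lie `w` apart in neighbouring intact blocks, and the lead or lag of the
reading at their deletions contradicts the monotonicity of `source`.

The running time is the number of guesses times `O(k * w)` for each: schoolbook multiplication costs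
`O(w ^ 2)` and there are about `k / w` symbols. Codes exist because Cauchy matrices are MDS, by
interpolation. -/

namespace GC

/-! ### Values and costs of the elementary list procedures -/

namespace Timed

@[simp] theorem val_pure {α : Type} (a : α) : (pure a : Timed α).val = a := rfl
@[simp] theorem cost_pure {α : Type} (a : α) : (pure a : Timed α).cost = 0 := rfl
@[simp] theorem val_bind {α β : Type} (x : Timed α) (f : α → Timed β) :
    (x >>= f).val = (f x.val).val := rfl
@[simp] theorem cost_bind {α β : Type} (x : Timed α) (f : α → Timed β) :
    (x >>= f).cost = x.cost + (f x.val).cost := rfl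

end Timed

@[simp] theorem cost_tick : tick.cost = 1 := rfl

@[simp] theorem appendT_val (a b : Bits) : (appendT a b).val = a ++ b := by
  induction a with
  | nil => simp [appendT]
  | cons x a ih => simp [appendT, ih]

@[simp] theorem appendT_cost (a b : Bits) : (appendT a b).cost = a.length + 1 := by
  induction a with
  | nil => simp [appendT]
  | cons x a ih => simp [appendT, ih]; omega

@[simp] theorem flattenT_val (l : List Bits) : (flattenT l).val = l.flatten := by
  induction l with
  | nil => simp [flattenT]
  | cons x a ih => simp [flattenT, ih]

theorem flattenT_cost {W : ℕ} {l : List Bits} (h : ∀ b ∈ l, b.length ≤ W) :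
    (flattenT l).cost ≤ l.length * (W + 2) + 1 := by
  induction l with
  | nil => simp [flattenT]
  | cons x a ih =>
    have h1 := h x (by simp)
    have h2 := ih fun b hb => h b (by simp [hb])
    simp only [flattenT, Timed.cost_bind, cost_tick, appendT_cost, List.length_cons]
    nlinarith

@[simp] theorem dropT_val (n : ℕ) (l : Bits) : (dropT n l).val = l.drop n := by
  induction n generalizing l with
  | zero => simp [dropT]
  | succ n ih => cases l <;> simp [dropT, ih]

theorem dropT_cost (n : ℕ) (l : Bits) : (dropT n l).cost ≤ n + 1 := by
  induction n generalizing l with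
  | zero => simp [dropT]
  | succ n ih =>
    cases l with
    | nil => simp [dropT]
    | cons b l => simp only [dropT, Timed.cost_bind, cost_tick]; have := ih l; omega

@[simp] theorem splitT_val {α : Type} (n : ℕ) (l : List α) :
    (splitT n l).val = (l.take n, l.drop n) := by
  induction n generalizing l with
  | zero => simp [splitT]
  | succ n ih => cases l <;> simp [splitT, ih]

theorem splitT_cost {α : Type} (n : ℕ) (l : List α) : (splitT n l).cost ≤ n + 1 := by
  induction n generalizing l with
  | zero => simp [splitT]
  | succ n ih =>
    cases l with
    | nil => simp [splitT]
    | cons b l =>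
      simp only [splitT, Timed.cost_bind, cost_tick, Timed.cost_pure]; have := ih l; omega

theorem splitPadT_val (n : ℕ) (l : Bits) :
    (splitPadT n l).val = (List.ofFn fun j : Fin n => l.getD j false, l.drop n) := by
  induction n generalizing l with
  | zero => simp [splitPadT]
  | succ n ih => cases l <;> simp [splitPadT, ih, List.ofFn_succ]

@[simp] theorem splitPadT_cost (n : ℕ) (l : Bits) : (splitPadT n l).cost = n + 1 := by
  induction n generalizing l with
  | zero => simp [splitPadT]
  | succ n ih => cases l <;> simp [splitPadT, ih] <;> omega

theorem blocksT_val (w K : ℕ) (l : Bits) :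
    (blocksT w K l).val =
      List.ofFn fun i : Fin K => List.ofFn fun j : Fin w => l.getD (i * w + j) false := by
  induction K generalizing l with
  | zero => simp [blocksT]
  | succ K ih =>
    simp only [blocksT, Timed.val_bind, splitPadT_val, ih, Timed.val_pure, List.ofFn_succ]
    congr 1
    · congr 1; funext j; simp
    · congr 1; funext i; congr 1; funext j
      simp [List.getD_eq_getElem?_getD, List.getElem?_drop]
      congr 2; ring

@[simp] theorem blocksT_cost (w K : ℕ) (l : Bits) :
    (blocksT w K l).cost = K * (w + 2) + 1 := by
  induction K generalizing l with
  | zero => simp [blocksT]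
  | succ K ih => simp [blocksT, ih]; ring

@[simp] theorem replicateT_val (b : Bool) (n : ℕ) (l : Bits) :
    (replicateT b n l).val = List.replicate n b ++ l := by
  induction n with
  | zero => simp [replicateT]
  | succ n ih => simp [replicateT, ih, List.replicate_succ]

@[simp] theorem replicateT_cost (b : Bool) (n : ℕ) (l : Bits) :
    (replicateT b n l).cost = n + 1 := by
  induction n with
  | zero => simp [replicateT]
  | succ n ih => simp [replicateT, ih]; omega

@[simp] theorem repeatT_val (n : ℕ) (l : Bits) :
    (repeatT n l).val = (l.map (List.replicate n)).flatten := by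
  induction l with
  | nil => simp [repeatT]
  | cons b l ih => simp [repeatT, ih]

@[simp] theorem repeatT_cost (n : ℕ) (l : Bits) :
    (repeatT n l).cost = l.length * (n + 2) + 1 := by
  induction l with
  | nil => simp [repeatT]
  | cons b l ih => simp [repeatT, ih]; ring

/-- For `j ≥ 1` the hypothesis places the last position read, `n * (j - 1)`, inside the string; on a
shorter string the procedure would stop early. -/
theorem unrepeatT_val (n j : ℕ) (l : Bits) (h : n * j < l.length + n) :
    (unrepeatT n j l).val = List.ofFn fun i : Fin j => l.getD (n * i) false := by
  induction j generalizing l with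
  | zero => simp [unrepeatT]
  | succ j ih =>
    cases l with
    | nil =>
      exfalso
      simp only [List.length_nil] at h
      nlinarith
    | cons b l =>
      have h' : n * j < ((b :: l).drop n).length + n := by
        rw [List.length_drop]
        simp only [List.length_cons] at h ⊢
        rw [Nat.mul_succ] at h
        omega
      simp only [unrepeatT, Timed.val_bind, dropT_val, ih _ h', Timed.val_pure, List.ofFn_succ]
      congr 1
      congr 1; funext i
      simp only [List.getD_eq_getElem?_getD, List.getElem?_drop]
      congr 2; simp; ring

theorem unrepeatT_cost (n j : ℕ) (l : Bits) : (unrepeatT n j l).cost ≤ j * (n + 2) + 1 := by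
  induction j generalizing l with
  | zero => simp [unrepeatT]
  | succ j ih =>
    cases l with
    | nil => simp [unrepeatT]
    | cons b l =>
      simp only [unrepeatT, Timed.cost_bind, cost_tick, Timed.cost_pure, dropT_val]
      have h1 := ih ((b :: l).drop n)
      have h2 := dropT_cost n (b :: l)
      nlinarith

@[simp] theorem eqT_val (a b : Bits) : (eqT a b).val = decide (a = b) := by
  induction a generalizing b with
  | nil => cases b <;> simp [eqT]
  | cons x a ih =>
    cases b with
    | nil => simp [eqT]
    | cons y b => simp [eqT, ih, Bool.beq_eq_decide_eq]

theorem eqT_cost (a b : Bits) : (eqT a b).cost ≤ a.length + 1 := by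
  induction a generalizing b with
  | nil => cases b <;> simp [eqT]
  | cons x a ih =>
    cases b with
    | nil => simp [eqT]
    | cons y b => simp [eqT]; have := ih b; omega

/-- The comparison stops at the end of the shorter string, so either length bounds it.
`updateT_cost` has a bound for the new string only. -/
theorem eqT_cost_right (a b : Bits) : (eqT a b).cost ≤ b.length + 1 := by
  induction a generalizing b with
  | nil => cases b <;> simp [eqT]
  | cons x a ih =>
    cases b with
    | nil => simp [eqT]
    | cons y b => simp [eqT]; have := ih b; omega

/-- Matching a letter at its first occurrence never spoils an embedding. This direction suffices:
the correct guess must pass the test, and the count of wrong guesses ignores it. -/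
theorem supersequenceT_val {a b : Bits} (h : a.Sublist b) : (supersequenceT a b).val = true := by
  induction b generalizing a with
  | nil => simp at h; subst h; simp [supersequenceT]
  | cons y b ih =>
    cases a with
    | nil => simp [supersequenceT]
    | cons x a =>
      simp only [supersequenceT, Timed.val_bind]
      split
      · next hxy =>
        simp only [beq_iff_eq] at hxy
        subst hxy
        exact ih (List.cons_sublist_cons.1 h)
      · next hxy =>
        apply ih
        cases h with
        | cons _ h => exact h
        | cons_cons _ h => simp at hxy

theorem supersequenceT_cost (a b : Bits) : (supersequenceT a b).cost ≤ b.length + 1 := by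
  induction b generalizing a with
  | nil => cases a <;> simp [supersequenceT]
  | cons y b ih =>
    cases a with
    | nil => simp [supersequenceT]
    | cons x a =>
      simp only [supersequenceT, Timed.cost_bind, cost_tick, List.length_cons]
      split
      · have := ih a; omega
      · have := ih (x :: a); omega

@[simp] theorem removeT_val (j : ℕ) (l : List Bits) : (removeT j l).val = l.eraseIdx j := by
  induction l generalizing j with
  | nil => simp [removeT]
  | cons a l ih => cases j <;> simp [removeT, ih]

theorem removeT_cost (j : ℕ) (l : List Bits) : (removeT j l).cost ≤ l.length + 1 := by
  induction l generalizing j with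
  | nil => simp [removeT]
  | cons a l ih =>
    cases j with
    | zero => simp [removeT]
    | succ j => simp [removeT]; have := ih j; omega

@[simp] theorem removeColT_val (j : ℕ) (M : List (List Bits)) :
    (removeColT j M).val = M.map fun r => r.eraseIdx j := by
  induction M with
  | nil => simp [removeColT]
  | cons a l ih => simp [removeColT, ih]

theorem removeColT_cost {N : ℕ} (j : ℕ) {M : List (List Bits)} (h : ∀ r ∈ M, r.length ≤ N) :
    (removeColT j M).cost ≤ M.length * (N + 2) + 1 := by
  induction M with
  | nil => simp [removeColT]
  | cons a l ih =>
    have h1 := h a (by simp)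
    have h2 := ih fun b hb => h b (by simp [hb])
    have h3 := removeT_cost j a
    simp [removeColT]
    nlinarith

@[simp] theorem setT_val (s : Bits) (j : ℕ) (l : List Bits) : (setT s j l).val = l.set j s := by
  induction l generalizing j with
  | nil => simp [setT]
  | cons a l ih => cases j <;> simp [setT, ih]

theorem setT_cost (s : Bits) (j : ℕ) (l : List Bits) : (setT s j l).cost ≤ l.length + 1 := by
  induction l generalizing j with
  | nil => simp [setT]
  | cons a l ih =>
    cases j with
    | zero => simp [setT]
    | succ j => simp [setT]; have := ih j; omega

@[simp] theorem setColT_val (j : ℕ) (M : List (List Bits)) (s : List Bits) :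
    (setColT j M s).val = List.zipWith (fun r x => r.set j x) M s := by
  induction M generalizing s with
  | nil => simp [setColT]
  | cons a l ih => cases s <;> simp [setColT, ih]

theorem setColT_cost {N : ℕ} (j : ℕ) {M : List (List Bits)} (h : ∀ r ∈ M, r.length ≤ N)
    (s : List Bits) : (setColT j M s).cost ≤ M.length * (N + 2) + 1 := by
  induction M generalizing s with
  | nil => simp [setColT]
  | cons a l ih =>
    cases s with
    | nil => simp [setColT]
    | cons x s =>
      have h1 := h a (by simp)
      have h2 := ih (fun b hb => h b (by simp [hb])) s
      have h3 := setT_cost x j a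
      simp [setColT]
      nlinarith

/-! ### Guesses -/

@[simp] theorem consAllT_val (a : ℕ) (ts l : List (List ℕ)) :
    (consAllT a ts l).val = ts.map (a :: ·) ++ l := by
  induction ts with
  | nil => simp [consAllT]
  | cons t ts ih => simp [consAllT, ih]

@[simp] theorem consAllT_cost (a : ℕ) (ts l : List (List ℕ)) :
    (consAllT a ts l).cost = ts.length + 1 := by
  induction ts with
  | nil => simp [consAllT]
  | cons t ts ih => simp [consAllT, ih]; omega

theorem mem_extendT {ts : List (List ℕ)} {N : ℕ} {t : List ℕ} :
    t ∈ (extendT ts N).val ↔ ∃ a < N, ∃ s ∈ ts, t = a :: s := by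
  induction N with
  | zero => simp [extendT]
  | succ N ih =>
    simp only [extendT, Timed.val_bind, consAllT_val, List.mem_append, List.mem_map, ih]
    constructor
    · rintro (⟨s, hs, rfl⟩ | ⟨a, ha, s, hs, rfl⟩)
      · exact ⟨N, by omega, s, hs, rfl⟩
      · exact ⟨a, by omega, s, hs, rfl⟩
    · rintro ⟨a, ha, s, hs, rfl⟩
      rcases Nat.lt_succ_iff_lt_or_eq.1 ha with h | rfl
      · exact Or.inr ⟨a, h, s, hs, rfl⟩
      · exact Or.inl ⟨s, hs, rfl⟩

theorem extendT_length (ts : List (List ℕ)) (N : ℕ) :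
    (extendT ts N).val.length = N * ts.length := by
  induction N with
  | zero => simp [extendT]
  | succ N ih => simp [extendT, ih]; ring

theorem extendT_cost (ts : List (List ℕ)) (N : ℕ) :
    (extendT ts N).cost = N * (ts.length + 2) + 1 := by
  induction N with
  | zero => simp [extendT]
  | succ N ih => simp [extendT, ih]; ring

theorem mem_tuplesT {N z : ℕ} {t : List ℕ} :
    t ∈ (tuplesT N z).val ↔ t.length = z ∧ ∀ a ∈ t, a < N := by
  induction z generalizing t with
  | zero =>
    simp only [tuplesT, Timed.val_bind, Timed.val_pure, List.mem_singleton]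
    constructor
    · rintro rfl; simp
    · rintro ⟨h, -⟩; exact List.length_eq_zero_iff.1 h
  | succ z ih =>
    simp only [tuplesT, Timed.val_bind, mem_extendT]
    constructor
    · rintro ⟨a, ha, s, hs, rfl⟩
      obtain ⟨h1, h2⟩ := ih.1 hs
      simp [h1, ha]
      exact h2
    · rintro ⟨h1, h2⟩
      obtain ⟨a, s, rfl⟩ := List.exists_cons_of_length_eq_add_one h1
      exact ⟨a, h2 a (by simp), s, ih.2 ⟨by simpa using h1, fun b hb => h2 b (by simp [hb])⟩, rfl⟩

theorem tuplesT_length (N z : ℕ) : (tuplesT N z).val.length = N ^ z := by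
  induction z with
  | zero => simp [tuplesT]
  | succ z ih => simp [tuplesT, extendT_length, ih, pow_succ, mul_comm]

theorem tuplesT_cost {N : ℕ} (hN : 0 < N) (z : ℕ) : (tuplesT N z).cost ≤ (5 * z + 1) * N ^ z := by
  induction z with
  | zero => simp [tuplesT]
  | succ z ih =>
    have h1 : 0 < N ^ z := by positivity
    simp only [tuplesT, Timed.cost_bind, cost_tick, extendT_cost, tuplesT_length]
    have h2 : N ^ (z + 1) = N * N ^ z := by ring
    have h3 : (5 * z + 1) * N ^ z ≤ N * ((5 * z + 1) * N ^ z) := Nat.le_mul_of_pos_left _ hN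
    have h4 : N ≤ N * N ^ z := Nat.le_mul_of_pos_right _ h1
    rw [h2]
    nlinarith

theorem affectedT_val (b : ℕ) (bs : List ℕ) :
    (affectedT b bs).val = bs.any fun a => (b == a) || (b == a + 1) := by
  induction bs with
  | nil => simp [affectedT]
  | cons a bs ih => simp [affectedT, ih]

@[simp] theorem affectedT_cost (b : ℕ) (bs : List ℕ) : (affectedT b bs).cost = bs.length + 1 := by
  induction bs with
  | nil => simp [affectedT]
  | cons a bs ih => simp [affectedT, ih]; omega

theorem flagsT_val (bs : List ℕ) (K b : ℕ) :
    (flagsT bs K b).val = List.ofFn fun i : Fin K => (affectedT (b + i) bs).val := by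
  induction K generalizing b with
  | zero => simp [flagsT]
  | succ K ih =>
    simp only [flagsT, Timed.val_bind, ih, Timed.val_pure, List.ofFn_succ]
    congr 2; funext i; congr 2; simp; ring

@[simp] theorem flagsT_cost (bs : List ℕ) (K b : ℕ) :
    (flagsT bs K b).cost = K * (bs.length + 2) + 1 := by
  induction K generalizing b with
  | zero => simp [flagsT]
  | succ K ih => simp [flagsT, ih]; ring

theorem deletedT_cost (b : ℕ) (bs ds : List ℕ) : (deletedT b bs ds).cost ≤ bs.length + 1 := by
  induction bs generalizing ds with
  | nil => simp [deletedT]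
  | cons a bs ih =>
    cases ds with
    | nil => simp [deletedT]
    | cons d ds => simp [deletedT]; have := ih ds; omega

theorem deletedT_val (b : ℕ) {z : ℕ} (bs ds : Fin z → ℕ) :
    (deletedT b (List.ofFn bs) (List.ofFn ds)).val = ∑ i, if bs i = b then ds i else 0 := by
  induction z with
  | zero => simp [deletedT]
  | succ z ih =>
    simp only [List.ofFn_succ, deletedT, Timed.val_bind, Timed.val_pure, ih, Fin.sum_univ_succ]
    by_cases h : b = bs 0
    · simp [h]
    · simp [h, Ne.symm h]

theorem deletionsT_val (bs ds : List ℕ) (K b : ℕ) :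
    (deletionsT bs ds K b).val = List.ofFn fun i : Fin K => (deletedT (b + i) bs ds).val := by
  induction K generalizing b with
  | zero => simp [deletionsT]
  | succ K ih =>
    simp only [deletionsT, Timed.val_bind, ih, Timed.val_pure, List.ofFn_succ]
    congr 2; funext i; congr 2; simp; ring

theorem deletionsT_cost (bs ds : List ℕ) (K b : ℕ) :
    (deletionsT bs ds K b).cost ≤ K * (bs.length + 2) + 1 := by
  induction K generalizing b with
  | zero => simp [deletionsT]
  | succ K ih =>
    simp only [deletionsT, Timed.cost_bind, cost_tick, Timed.cost_pure]
    have h1 := ih (b + 1)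
    have h2 := deletedT_cost b bs ds
    nlinarith

@[simp] theorem countT_val (l : List Bool) : (countT l).val = l.count true := by
  induction l with
  | nil => simp [countT]
  | cons a l ih => cases a <;> simp [countT, ih]

@[simp] theorem countT_cost (l : List Bool) : (countT l).cost = l.length + 1 := by
  induction l with
  | nil => simp [countT]
  | cons a l ih => cases a <;> simp [countT, ih] <;> omega

/-- The entries of a list at the positions flagged `true`. -/
def selected {α : Type} : List Bool → List α → List α
  | a :: l, x :: xs => if a then x :: selected l xs else selected l xs
  | _, _ => []

@[simp] theorem selectT_val (fl : List Bool) (l : List Bits) :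
    (selectT fl l).val = selected fl l := by
  induction fl generalizing l with
  | nil => simp [selectT, selected]
  | cons a fl ih => cases l <;> simp [selectT, ih, selected]

theorem selectT_cost (fl : List Bool) (l : List Bits) : (selectT fl l).cost ≤ fl.length + 1 := by
  induction fl generalizing l with
  | nil => simp [selectT]
  | cons a fl ih =>
    cases l with
    | nil => simp [selectT]
    | cons x l => simp [selectT]; have := ih l; omega

@[simp] theorem selectColsT_val (fl : List Bool) (M : List (List Bits)) :
    (selectColsT fl M).val = M.map (selected fl) := by
  induction M with
  | nil => simp [selectColsT]
  | cons a M ih => simp [selectColsT, ih]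

theorem selectColsT_cost (fl : List Bool) (M : List (List Bits)) :
    (selectColsT fl M).cost ≤ M.length * (fl.length + 2) + 1 := by
  induction M with
  | nil => simp [selectColsT]
  | cons a M ih =>
    simp [selectColsT]
    have := selectT_cost fl a
    nlinarith

/-- Lets `Code.cramerT_syndromes` treat coefficients and message blocks alike, as images of one list
of selected indices. -/
theorem selected_map {α β : Type} (f : α → β) (fl : List Bool) (l : List α) :
    selected fl (l.map f) = (selected fl l).map f := by
  induction fl generalizing l with
  | nil => simp [selected]
  | cons a fl ih =>
    cases l with
    | nil => simp [selected]
    | cons x l => cases a <;> simp [selected, ih]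

theorem selected_sublist {α : Type} (fl : List Bool) (l : List α) :
    (selected fl l).Sublist l := by
  induction fl generalizing l with
  | nil => simp [selected]
  | cons a fl ih =>
    cases l with
    | nil => simp [selected]
    | cons x l =>
      cases a
      · exact (ih l).trans (List.sublist_cons_self x l)
      · exact (ih l).cons_cons x

theorem length_selected_le {α : Type} (fl : List Bool) (l : List α) :
    (selected fl l).length ≤ fl.count true := by
  induction fl generalizing l with
  | nil => simp [selected]
  | cons a fl ih =>
    cases l with
    | nil => simp [selected]
    | cons x l => cases a <;> simp [selected, ih]

theorem length_selected {α : Type} {fl : List Bool} {l : List α} (h : fl.length = l.length) :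
    (selected fl l).length = fl.count true := by
  induction fl generalizing l with
  | nil => simp [selected]
  | cons a fl ih =>
    cases l with
    | nil => simp at h
    | cons x l => cases a <;> simp [selected, ih (by simpa using h : fl.length = l.length)]

end GC

/-! ### The finite field: representation of elements, inversion, inner products. -/

namespace GC

/-! ### Arithmetic of `GF(2^w)` on lists of bits -/

section Field

variable {w : ℕ} (m : Fin w → Bool)

/-- The element of `GF(2)[X] / (modulus)` represented by a list of bits. -/
noncomputable def sym : Bits → AdjoinRoot (modulusPoly m)
  | [] => 0
  | a :: l => (if a then 1 else 0) + AdjoinRoot.root (modulusPoly m) * sym l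

theorem sym_add_self (x : AdjoinRoot (modulusPoly m)) : x + x = 0 := by
  have h : (2 : AdjoinRoot (modulusPoly m)) = 0 := by
    have h2 : (2 : ZMod 2) = 0 := rfl
    have := congrArg (AdjoinRoot.of (modulusPoly m)) h2
    rwa [map_zero, map_ofNat] at this
  rw [← two_mul, h, zero_mul]

theorem bit_xor (a b : Bool) :
    ((if xor a b then 1 else 0 : AdjoinRoot (modulusPoly m))) =
      (if a then 1 else 0) + (if b then 1 else 0) := by
  cases a <;> cases b <;> simp [sym_add_self]

theorem sym_ofFn {n : ℕ} (f : Fin n → Bool) :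
    sym m (List.ofFn f) =
      ∑ i : Fin n, if f i then AdjoinRoot.root (modulusPoly m) ^ (i : ℕ) else 0 := by
  induction n with
  | zero => simp [sym]
  | succ n ih =>
    rw [List.ofFn_succ, sym, ih, Fin.sum_univ_succ, Finset.mul_sum]
    simp [pow_succ', mul_ite]

theorem symbol_eq_sym (f : Fin w → Bool) : symbol m f = sym m (List.ofFn f) := by
  rw [sym_ofFn, symbol]

theorem sym_of_length {l : Bits} (h : l.length = w) :
    sym m l = symbol m fun i => l.getD i false := by
  subst h
  rw [symbol_eq_sym]
  congr 1
  apply List.ext_getElem <;> simp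

theorem addT_length (a b : Bits) : (addT a b).val.length = min a.length b.length := by
  induction a generalizing b with
  | nil => simp [addT]
  | cons x a ih => cases b <;> simp [addT, ih]

theorem addT_cost (a b : Bits) : (addT a b).cost ≤ a.length + 1 := by
  induction a generalizing b with
  | nil => simp [addT]
  | cons x a ih =>
    cases b with
    | nil => simp [addT]
    | cons y b => simp [addT]; have := ih b; omega

theorem addT_cost_right (a b : Bits) : (addT a b).cost ≤ b.length + 1 := by
  induction a generalizing b with
  | nil => simp [addT]
  | cons x a ih =>
    cases b with
    | nil => simp [addT]
    | cons y b => simp [addT]; have := ih b; omega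

theorem sym_addT {a b : Bits} (h : a.length = b.length) :
    sym m (addT a b).val = sym m a + sym m b := by
  induction a generalizing b with
  | nil =>
    obtain rfl := List.length_eq_zero_iff.1 h.symm
    simp [addT, sym]
  | cons x a ih =>
    cases b with
    | nil => simp at h
    | cons y b =>
      simp only [addT, Timed.val_bind, Timed.val_pure, sym, ih (by simpa using h), bit_xor]
      ring

@[simp] theorem zeroT_val (l : Bits) : (zeroT l).val = List.replicate l.length false := by
  induction l with
  | nil => simp [zeroT]
  | cons x a ih => simp [zeroT, ih, List.replicate_succ]

@[simp] theorem zeroT_cost (l : Bits) : (zeroT l).cost = l.length + 1 := by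
  induction l with
  | nil => simp [zeroT]
  | cons x a ih => simp [zeroT, ih]; omega

@[simp] theorem sym_replicate_false (n : ℕ) : sym m (List.replicate n false) = 0 := by
  induction n with
  | zero => simp [sym]
  | succ n ih => simp [List.replicate_succ, sym, ih]

theorem oneT_length (l : Bits) : (oneT l).val.length = l.length := by
  cases l <;> simp [oneT]

theorem oneT_cost (l : Bits) : (oneT l).cost ≤ l.length + 1 := by
  cases l <;> simp [oneT]; omega

theorem sym_oneT {l : Bits} (h : l ≠ []) : sym m (oneT l).val = 1 := by
  cases l with
  | nil => simp at h
  | cons a l => simp [oneT, sym]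

theorem shiftT_length (b : Bool) (l : Bits) : (shiftT b l).val.1.length = l.length := by
  induction l generalizing b with
  | nil => simp [shiftT]
  | cons x a ih => simp [shiftT, ih]

theorem shiftT_cost (b : Bool) (l : Bits) : (shiftT b l).cost = l.length + 1 := by
  induction l generalizing b with
  | nil => simp [shiftT]
  | cons x a ih => simp [shiftT, ih]; omega

/-- Invariant of multiplication by the root: the incoming carry has weight one, and the coordinate
pushed out at the top has weight `root ^ l.length`. -/
theorem sym_shiftT (b : Bool) (l : Bits) :
    sym m (shiftT b l).val.1 +
        (if (shiftT b l).val.2 then AdjoinRoot.root (modulusPoly m) ^ l.length else 0) =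
      (if b then 1 else 0) + AdjoinRoot.root (modulusPoly m) * sym m l := by
  induction l generalizing b with
  | nil => simp [shiftT, sym]
  | cons x a ih =>
    have h := ih x
    simp only [shiftT, Timed.val_bind, Timed.val_pure, sym, List.length_cons] at h ⊢
    rw [← h, add_assoc, mul_add]
    congr 2
    rw [mul_ite, mul_zero, pow_succ']
    rfl

/-- The modulus vanishes at its root and signs do not matter in characteristic two. Hence `mulXT`
may add the lower coefficients of the modulus for the bit shifted out. -/
theorem root_pow : AdjoinRoot.root (modulusPoly m) ^ w = sym m (List.ofFn m) := by
  have h : AdjoinRoot.mk (modulusPoly m) (modulusPoly m) = 0 := AdjoinRoot.mk_self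
  have h2 : AdjoinRoot.mk (modulusPoly m) (modulusPoly m) =
      AdjoinRoot.root (modulusPoly m) ^ w + sym m (List.ofFn m) := by
    rw [sym_ofFn]
    have h3 (p : (ZMod 2)[X]) (hp : p = X ^ w + ∑ i : Fin w, if m i then X ^ (i : ℕ) else 0) :
        AdjoinRoot.mk (modulusPoly m) p = AdjoinRoot.root (modulusPoly m) ^ w +
          ∑ i : Fin w, if m i then AdjoinRoot.root (modulusPoly m) ^ (i : ℕ) else 0 := by
      rw [hp, map_add, map_pow, AdjoinRoot.mk_X, map_sum]
      congr 1
      refine Finset.sum_congr rfl fun i _ => ?_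
      split
      · rw [map_pow, AdjoinRoot.mk_X]
      · exact map_zero _
    exact h3 _ rfl
  rw [h2] at h
  calc _ = AdjoinRoot.root (modulusPoly m) ^ w + sym m (List.ofFn m) + sym m (List.ofFn m) := by
        rw [add_assoc, sym_add_self, add_zero]
    _ = _ := by rw [h, zero_add]

theorem mulXT_length_le (l a : Bits) : (mulXT l a).val.length ≤ a.length := by
  simp only [mulXT, Timed.val_bind]
  split
  · simp [addT_length, shiftT_length]
  · simp [shiftT_length]

theorem mulXT_length {l a : Bits} (h : a.length = l.length) :
    (mulXT l a).val.length = l.length := by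
  simp only [mulXT, Timed.val_bind]
  split
  · simp [addT_length, shiftT_length, h]
  · simp [shiftT_length, h]

theorem mulXT_cost (l a : Bits) : (mulXT l a).cost ≤ 2 * a.length + 3 := by
  simp only [mulXT, Timed.cost_bind, cost_tick, shiftT_cost]
  split
  · have := addT_cost (shiftT false a).val.1 l
    rw [shiftT_length] at this
    omega
  · simp; omega

theorem sym_mulXT {a : Bits} (h : a.length = w) :
    sym m (mulXT (List.ofFn m) a).val = AdjoinRoot.root (modulusPoly m) * sym m a := by
  have h1 := sym_shiftT m false a
  simp only [mulXT, Timed.val_bind]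
  rw [h, root_pow] at h1
  split
  · next h2 =>
    rw [sym_addT _ (by simp [shiftT_length, h])]
    simpa [h2] using h1
  · next h2 => simpa [h2] using h1

theorem mulT_length_le (l a b : Bits) : (mulT l a b).val.length ≤ l.length := by
  induction a with
  | nil => simp [mulT]
  | cons x a ih =>
    have h1 := mulXT_length_le l (mulT l a b).val
    simp only [mulT, Timed.val_bind]
    split
    · rw [addT_length]; omega
    · exact h1.trans ih

theorem mulT_length {l b : Bits} (h : b.length = l.length) (a : Bits) :
    (mulT l a b).val.length = l.length := by
  induction a with
  | nil => simp [mulT]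
  | cons x a ih =>
    have h1 := mulXT_length ih
    simp only [mulT, Timed.val_bind]
    split
    · rw [addT_length]; omega
    · exact h1

theorem mulT_cost_aux (l a b : Bits) :
    (mulT l a b).cost ≤ a.length * (3 * l.length + 5) + l.length + 2 := by
  induction a with
  | nil => simp [mulT]; omega
  | cons x a ih =>
    have h0 := mulT_length_le l a b
    have h1 := mulXT_cost l (mulT l a b).val
    have h2 := mulXT_length_le l (mulT l a b).val
    have h3 := addT_cost (mulXT l (mulT l a b).val).val b
    simp only [mulT, Timed.cost_bind, cost_tick, List.length_cons]
    split
    · nlinarith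
    · simp only [Timed.cost_pure]; nlinarith

theorem mulT_cost {w : ℕ} (hw : 1 ≤ w) {l a : Bits} (hl : l.length = w) (ha : a.length ≤ w)
    (b : Bits) : (mulT l a b).cost ≤ 11 * w ^ 2 := by
  have h := mulT_cost_aux l a b
  rw [hl] at h
  have : a.length * (3 * w + 5) ≤ w * (3 * w + 5) := Nat.mul_le_mul_right _ ha
  nlinarith

theorem sym_mulT (a : Bits) {b : Bits} (h : b.length = w) :
    sym m (mulT (List.ofFn m) a b).val = sym m a * sym m b := by
  induction a with
  | nil => simp [mulT, sym]
  | cons x a ih =>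
    have h0 : (mulT (List.ofFn m) a b).val.length = w := by
      rw [mulT_length] <;> simp [h]
    have h1 := sym_mulXT m h0
    have h2 : (mulXT (List.ofFn m) (mulT (List.ofFn m) a b).val).val.length = w := by
      rw [mulXT_length] <;> simp [h0]
    simp only [mulT, Timed.val_bind, sym]
    cases x
    · simp [h1, ih, mul_assoc]
    · simp only [if_true]
      rw [sym_addT m (h2.trans h.symm), h1, ih]
      ring

/-! ### Representation of the field elements -/

theorem degree_lower_lt (f : Fin w → Bool) :
    (∑ i : Fin w, if f i then (X : (ZMod 2)[X]) ^ (i : ℕ) else 0).degree < w := by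
  refine (Polynomial.degree_sum_le _ _).trans_lt ?_
  refine (Finset.sup_lt_iff (WithBot.bot_lt_coe w)).2 ?_
  intro i _
  split
  · rw [degree_X_pow]; exact WithBot.coe_lt_coe.2 i.2
  · simp

theorem coeff_lower (f : Fin w → Bool) (j : Fin w) :
    (∑ i : Fin w, if f i then (X : (ZMod 2)[X]) ^ (i : ℕ) else 0).coeff j =
      if f j then 1 else 0 := by
  rw [finsetSum_coeff, Finset.sum_eq_single j]
  · split <;> simp
  · intro i _ hi
    split
    · rw [coeff_X_pow, if_neg]; exact fun h => hi (Fin.ext h.symm)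
    · simp
  · simp

theorem modulusPoly_monic : (modulusPoly m).Monic :=
  monic_X_pow_add (degree_lower_lt m)

theorem modulusPoly_degree : (modulusPoly m).degree = w :=
  by
  rw [modulusPoly, degree_add_eq_left_of_degree_lt, degree_X_pow]
  rw [degree_X_pow]
  exact degree_lower_lt m

theorem symbol_eq_mk (f : Fin w → Bool) :
    symbol m f = AdjoinRoot.mk (modulusPoly m) (∑ i : Fin w, if f i then X ^ (i : ℕ) else 0) := by
  rw [symbol, map_sum]
  refine Finset.sum_congr rfl fun i _ => ?_
  split
  · rw [map_pow, AdjoinRoot.mk_X]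
  · rw [map_zero]

/-- The difference of two representatives has degree below `w`, and zero is the only such multiple
of a polynomial of degree `w`. -/
theorem symbol_injective : Function.Injective (symbol m) := by
  intro f g h
  rw [symbol_eq_mk, symbol_eq_mk, AdjoinRoot.mk_eq_mk] at h
  have h0 := eq_zero_of_dvd_of_degree_lt h (by
    rw [modulusPoly_degree]
    exact (degree_sub_le _ _).trans_lt (max_lt (degree_lower_lt f) (degree_lower_lt g)))
  funext j
  have h1 := congrArg (fun p => p.coeff j) (sub_eq_zero.1 h0)
  simp only [coeff_lower] at h1
  cases hf : f j <;> cases hg : g j <;> simp_all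

/-- A nonzero coefficient in `ZMod 2` is one, so testing coefficients against zero loses nothing. -/
theorem lower_eq_of_degree_lt {q : (ZMod 2)[X]} (hq : q.degree < w) :
    (∑ i : Fin w, if decide (q.coeff i ≠ 0) = true then (X : (ZMod 2)[X]) ^ (i : ℕ) else 0) =
      q := by
  ext j
  by_cases hj : j < w
  · have := coeff_lower (fun i : Fin w => decide (q.coeff i ≠ 0)) ⟨j, hj⟩
    simp only at this
    rw [this]
    generalize q.coeff j = a
    revert a; decide
  · rw [coeff_eq_zero_of_degree_lt, coeff_eq_zero_of_degree_lt]
    · exact hq.trans_le (by exact_mod_cast not_lt.1 hj)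
    · exact (degree_lower_lt _).trans_le (by exact_mod_cast not_lt.1 hj)

/-- The remainder modulo the monic modulus supplies the coordinates. -/
theorem symbol_surjective : Function.Surjective (symbol m) := by
  intro x
  obtain ⟨p, rfl⟩ := AdjoinRoot.mk_surjective x
  refine ⟨fun i => decide ((p %ₘ modulusPoly m).coeff i ≠ 0), ?_⟩
  have hdeg : (p %ₘ modulusPoly m).degree < w :=
    (degree_modByMonic_lt _ (modulusPoly_monic m)).trans_eq (modulusPoly_degree m)
  rw [symbol_eq_mk, AdjoinRoot.mk_eq_mk, lower_eq_of_degree_lt hdeg]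
  have := modByMonic_add_div p (modulusPoly m)
  refine ⟨-(p /ₘ modulusPoly m), ?_⟩
  linear_combination this

theorem sym_injOn {a b : Bits} (ha : a.length = w) (hb : b.length = w) (h : sym m a = sym m b) :
    a = b := by
  rw [sym_of_length m ha, sym_of_length m hb] at h
  have h1 := symbol_injective m h
  apply List.ext_getElem (ha.trans hb.symm)
  intro i h2 h3
  have := congrFun h1 ⟨i, ha ▸ h2⟩
  simpa [List.getD_eq_getElem, h2, h3] using this

theorem natCard_adjoinRoot : Nat.card (AdjoinRoot (modulusPoly m)) = 2 ^ w := by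
  rw [← Nat.card_congr (Equiv.ofBijective _ ⟨symbol_injective m, symbol_surjective m⟩)]
  simp

theorem pow_card_sub_one [Fact (Irreducible (modulusPoly m))]
    {a : AdjoinRoot (modulusPoly m)} (ha : a ≠ 0) : a ^ (2 ^ w - 1) = 1 := by
  have : Finite (AdjoinRoot (modulusPoly m)) := Finite.of_surjective _ (symbol_surjective m)
  have := Fintype.ofFinite (AdjoinRoot (modulusPoly m))
  rw [← natCard_adjoinRoot m, Nat.card_eq_fintype_card]
  exact FiniteField.pow_card_sub_one_eq_one a ha

/-! ### Inversion -/

theorem frobeniusProdT_length {l acc : Bits} (n : ℕ) {a : Bits} (ha : a.length = l.length)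
    (hacc : acc.length = l.length) : (frobeniusProdT l n a acc).val.length = l.length := by
  induction n generalizing a acc with
  | zero => simpa [frobeniusProdT] using hacc
  | succ n ih =>
    simp only [frobeniusProdT, Timed.val_bind]
    exact ih (mulT_length ha _) (mulT_length (mulT_length ha _) _)

theorem frobeniusProdT_cost {w : ℕ} (hw : 1 ≤ w) {l : Bits} (hl : l.length = w) (n : ℕ)
    {a acc : Bits} (ha : a.length ≤ w) (hacc : acc.length ≤ w) :
    (frobeniusProdT l n a acc).cost ≤ n * (23 * w ^ 2) + 1 := by
  induction n generalizing a acc with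
  | zero => simp [frobeniusProdT]
  | succ n ih =>
    simp only [frobeniusProdT, Timed.cost_bind, cost_tick]
    have h1 := mulT_cost hw hl ha a
    have h2 := mulT_cost hw hl hacc (mulT l a a).val
    have h3 := ih (a := (mulT l a a).val) (acc := (mulT l acc (mulT l a a).val).val)
      ((mulT_length_le _ _ _).trans hl.le) ((mulT_length_le _ _ _).trans hl.le)
    have : 1 ≤ w ^ 2 := Nat.one_le_pow _ _ hw
    nlinarith

/-- The factors `a^2, a^4, …, a^(2^n)` have total exponent `2 + 4 + ⋯ + 2^n = 2^(n+1) - 2`. -/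
theorem sym_frobeniusProdT (n : ℕ) {a acc : Bits} (ha : a.length = w) (hacc : acc.length = w) :
    sym m (frobeniusProdT (List.ofFn m) n a acc).val =
      sym m acc * sym m a ^ (2 ^ (n + 1) - 2) := by
  induction n generalizing a acc with
  | zero => simp [frobeniusProdT]
  | succ n ih =>
    have h1 : (mulT (List.ofFn m) a a).val.length = w := by rw [mulT_length] <;> simp [ha]
    simp only [frobeniusProdT, Timed.val_bind]
    rw [ih h1 (by rw [mulT_length] <;> simp [h1]), sym_mulT m _ h1, sym_mulT m _ ha, mul_assoc,
      ← pow_two, ← pow_mul, ← pow_add]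
    congr 2
    have : 2 ≤ 2 ^ (n + 1) := by
      rw [pow_succ]; have := Nat.one_le_two_pow (n := n); omega
    have h3 : 2 ^ (n + 1 + 1) = 2 * 2 ^ (n + 1) := by ring
    omega

theorem invT_length {w : ℕ} {l a : Bits} (ha : a.length = l.length) :
    (invT w l a).val.length = l.length := by
  simp only [invT, Timed.val_bind]
  exact frobeniusProdT_length _ ha (oneT_length l)

theorem invT_cost {w : ℕ} (hw : 1 ≤ w) {l a : Bits} (hl : l.length = w) (ha : a.length ≤ w) :
    (invT w l a).cost ≤ 27 * w ^ 3 := by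
  simp only [invT, Timed.cost_bind, cost_tick]
  have h1 := oneT_cost l
  have h2 := frobeniusProdT_cost hw hl (w - 1) ha ((oneT_length l).trans hl).le
  have h3 : (w - 1) * (23 * w ^ 2) ≤ w * (23 * w ^ 2) := Nat.mul_le_mul_right _ (by omega)
  have h4 : w ≤ w ^ 3 := Nat.le_self_pow (by norm_num) w
  have h6 : 1 ≤ w ^ 3 := Nat.one_le_pow _ _ hw
  have h5 : w * (23 * w ^ 2) = 23 * w ^ 3 := by ring
  omega

/-- With `n = w - 1` squarings the exponent is `2^w - 2`; one more factor `a` gives `a^(2^w - 1)`,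
which is one in a field of `2^w` elements. -/
theorem sym_invT_mul [Fact (Irreducible (modulusPoly m))] (hw : 1 ≤ w) {a : Bits}
    (ha : a.length = w) (h0 : sym m a ≠ 0) :
    sym m (invT w (List.ofFn m) a).val * sym m a = 1 := by
  have hne : List.ofFn m ≠ [] := by
    intro h
    have := congrArg List.length h
    simp at this
    omega
  simp only [invT, Timed.val_bind]
  rw [sym_frobeniusProdT m _ ha (by simp [oneT_length]), sym_oneT m hne, one_mul, ← pow_succ,
    ← pow_card_sub_one m h0]
  congr 1
  have h1 : 2 ≤ 2 ^ w := by
    calc 2 = 2 ^ 1 := rfl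
      _ ≤ 2 ^ w := Nat.pow_le_pow_right (by norm_num) hw
  rw [Nat.sub_add_cancel hw]
  omega

/-! ### Inner products and parities -/

theorem dotT_length (l : Bits) (G U : List Bits) : (dotT l G U).val.length ≤ l.length := by
  induction G generalizing U with
  | nil => simp [dotT]
  | cons g G ih =>
    cases U with
    | nil => simp [dotT]
    | cons u U =>
      simp only [dotT, Timed.val_bind, addT_length]
      have := ih U
      omega

theorem dotT_length_eq {l : Bits} (G : List Bits) {U : List Bits}
    (hU : ∀ u ∈ U, u.length = l.length) : (dotT l G U).val.length = l.length := by
  induction G generalizing U with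
  | nil => simp [dotT]
  | cons g G ih =>
    cases U with
    | nil => simp [dotT]
    | cons u U =>
      simp only [dotT, Timed.val_bind, addT_length]
      rw [ih fun x hx => hU x (by simp [hx]), mulT_length (hU u (by simp))]
      simp

theorem dotT_cost {w : ℕ} (hw : 1 ≤ w) {l : Bits} (hl : l.length = w) {G : List Bits}
    (hG : ∀ g ∈ G, g.length ≤ w) (U : List Bits) :
    (dotT l G U).cost ≤ (G.length + 1) * (14 * w ^ 2) := by
  have h1 : w ≤ w ^ 2 := Nat.le_self_pow (by norm_num) w
  induction G generalizing U with
  | nil => simp [dotT, hl]; omega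
  | cons g G ih =>
    cases U with
    | nil =>
      have : 14 * w ^ 2 ≤ ((g :: G).length + 1) * (14 * w ^ 2) :=
        Nat.le_mul_of_pos_left _ (by omega)
      simp only [dotT, Timed.cost_bind, cost_tick, zeroT_cost]
      omega
    | cons u U =>
      simp only [dotT, Timed.cost_bind, cost_tick, List.length_cons]
      have h2 := ih (fun x hx => hG x (by simp [hx])) U
      have h3 := mulT_cost hw hl (hG g (by simp)) u
      have h4 := addT_cost (mulT l g u).val (dotT l G U).val
      have h5 := mulT_length_le l g u
      nlinarith

theorem sym_dotT {G U : List Bits} (hU : ∀ u ∈ U, u.length = w) :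
    sym m (dotT (List.ofFn m) G U).val =
      (List.zipWith (fun g u => sym m g * sym m u) G U).sum := by
  induction G generalizing U with
  | nil => simp [dotT]
  | cons g G ih =>
    cases U with
    | nil => simp [dotT]
    | cons u U =>
      have hu := hU u (by simp)
      have hU' : ∀ x ∈ U, x.length = w := fun x hx => hU x (by simp [hx])
      simp only [dotT, Timed.val_bind, List.zipWith_cons_cons, List.sum_cons]
      rw [sym_addT, ih hU', sym_mulT m g hu]
      rw [mulT_length (by simp [hu]), dotT_length_eq _ (by simpa using hU')]

theorem paritiesT_val (l : Bits) (G : List (List Bits)) (U : List Bits) :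
    (paritiesT l G U).val = G.map fun g => (dotT l g U).val := by
  induction G with
  | nil => simp [paritiesT]
  | cons g G ih => simp [paritiesT, ih]

theorem paritiesT_cost {w N : ℕ} (hw : 1 ≤ w) {l : Bits} (hl : l.length = w)
    {G : List (List Bits)} (hG : ∀ g ∈ G, g.length ≤ N ∧ ∀ b ∈ g, b.length ≤ w) (U : List Bits) :
    (paritiesT l G U).cost ≤ G.length * ((N + 2) * (14 * w ^ 2)) + 1 := by
  have h1 : 1 ≤ w ^ 2 := Nat.one_le_pow _ _ hw
  induction G with
  | nil => simp [paritiesT]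
  | cons g G ih =>
    simp only [paritiesT, Timed.cost_bind, cost_tick, List.length_cons, Timed.cost_pure]
    have h2 := ih fun x hx => hG x (by simp [hx])
    have h3 := dotT_cost hw hl (hG g (by simp)).2 U
    have h4 : (g.length + 1) * (14 * w ^ 2) ≤ (N + 1) * (14 * w ^ 2) :=
      Nat.mul_le_mul_right _ (by have := (hG g (by simp)).1; omega)
    nlinarith

theorem syndromesT_val (l : Bits) (G : List (List Bits)) (p U : List Bits) :
    (syndromesT l G p U).val = List.zipWith (fun g q => (addT q (dotT l g U).val).val) G p := by
  induction G generalizing p with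
  | nil => simp [syndromesT]
  | cons g G ih => cases p <;> simp [syndromesT, ih]

theorem syndromesT_cost {w N : ℕ} (hw : 1 ≤ w) {l : Bits} (hl : l.length = w)
    {G : List (List Bits)} (hG : ∀ g ∈ G, g.length ≤ N ∧ ∀ b ∈ g, b.length ≤ w) (p U : List Bits) :
    (syndromesT l G p U).cost ≤ G.length * ((N + 2) * (14 * w ^ 2)) + 1 := by
  have h1 : w ≤ w ^ 2 := Nat.le_self_pow (by norm_num) w
  induction G generalizing p with
  | nil => simp [syndromesT]
  | cons g G ih =>
    cases p with
    | nil => simp [syndromesT]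
    | cons q p =>
      simp only [syndromesT, Timed.cost_bind, cost_tick, List.length_cons, Timed.cost_pure]
      have h2 := ih (fun x hx => hG x (by simp [hx])) p
      have h3 := dotT_cost hw hl (hG g (by simp)).2 U
      have h4 : (g.length + 1) * (14 * w ^ 2) ≤ (N + 1) * (14 * w ^ 2) :=
        Nat.mul_le_mul_right _ (by have := (hG g (by simp)).1; omega)
      have h5 := addT_cost_right q (dotT l g U).val
      have h6 := dotT_length l g U
      nlinarith

end Field

end GC

/-! ### Laplace expansion and the rule of Cramer over the field. -/

namespace GC

/-! ### Determinants and linear systems -/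

section Determinant

variable {w : ℕ} (m : Fin w → Bool)

theorem laplaceT_length {l : Bits} {det : List (List Bits) → Timed Bits}
    (hdet : ∀ M, (det M).val.length = l.length) (M : List (List Bits)) (j : ℕ) (as : List Bits) :
    (laplaceT l det M j as).val.length = l.length := by
  induction as generalizing j with
  | nil => simp [laplaceT]
  | cons a as ih =>
    simp only [laplaceT, Timed.val_bind, addT_length]
    rw [ih, mulT_length (hdet _), min_self]

theorem detT_length (l : Bits) (n : ℕ) (M : List (List Bits)) :
    (detT l n M).val.length = l.length := by
  induction n generalizing M with
  | zero => simp [detT, oneT_length]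
  | succ n ih =>
    cases M with
    | nil => simp [detT, oneT_length]
    | cons r M => simpa [detT] using laplaceT_length ih M 0 r

theorem cramerT_length (l : Bits) (e : ℕ) (M : List (List Bits)) (dinv : Bits) (s : List Bits)
    (i j : ℕ) : (cramerT l e M dinv s i j).val.length = i := by
  induction i generalizing j with
  | zero => simp [cramerT]
  | succ i ih => simp [cramerT, ih]

theorem length_of_mem_cramerT {l : Bits} {e : ℕ} {M : List (List Bits)} {dinv : Bits}
    {s : List Bits} {i j : ℕ} {x : Bits} (hx : x ∈ (cramerT l e M dinv s i j).val) :
    x.length = l.length := by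
  induction i generalizing j with
  | zero => simp [cramerT] at hx
  | succ i ih =>
    simp only [cramerT, Timed.val_bind, Timed.val_pure, List.mem_cons] at hx
    rcases hx with rfl | hx
    · exact mulT_length (detT_length _ _ _) _
    · exact ih hx

/-- The square matrix over `GF(2^w)` given by a list of rows. -/
noncomputable def toMatrix (n : ℕ) (M : List (List Bits)) :
    Matrix (Fin n) (Fin n) (AdjoinRoot (modulusPoly m)) :=
  Matrix.of fun i j => sym m ((M.getD i []).getD j [])

theorem sym_laplaceT {det : List (List Bits) → Timed Bits}
    (hdet : ∀ M, (det M).val.length = w) (M : List (List Bits)) (j : ℕ) (as : List Bits) :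
    sym m (laplaceT (List.ofFn m) det M j as).val =
      ∑ i : Fin as.length, sym m as[i] * sym m (det (M.map fun r => r.eraseIdx (j + i))).val := by
  induction as generalizing j with
  | nil => simp [laplaceT]
  | cons a as ih =>
    simp only [laplaceT, Timed.val_bind, removeColT_val, List.length_cons]
    rw [sym_addT, sym_mulT _ _ (hdet _), ih, Fin.sum_univ_succ]
    · simp [add_left_comm, add_comm]
    · rw [mulT_length, laplaceT_length] <;> simp [hdet]

theorem sym_detT {n : ℕ} (hw : 1 ≤ w) {M : List (List Bits)} (hM : M.length = n)
    (hr : ∀ r ∈ M, r.length = n) :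
    sym m (detT (List.ofFn m) n M).val = (toMatrix m n M).det := by
  induction n generalizing M with
  | zero =>
    have hne : List.ofFn m ≠ [] := by
      intro h
      have := congrArg List.length h
      simp at this
      omega
    simp [detT, sym_oneT m hne]
  | succ n ih =>
    obtain ⟨r, M, rfl⟩ := List.exists_cons_of_length_eq_add_one hM
    have hr0 : r.length = n + 1 := hr r (by simp)
    -- The alternating signs of the expansion disappear in characteristic two.
    have hneg : (-1 : AdjoinRoot (modulusPoly m)) = 1 := by
      have := sym_add_self m 1
      linear_combination -this
    simp only [detT, Timed.val_bind]
    rw [sym_laplaceT m (fun M => by rw [detT_length]; simp), Matrix.det_succ_row_zero]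
    rw [← Equiv.sum_comp (finCongr hr0).symm]
    refine Finset.sum_congr rfl fun j _ => ?_
    rw [hneg, one_pow, one_mul, ih]
    · congr 1
      · have hj : (j : ℕ) < r.length := by rw [hr0]; exact j.2
        simp [toMatrix, List.getD_eq_getElem?_getD, hj]
      · congr 1
        ext i l
        simp only [toMatrix, Matrix.of_apply, Matrix.submatrix_apply, finCongr_symm,
          finCongr_apply_coe, zero_add]
        have hi : (i : ℕ) < M.length := by
          have := i.2
          simp at hM
          omega
        simp only [List.getD_eq_getElem?_getD, List.getElem?_map, Fin.val_succ,
          List.getElem?_cons_succ, List.getElem?_eq_getElem hi, Option.map_some,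
          Option.getD_some, List.getElem?_eraseIdx]
        congr 2
        rcases lt_or_ge (l : ℕ) (j : ℕ) with h | h
        · rw [if_pos h, Fin.succAbove_of_castSucc_lt _ _ (by simpa [Fin.lt_def] using h)]
          simp
        · rw [if_neg (by omega), Fin.succAbove_of_le_castSucc _ _ (by simpa [Fin.le_def] using h)]
          simp
    · simpa using hM
    · intro r' h'
      obtain ⟨r'', h'', rfl⟩ := List.mem_map.1 h'
      have h1 := hr r'' (by simp [h''])
      have h2 : (j : ℕ) < n + 1 := j.2
      rw [List.length_eraseIdx, if_pos]
      · omega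
      · simpa [h1] using h2

theorem cramerT_val (l : Bits) (e : ℕ) (M : List (List Bits)) (dinv : Bits) (s : List Bits)
    (i j : ℕ) : (cramerT l e M dinv s i j).val = List.ofFn fun a : Fin i =>
      (mulT l dinv (detT l e (List.zipWith (fun r x => r.set (j + a) x) M s)).val).val := by
  induction i generalizing j with
  | zero => simp [cramerT]
  | succ i ih =>
    simp only [cramerT, Timed.val_bind, Timed.val_pure, setColT_val, ih, List.ofFn_succ]
    congr 2
    funext a
    simp only [Fin.val_succ]
    rw [show j + 1 + (a : ℕ) = j + (a + 1) by ring]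

theorem toMatrix_set {n : ℕ} {M : List (List Bits)} (hM : M.length = n)
    (hr : ∀ r ∈ M, r.length = n) {s : List Bits} (hs : s.length = n) (j : Fin n) :
    toMatrix m n (List.zipWith (fun r x => r.set j x) M s) =
      (toMatrix m n M).updateCol j fun i => sym m (s.getD i []) := by
  ext i l
  have hi : (i : ℕ) < M.length := hM ▸ i.2
  have hi' : (i : ℕ) < s.length := hs ▸ i.2
  have hri : M[i].length = n := hr _ (List.getElem_mem hi)
  simp only [toMatrix, Matrix.of_apply, Matrix.updateCol_apply, List.getD_eq_getElem?_getD,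
    List.getElem?_zipWith, List.getElem?_eq_getElem hi, List.getElem?_eq_getElem hi',
    Option.getD_some, List.getElem?_set]
  by_cases h : l = j
  · subst h
    simp only [if_true]
    rw [if_pos (by simp only [Fin.getElem_fin] at hri ⊢; rw [hri]; exact l.2)]
    rfl
  · rw [if_neg h, if_neg (fun h' => h (Fin.ext h'.symm))]

/-- The rule of Cramer finds the solution of a regular system. -/
theorem cramerT_eq [Fact (Irreducible (modulusPoly m))] (hw : 1 ≤ w) {e : ℕ}
    {M : List (List Bits)} (hM : M.length = e) (hr : ∀ r ∈ M, r.length = e) {s x : List Bits}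
    (hs : s.length = e) (hx : x.length = e) (hxw : ∀ b ∈ x, b.length = w)
    (hdet : (toMatrix m e M).det ≠ 0)
    (hsol : ∀ i : Fin e, ∑ j : Fin e, toMatrix m e M i j * sym m (x.getD j []) =
      sym m (s.getD i [])) :
    (cramerT (List.ofFn m) e M (invT w (List.ofFn m) (detT (List.ofFn m) e M).val).val s e 0).val =
      x := by
  have hlen : ∀ M', (detT (List.ofFn m) e M').val.length = w := fun M' => by
    rw [detT_length]; simp
  have hdinv := sym_invT_mul m hw (hlen M) (by rw [sym_detT m hw hM hr]; exact hdet)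
  rw [sym_detT m hw hM hr] at hdinv
  rw [cramerT_val]
  apply List.ext_getElem (by simp [hx])
  intro j h1 h2
  have hj : j < e := by simpa using h1
  have hxj := hxw _ (List.getElem_mem h2)
  rw [List.getElem_ofFn]
  refine sym_injOn m ?_ hxj ?_
  · rw [mulT_length] <;> simp [hlen]
  · have hz : (List.zipWith (fun r x => r.set j x) M s).length = e := by simp [hM, hs]
    simp only [zero_add]
    rw [sym_mulT m _ (hlen _), sym_detT m hw hz]
    · have h3 := toMatrix_set m hM hr hs ⟨j, hj⟩
      simp only at h3
      rw [h3, ← Matrix.cramer_apply]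
      -- The right-hand side is `M x`, so Cramer's vector is `adj(M) M x = det(M) x`, and `dinv`
      -- cancels the determinant.
      have h4 : (fun i : Fin e => sym m (s.getD i [])) =
          (toMatrix m e M).mulVec fun j => sym m (x.getD j []) := by
        funext i
        exact (hsol i).symm
      rw [h4, Matrix.cramer_eq_adjugate_mulVec, Matrix.mulVec_mulVec, Matrix.adjugate_mul,
        Matrix.smul_mulVec, Matrix.one_mulVec, Pi.smul_apply, smul_eq_mul, ← mul_assoc, hdinv,
        one_mul]
      simp [List.getD_eq_getElem?_getD, h2]
    · intro r h
      obtain ⟨i, hi, rfl⟩ := List.getElem_of_mem h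
      simp only [List.getElem_zipWith, List.length_set]
      exact hr _ (List.getElem_mem _)

/-! ### Costs -/

/-- `N` bounds both dimensions of all matrices that occur, and `B` is the constant inherited from
determinants with one row less. Lower terms are absorbed into `w ^ 2`. -/
theorem laplaceT_cost {N B : ℕ} (hw : 1 ≤ w) {l : Bits} (hl : l.length = w)
    {det : List (List Bits) → Timed Bits}
    {M : List (List Bits)} (hMN : M.length ≤ N)
    (hM : ∀ r ∈ M, r.length ≤ N ∧ ∀ b ∈ r, b.length ≤ w)
    (hdet : ∀ M' : List (List Bits), M'.length ≤ N →
      (∀ r ∈ M', r.length ≤ N ∧ ∀ b ∈ r, b.length ≤ w) → (det M').cost ≤ B * w ^ 2)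
    (j : ℕ) {as : List Bits} (has : ∀ b ∈ as, b.length ≤ w) :
    (laplaceT l det M j as).cost ≤ (as.length * (N * (N + 2) + B + 15) + 3) * w ^ 2 := by
  have h1 : w ≤ w ^ 2 := Nat.le_self_pow (by norm_num) w
  have h0 : 1 ≤ w ^ 2 := Nat.one_le_pow _ _ hw
  induction as generalizing j with
  | nil => simp [laplaceT, hl]; omega
  | cons a as ih =>
    have h2 := removeColT_cost j fun r hr => (hM r hr).1
    have h3 : M.length * (N + 2) ≤ N * (N + 2) := Nat.mul_le_mul_right _ hMN
    have h4 := hdet (M.map fun r => r.eraseIdx j) (by simpa using hMN) (by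
      intro r hr
      obtain ⟨r', hr', rfl⟩ := List.mem_map.1 hr
      exact ⟨(List.eraseIdx_sublist _ _).length_le.trans (hM r' hr').1,
        fun b hb => (hM r' hr').2 b ((List.eraseIdx_sublist _ _).subset hb)⟩)
    have h5 := mulT_cost hw hl (has a (by simp)) (det (M.map fun r => r.eraseIdx j)).val
    have h6 := ih (j + 1) fun b hb => has b (by simp [hb])
    have h7 := addT_cost (mulT l a (det (M.map fun r => r.eraseIdx j)).val).val
      (laplaceT l det M (j + 1) as).val
    have h8 := mulT_length_le l a (det (M.map fun r => r.eraseIdx j)).val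
    simp only [laplaceT, Timed.cost_bind, cost_tick, removeColT_val, List.length_cons]
    have h9 : N * (N + 2) ≤ N * (N + 2) * w ^ 2 := Nat.le_mul_of_pos_right _ h0
    calc _ ≤ 1 + (N * (N + 2) * w ^ 2 + 1 + (B * w ^ 2 + (11 * w ^ 2 +
          ((as.length * (N * (N + 2) + B + 15) + 3) * w ^ 2 + (w + 1))))) := by omega
      _ ≤ w ^ 2 + (N * (N + 2) * w ^ 2 + w ^ 2 + (B * w ^ 2 + (11 * w ^ 2 +
          ((as.length * (N * (N + 2) + B + 15) + 3) * w ^ 2 + (w ^ 2 + w ^ 2))))) := by omega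
      _ = _ := by ring

/-- A factor that bounds the cost of determinants of `n` rows, in terms of `w ^ 2`. -/
def detFactor (N : ℕ) : ℕ → ℕ
  | 0 => 3
  | n + 1 => N * (N * (N + 2) + detFactor N n + 15) + 4

theorem detT_cost {N : ℕ} (hw : 1 ≤ w) {l : Bits} (hl : l.length = w) (n : ℕ)
    {M : List (List Bits)} (hMN : M.length ≤ N)
    (hM : ∀ r ∈ M, r.length ≤ N ∧ ∀ b ∈ r, b.length ≤ w) :
    (detT l n M).cost ≤ detFactor N n * w ^ 2 := by
  have h1 : w ≤ w ^ 2 := Nat.le_self_pow (by norm_num) w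
  have h0 : 1 ≤ w ^ 2 := Nat.one_le_pow _ _ hw
  have h2 := oneT_cost l
  induction n generalizing M with
  | zero => simp [detT, detFactor]; omega
  | succ n ih =>
    cases M with
    | nil =>
      simp only [detT, Timed.cost_bind, cost_tick, detFactor]
      have : 4 * w ^ 2 ≤ (N * (N * (N + 2) + detFactor N n + 15) + 4) * w ^ 2 :=
        Nat.mul_le_mul_right _ (by omega)
      omega
    | cons r M =>
      simp only [detT, Timed.cost_bind, cost_tick, detFactor]
      have h3 := laplaceT_cost hw hl (M := M) (by simp at hMN; omega)
        (fun r' hr' => hM r' (by simp [hr'])) (fun M' => ih) 0 (hM r (by simp)).2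
      have h4 : (r.length * (N * (N + 2) + detFactor N n + 15) + 3) * w ^ 2 ≤
          (N * (N * (N + 2) + detFactor N n + 15) + 3) * w ^ 2 :=
        Nat.mul_le_mul_right _ (Nat.add_le_add_right
          (Nat.mul_le_mul_right _ (hM r (by simp)).1) _)
      have h5 : (N * (N * (N + 2) + detFactor N n + 15) + 4) * w ^ 2 =
          (N * (N * (N + 2) + detFactor N n + 15) + 3) * w ^ 2 + w ^ 2 := by ring
      omega

theorem detFactor_mono {N n n' : ℕ} (hN : 0 < N) (h : n ≤ n') :
    detFactor N n ≤ detFactor N n' := by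
  induction h with
  | refl => exact le_rfl
  | step _ ih =>
    refine ih.trans ?_
    simp only [detFactor]
    nlinarith [Nat.zero_le (N * (N + 2))]

theorem cramerT_cost {N : ℕ} (hw : 1 ≤ w) {l : Bits} (hl : l.length = w) (e : ℕ)
    {M : List (List Bits)} (hMN : M.length ≤ N)
    (hM : ∀ r ∈ M, r.length ≤ N ∧ ∀ b ∈ r, b.length ≤ w) {dinv : Bits} (hd : dinv.length ≤ w)
    {s : List Bits} (hs : ∀ b ∈ s, b.length ≤ w) (i j : ℕ) :
    (cramerT l e M dinv s i j).cost ≤ i * ((N * (N + 2) + detFactor N e + 13) * w ^ 2) + 1 := by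
  have h0 : 1 ≤ w ^ 2 := Nat.one_le_pow _ _ hw
  induction i generalizing j with
  | zero => simp [cramerT]
  | succ i ih =>
    simp only [cramerT, Timed.cost_bind, cost_tick, Timed.cost_pure, setColT_val]
    have h1 := setColT_cost j (fun r hr => (hM r hr).1) s
    have h2 : M.length * (N + 2) ≤ N * (N + 2) := Nat.mul_le_mul_right _ hMN
    have h3 := detT_cost (N := N) hw hl e (M := List.zipWith (fun r x => r.set j x) M s)
      (by simp; omega) (by
        intro r hr
        obtain ⟨i, hi, rfl⟩ := List.getElem_of_mem hr
        simp only [List.getElem_zipWith, List.length_set]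
        have hi' := hM _ (List.getElem_mem (l := M) (n := i) (by simp at hi; omega))
        refine ⟨hi'.1, fun b hb => ?_⟩
        rcases List.mem_or_eq_of_mem_set hb with hb | rfl
        · exact hi'.2 b hb
        · exact hs _ (List.getElem_mem _))
    have h4 := mulT_cost hw hl hd (detT l e (List.zipWith (fun r x => r.set j x) M s)).val
    have h5 := ih (j + 1)
    have h9 : N * (N + 2) ≤ N * (N + 2) * w ^ 2 := Nat.le_mul_of_pos_right _ h0
    calc _ ≤ 1 + ((N * (N + 2) * w ^ 2 + 1) + (detFactor N e * w ^ 2 + (11 * w ^ 2 +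
          (i * ((N * (N + 2) + detFactor N e + 13) * w ^ 2) + 1)))) := by omega
      _ ≤ w ^ 2 + ((N * (N + 2) * w ^ 2 + w ^ 2) + (detFactor N e * w ^ 2 + (11 * w ^ 2 +
          (i * ((N * (N + 2) + detFactor N e + 13) * w ^ 2) + 1)))) := by omega
      _ = _ := by ring

end Determinant

end GC

/-! ### Reading the received string under an arbitrary guess and under the correct one. -/

namespace GC

/-! ### Chunking the received string and filling in the erasures -/

/-- The number of deletions guessed in the affected ones among the first `j` blocks. -/
def guessed : List Bool → List ℕ → ℕ → ℕ
  | a :: fl, d :: ds, j + 1 => (if a then d else 0) + guessed fl ds j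
  | _, _, _ => 0

@[simp] theorem guessed_zero (fl : List Bool) (ds : List ℕ) : guessed fl ds 0 = 0 := by
  cases fl <;> cases ds <;> rfl

theorem guessed_eq_sum (fl : List Bool) (ds : List ℕ) (j : ℕ) :
    guessed fl ds j =
      ∑ i ∈ Finset.range j, if fl.getD i false then ds.getD i 0 else 0 := by
  induction fl generalizing ds j with
  | nil => simp [guessed]
  | cons a fl ih =>
    cases ds with
    | nil => simp [guessed]
    | cons d ds =>
      cases j with
      | zero => simp
      | succ j => rw [guessed, ih, Finset.sum_range_succ']; simp [add_comm]

theorem guessed_mono (fl : List Bool) (ds : List ℕ) : Monotone (guessed fl ds) := by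
  intro i j h
  rw [guessed_eq_sum, guessed_eq_sum]
  exact Finset.sum_le_sum_of_subset (Finset.range_subset_range.2 h)

/-- A successful chunking does not require more deletions than there are bits. -/
theorem guessed_le_of_chunkT {w : ℕ} {fl : List Bool} {ds : List ℕ} {n g L D : ℕ} {y : Bits}
    {ps : List Piece} (hlen : fl.length = ds.length)
    (h : (chunkT w fl ds n g L D y).val = some ps) {j : ℕ} (hj : fl[j]? = some false) :
    D + guessed fl ds j ≤ L + j * w := by
  induction fl generalizing ds n g L D y ps j with
  | nil => simp at hj
  | cons a fl ih =>
    cases ds with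
    | nil => simp at hlen
    | cons d ds =>
      have hlen' : fl.length = ds.length := by simpa using hlen
      cases a
      · simp only [chunkT, Timed.val_bind] at h
        split at h
        · simp at h
        · next hD =>
          simp only [Timed.val_bind, Timed.val_pure, Option.map_eq_some_iff] at h
          obtain ⟨ps', h, -⟩ := h
          cases j with
          | zero => simp; omega
          | succ j =>
            have := ih hlen' h (by simpa using hj)
            simp only [guessed, Bool.false_eq_true, if_false]
            nlinarith
      · simp only [chunkT, Timed.val_bind] at h
        cases j with
        | zero => simp at hj
        | succ j =>
          have := ih hlen' h (by simpa using hj)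
          simp only [guessed, if_true]
          have := min_le_left w n
          nlinarith

/-- Block `i` is intact, so the counters of the current run restart at zero after it. From there
`guessed_le_of_chunkT` allows at most `w` deletions for each of the `j - i - 1` blocks in between.
This becomes `IsShift.gap`. -/
theorem guessed_gap_of_chunkT {w : ℕ} {fl : List Bool} {ds : List ℕ} {n g L D : ℕ} {y : Bits}
    {ps : List Piece} (hlen : fl.length = ds.length)
    (h : (chunkT w fl ds n g L D y).val = some ps) {i j : ℕ} (hij : i < j)
    (hi : fl[i]? = some false) (hj : fl[j]? = some false) :
    guessed fl ds j ≤ guessed fl ds i + (j - i - 1) * w := by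
  induction fl generalizing ds n g L D y ps i j with
  | nil => simp at hj
  | cons a fl ih =>
    cases ds with
    | nil => simp at hlen
    | cons d ds =>
      obtain ⟨j, rfl⟩ : ∃ j', j = j' + 1 := ⟨j - 1, by omega⟩
      have hlen' : fl.length = ds.length := by simpa using hlen
      cases a
      · simp only [chunkT, Timed.val_bind] at h
        split at h
        · simp at h
        · next hD =>
          simp only [Timed.val_bind, Timed.val_pure, Option.map_eq_some_iff] at h
          obtain ⟨ps', h, -⟩ := h
          cases i with
          | zero =>
            have := guessed_le_of_chunkT hlen' h (by simpa using hj : fl[j]? = some false)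
            simpa [guessed] using this
          | succ i =>
            have := ih (i := i) (j := j) hlen' h (by omega) (by simpa using hi) (by simpa using hj)
            simp only [guessed, Bool.false_eq_true, if_false, Nat.add_sub_add_right]
            omega
      · simp only [chunkT, Timed.val_bind] at h
        cases i with
        | zero => simp at hi
        | succ i =>
          have := ih (i := i) (j := j) hlen' h (by omega) (by simpa using hi) (by simpa using hj)
          simp only [guessed, if_true, Nat.add_sub_add_right]
          omega

theorem length_flatten_of_forall {w : ℕ} {X : List Bits} (h : ∀ b ∈ X, b.length = w) :
    X.flatten.length = X.length * w := by
  induction X with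
  | nil => simp
  | cons b X ih =>
    simp only [List.flatten_cons, List.length_append, List.length_cons]
    rw [h b (by simp), ih fun b hb => h b (by simp [hb])]
    ring

/-- Only the shape of the decoded string is kept; that the supersequence test was passed is
forgotten, since the bound on failures does not need it. -/
theorem fillT_erased_eq_some {g : ℕ} {sub : Bits} {ps : List Piece} {X : List Bits} {v : Bits}
    (h : (fillT (Piece.erased g sub :: ps) X).val = some v) :
    ∃ v', (fillT ps (X.drop g)).val = some v' ∧ v = (X.take g).flatten ++ v' := by
  simp only [fillT, Timed.val_bind, splitT_val, flattenT_val] at h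
  split at h
  · simp only [Timed.val_bind] at h
    split at h
    · simp at h
    · next r hr =>
      simp only [Timed.val_bind, Timed.val_pure, appendT_val, Option.some.injEq] at h
      exact ⟨_, hr, h.symm⟩
  · simp at h

theorem fillT_known_eq_some {b : Bits} {ps : List Piece} {X : List Bits} {v : Bits}
    (h : (fillT (Piece.known b :: ps) X).val = some v) :
    ∃ v', (fillT ps X).val = some v' ∧ v = b ++ v' := by
  simp only [fillT, Timed.val_bind] at h
  split at h
  · simp at h
  · next r hr =>
    simp only [Timed.val_bind, Timed.val_pure, appendT_val, Option.some.injEq] at h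
    exact ⟨_, hr, h.symm⟩

/-- In a block regarded as intact, the decoded string consists of received bits, shifted by the
number of deletions guessed so far. -/
theorem getElem?_of_fillT_chunkT {w : ℕ} {fl : List Bool} {ds : List ℕ} {n g L D : ℕ} {y : Bits}
    {ps : List Piece} {X : List Bits} {v : Bits} (hlen : fl.length = ds.length)
    (h : (chunkT w fl ds n g L D y).val = some ps) (hy : L + n ≤ y.length + D)
    (hn : n ≤ fl.length * w)
    (hX : ∀ b ∈ X, b.length = w) (hXg : g + fl.count true ≤ X.length)
    (hv : (fillT ps X).val = some v) :
    g * w + n ≤ v.length ∧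
      ∀ j i, fl[j]? = some false → i < w → j * w + i < n →
        v[g * w + (j * w + i)]? = y[L + (j * w + i) - (D + guessed fl ds j)]? := by
  induction fl generalizing ds n g L D y ps X v with
  | nil =>
    cases ds with
    | cons d ds => simp at hlen
    | nil =>
      obtain rfl : n = 0 := by simpa using hn
      simp only [chunkT, Timed.val_bind] at h
      split at h
      · simp at h
      · simp only [Timed.val_bind, Timed.val_pure, Option.some.injEq] at h
        subst h
        obtain ⟨v', -, rfl⟩ := fillT_erased_eq_some hv
        refine ⟨?_, by simp⟩
        rw [List.length_append, length_flatten_of_forall fun b hb => hX b (List.mem_of_mem_take hb)]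
        simp only [List.count_nil] at hXg
        rw [List.length_take, min_eq_left (by omega)]
        omega
  | cons a fl ih =>
    cases ds with
    | nil => simp at hlen
    | cons d ds =>
      have hlen' : fl.length = ds.length := by simpa using hlen
      have hn' : n - w ≤ fl.length * w := by
        simp only [List.length_cons] at hn
        have : (fl.length + 1) * w = fl.length * w + w := by ring
        omega
      cases a
      · simp only [chunkT, Timed.val_bind] at h
        split at h
        · simp at h
        · next hD =>
          simp only [Timed.val_bind, Timed.val_pure, splitT_val, Option.map_eq_some_iff] at h
          obtain ⟨ps', h, rfl⟩ := h
          obtain ⟨v1, hv1, rfl⟩ := fillT_erased_eq_some hv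
          obtain ⟨v2, hv2, rfl⟩ := fillT_known_eq_some hv1
          simp only [List.count_cons, beq_iff_eq, Bool.false_eq_true, if_false] at hXg
          have hg : (X.take g).flatten.length = g * w := by
            rw [length_flatten_of_forall fun b hb => hX b (List.mem_of_mem_take hb),
              List.length_take, min_eq_left (by omega)]
          obtain ⟨h1, h2⟩ := ih hlen' h (by simp only [List.length_drop]; omega) hn'
            (fun b hb => hX b (List.mem_of_mem_drop hb))
            (by rw [List.length_drop]; omega) hv2
          have hb : (List.take (min w n) (List.drop (L - D) y)).length = min w n := by
            rw [List.length_take, List.length_drop]; omega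
          refine ⟨?_, ?_⟩
          · simp only [List.length_append, hg, hb]
            omega
          · intro j i hj hi hji
            rw [List.getElem?_append_right (by omega), hg, Nat.add_sub_cancel_left]
            cases j with
            | zero =>
              rw [List.getElem?_append_left (by omega), List.getElem?_take,
                if_pos (by omega), List.getElem?_drop]
              congr 1
              simp
              omega
            | succ j =>
              have h3 : (j + 1) * w + i = w + (j * w + i) := by ring
              rw [h3] at hji ⊢
              -- The recursive call begins a fresh run with `g = 0`, and the index is brought to the
              -- form required by `h2`.
              have h5 : (w + (j * w + i) - min w n) = 0 * w + (j * w + i) := by omega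
              have hj' : fl[j]? = some false := by simpa using hj
              -- The guessed shift does not exceed the number of bits passed, so the truncated
              -- subtractions below are genuine ones.
              have h4 := guessed_le_of_chunkT hlen' h hj'
              rw [List.getElem?_append_right (by omega), hb, h5,
                h2 j i hj' hi (by omega), List.getElem?_drop,
                List.getElem?_drop]
              congr 1
              simp only [guessed, Bool.false_eq_true, if_false]
              omega
      · simp only [chunkT, Timed.val_bind] at h
        simp only [List.count_cons, beq_self_eq_true, if_true] at hXg
        obtain ⟨h1, h2⟩ := ih hlen' h (by omega) hn' hX (by omega) hv
        rw [Nat.succ_mul] at h1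
        refine ⟨by omega, ?_⟩
        intro j i hj hi hji
        cases j with
        | zero => simp at hj
        | succ j =>
          have h3 : (j + 1) * w + i = w + (j * w + i) := by ring
          rw [h3] at hji ⊢
          have h4 := h2 j i (by simpa using hj) hi (by omega)
          rw [Nat.succ_mul, add_assoc] at h4
          rw [h4]
          congr 1
          simp only [guessed, if_true]
          omega

/-! ### Deletions -/

/-- Deletion of the positions in `E`, counted from `o`. -/
def deleteFrom (E : Finset ℕ) (o : ℕ) (x : Bits) : Bits :=
  ((x.zipIdx o).filter fun a => a.2 ∉ E).map Prod.fst

theorem deleteAt_eq (E : Finset ℕ) (x : Bits) : deleteAt E x = deleteFrom E 0 x := rfl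

@[simp] theorem deleteFrom_nil (E : Finset ℕ) (o : ℕ) : deleteFrom E o [] = [] := rfl

theorem deleteFrom_append (E : Finset ℕ) (o : ℕ) (x y : Bits) :
    deleteFrom E o (x ++ y) = deleteFrom E o x ++ deleteFrom E (o + x.length) y := by
  simp [deleteFrom, List.zipIdx_append]

theorem deleteFrom_sublist (E : Finset ℕ) (o : ℕ) (x : Bits) : (deleteFrom E o x).Sublist x := by
  have h : ((x.zipIdx o).map Prod.fst) = x := by simp
  conv_rhs => rw [← h]
  exact List.filter_sublist.map _

theorem deleteFrom_singleton (E : Finset ℕ) (o : ℕ) (b : Bool) :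
    deleteFrom E o [b] = if o ∈ E then [] else [b] := by
  by_cases h : o ∈ E <;> simp [deleteFrom, h]

theorem length_deleteFrom (E : Finset ℕ) (o : ℕ) (x : Bits) :
    (deleteFrom E o x).length + (E ∩ Finset.Ico o (o + x.length)).card = x.length := by
  induction x using List.reverseRecOn with
  | nil => simp
  | append_singleton x b ih =>
    rw [deleteFrom_append, deleteFrom_singleton, List.length_append, List.length_append,
      List.length_singleton, ← add_assoc, ← Finset.insert_Ico_right_eq_Ico_add_one (by omega)]
    by_cases h : o + x.length ∈ E
    · rw [Finset.inter_insert_of_mem h, Finset.card_insert_of_notMem (by simp), if_pos h]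
      simp only [List.length_nil]
      omega
    · rw [Finset.inter_insert_of_notMem h, if_neg h]
      simp only [List.length_singleton]
      omega

theorem deleteFrom_eq_self {E : Finset ℕ} {o : ℕ} {x : Bits}
    (h : ∀ i ∈ E, i < o ∨ o + x.length ≤ i) : deleteFrom E o x = x := by
  apply (deleteFrom_sublist E o x).eq_of_length
  have h1 := length_deleteFrom E o x
  rw [Finset.card_eq_zero.2] at h1
  · exact h1
  · ext i
    simp only [Finset.mem_inter, Finset.mem_Ico, Finset.notMem_empty, iff_false]
    rintro ⟨h1, h2, h3⟩
    have := h i h1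
    omega

theorem deleteFrom_take_add (E : Finset ℕ) (o w t : ℕ) (x : Bits) :
    deleteFrom E o (x.take (w + t)) =
      deleteFrom E o (x.take w) ++ deleteFrom E (o + w) ((x.drop w).take t) := by
  rw [List.take_add, deleteFrom_append]
  rcases le_total w x.length with h | h
  · rw [List.length_take, min_eq_left h]
  · rw [List.drop_eq_nil_of_le h]; simp

theorem deleteFrom_take_drop (E : Finset ℕ) (o w : ℕ) (x : Bits) :
    deleteFrom E o x =
      deleteFrom E o (x.take w) ++ deleteFrom E (o + w) (x.drop w) := by
  have h := deleteFrom_take_add E o w x.length x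
  rwa [List.take_of_length_le (by omega), List.take_of_length_le (l := x.drop w) (by simp)] at h

/-- Padding only appends zeros, so this covers a last block shorter than `w` as well. -/
theorem take_prefix_ofFn (w : ℕ) (x : Bits) :
    x.take w <+: List.ofFn fun j : Fin w => x.getD j false := by
  rw [List.prefix_iff_getElem?]
  intro i hi
  rw [List.length_take] at hi
  have h1 : i < w := by omega
  have h2 : i < x.length := by omega
  rw [List.getElem?_ofFn, dif_pos h1]
  simp [h2]

theorem zerosT_val (l : Bits) (g : ℕ) (r : List Bits) :
    (zerosT l g r).val = List.replicate g (List.replicate l.length false) ++ r := by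
  induction g with
  | zero => simp [zerosT]
  | succ g ih => simp [zerosT, ih, List.replicate_succ]

theorem fillT_erased_of_sublist {g : ℕ} {sub : Bits} {ps : List Piece} {Xa Xb : List Bits}
    (hg : Xa.length = g) (hs : sub.Sublist Xa.flatten) :
    (fillT (Piece.erased g sub :: ps) (Xa ++ Xb)).val =
      (fillT ps Xb).val.map (Xa.flatten ++ ·) := by
  have h1 : List.take g (Xa ++ Xb) = Xa := by rw [← hg]; simp
  have h2 : List.drop g (Xa ++ Xb) = Xb := by rw [← hg]; simp
  simp only [fillT, Timed.val_bind, splitT_val, flattenT_val, h1, h2, supersequenceT_val hs,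
    if_true]
  split <;> simp_all

theorem fillT_known (b : Bits) (ps : List Piece) (X : List Bits) :
    (fillT (Piece.known b :: ps) X).val = (fillT ps X).val.map (b ++ ·) := by
  simp only [fillT, Timed.val_bind]
  split <;> simp_all

/-- Chunking according to the true numbers of deletions recovers the intact blocks, and filling in
the true symbols of the affected blocks recovers the message. -/
theorem chunkT_of_correct {w : ℕ} (m : Bits) (hm : m.length = w) (E : Finset ℕ)
    {fl : List Bool} {ds : List ℕ} {u : Bits} {o g L D : ℕ} {acc : Bits} {tl : Bits}
    {X : List Bits} (hlen : fl.length = ds.length) (hu : u.length ≤ fl.length * w)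
    (hX : X.length = g) (hacc : acc.Sublist X.flatten)
    (hcount : ∀ j ≤ fl.length, j = fl.length ∨ fl[j]? = some false →
      acc.length + (deleteFrom E o (u.take (j * w))).length + D + guessed fl ds j =
        L + (u.take (j * w)).length)
    (hknown : ∀ j, fl[j]? = some false →
      deleteFrom E (o + j * w) ((u.drop (j * w)).take w) = (u.drop (j * w)).take w) :
    ∃ ps, (chunkT w fl ds u.length g L D (acc ++ deleteFrom E o u ++ tl)).val = some ps ∧
      (knownSymbolsT w m ps).val = List.replicate g (List.replicate w false) ++
        List.zipWith (fun a b => if a then List.replicate w false else b) fl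
          (blocksT w fl.length u).val ∧
      ∃ v, (fillT ps (X ++ selected fl (blocksT w fl.length u).val)).val =
        some (X.flatten ++ v) ∧ u <+: v := by
  induction fl generalizing ds u o g L D acc X with
  | nil =>
    cases ds with
    | cons d ds => simp at hlen
    | nil =>
      obtain rfl : u = [] := List.length_eq_zero_iff.1 (by simpa using hu)
      have h0 := hcount 0 (by simp) (by simp)
      simp only [zero_mul, List.take_nil, deleteFrom_nil, List.length_nil, add_zero,
        guessed_zero] at h0
      have hLD : ¬ L < D := by omega
      have hsub : L - D = acc.length := by omega
      refine ⟨[Piece.erased g acc], ?_, ?_, ?_⟩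
      · simp [chunkT, hLD, hsub]
      · simp [knownSymbolsT, zerosT_val, hm]
      · refine ⟨[], ?_, by simp⟩
        rw [fillT_erased_of_sublist hX hacc]
        simp [fillT]
  | cons a fl ih =>
    cases ds with
    | nil => simp at hlen
    | cons d ds =>
      have hlen' : fl.length = ds.length := by simpa using hlen
      have hu' : (u.drop w).length ≤ fl.length * w := by
        simp only [List.length_cons, List.length_drop] at hu ⊢
        have : (fl.length + 1) * w = fl.length * w + w := by ring
        omega
      have hknown' : ∀ j, fl[j]? = some false →
          deleteFrom E (o + w + j * w) (((u.drop w).drop (j * w)).take w) =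
            ((u.drop w).drop (j * w)).take w := by
        intro j hj
        have := hknown (j + 1) (by simpa using hj)
        rw [List.drop_drop]
        rw [show (j + 1) * w = w + j * w by ring, ← add_assoc] at this
        exact this
      have hblocks : (blocksT w (fl.length + 1) u).val =
          (List.ofFn fun j : Fin w => u.getD j false) :: (blocksT w fl.length (u.drop w)).val := by
        simp [blocksT, splitPadT_val]
      have hsplit : ∀ j, (u.take ((j + 1) * w)).length =
          (u.take w).length + ((u.drop w).take (j * w)).length := by
        intro j
        rw [show (j + 1) * w = w + j * w by ring, List.take_add, List.length_append]
      have hdel : ∀ j, (deleteFrom E o (u.take ((j + 1) * w))).length =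
          (deleteFrom E o (u.take w)).length +
            (deleteFrom E (o + w) ((u.drop w).take (j * w))).length := by
        intro j
        rw [show (j + 1) * w = w + j * w by ring, deleteFrom_take_add, List.length_append]
      have htake : (u.take w).length = min w u.length := List.length_take
      have hdrop : u.length - w = (u.drop w).length := List.length_drop.symm
      cases a
      · have h0 := hcount 0 (by simp) (by simp)
        simp only [zero_mul, List.take_zero, deleteFrom_nil, List.length_nil, add_zero,
          guessed_zero] at h0
        have hk0 : deleteFrom E o (u.take w) = u.take w := by simpa using hknown 0 (by simp)
        have hLD : ¬ L < D := by omega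
        have hsub : L - D = acc.length := by omega
        -- An intact block closes the pending run, whose `L - D` bits are exactly `acc` by `hcount`
        -- at `0`; the recursion restarts with empty accumulators.
        obtain ⟨ps, h1, h2, v, h3, h4⟩ := ih (ds := ds) (u := u.drop w) (o := o + w) (g := 0)
          (L := 0) (D := 0) (acc := []) (X := []) hlen' hu' rfl (by simp)
          (by
            intro j hj hj2
            have := hcount (j + 1) (by simpa using hj) (by
              rcases hj2 with h | h
              · left; simp [h]
              · right; simpa using h)
            rw [hsplit, hdel, hk0] at this
            simp only [guessed, Bool.false_eq_true, if_false] at this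
            simp only [List.length_nil]
            omega) hknown'
        refine ⟨Piece.erased g acc :: Piece.known (u.take w) :: ps, ?_, ?_, ?_⟩
        · simp only [chunkT, Timed.val_bind, hLD, if_false, splitT_val, Timed.val_pure, hsub]
          rw [deleteFrom_take_drop E o w u, hk0, ← htake, hdrop]
          simp only [List.append_assoc, List.take_left', List.drop_left']
          simp only [List.nil_append] at h1
          rw [h1]
          rfl
        · simp only [knownSymbolsT, Timed.val_bind, splitPadT_val, Timed.val_pure, zerosT_val, h2,
            hm, List.length_cons, hblocks]
          simp
        · refine ⟨u.take w ++ v, ?_, ?_⟩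
          · rw [fillT_erased_of_sublist hX hacc, fillT_known, List.length_cons, hblocks]
            simp only [selected, Bool.false_eq_true, if_false]
            simp only [List.nil_append, List.flatten_nil] at h3
            rw [h3]
            simp
          · conv_lhs => rw [← List.take_append_drop w u]
            exact List.prefix_append_right_inj _ |>.2 h4
      -- An affected block joins the pending run: its surviving bits are appended to `acc`, its true
      -- symbol to `X`.
      · obtain ⟨ps, h1, h2, v, h3, h4⟩ := ih (ds := ds) (u := u.drop w) (o := o + w) (g := g + 1)
          (L := L + min w u.length) (D := D + d) (acc := acc ++ deleteFrom E o (u.take w))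
          (X := X ++ [List.ofFn fun j : Fin w => u.getD j false]) hlen' hu' (by simp [hX])
          (by
            rw [List.flatten_append]
            refine hacc.append ?_
            simp only [List.flatten_singleton]
            exact (deleteFrom_sublist _ _ _).trans (take_prefix_ofFn w u).sublist)
          (by
            intro j hj hj2
            have := hcount (j + 1) (by simpa using hj) (by
              rcases hj2 with h | h
              · left; simp [h]
              · right; simpa using h)
            rw [hsplit, hdel] at this
            simp only [guessed, if_true] at this
            simp only [List.length_append]
            omega) hknown'
        refine ⟨ps, ?_, ?_, ?_⟩
        · simp only [chunkT, Timed.val_bind, hdrop]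
          rw [deleteFrom_take_drop E o w u, ← List.append_assoc]
          exact h1
        · rw [h2, List.length_cons, hblocks]
          simp [List.replicate_succ']
        · refine ⟨(List.ofFn fun j : Fin w => u.getD j false) ++ v, ?_, ?_⟩
          · rw [List.length_cons, hblocks]
            simp only [selected, if_true]
            simp only [List.append_assoc, List.flatten_append, List.flatten_singleton,
              List.singleton_append] at h3
            exact h3
          · rcases le_total w u.length with h | h
            · conv_lhs => rw [← List.take_append_drop w u]
              have h5 : u.take w = List.ofFn fun j : Fin w => u.getD j false :=
                (take_prefix_ofFn w u).eq_of_length (by simp [h])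
              rw [h5]
              exact List.prefix_append_right_inj _ |>.2 h4
            -- The rest of the message fits into one block, and the padded symbol alone already has
            -- it as a prefix.
            · have := take_prefix_ofFn w u
              rw [List.take_of_length_le h] at this
              exact this.trans (List.prefix_append _ _)

/-! ### Costs -/

theorem chunkT_end_cost (g L D : ℕ) (y : Bits) :
    (if L < D then (pure none : Timed (Option (List Piece))) else do
      let s ← splitT (L - D) y
      return some [Piece.erased g s.1]).cost ≤ L + 1 := by
  split
  · simp
  · have := splitT_cost (L - D) y
    simp only [Timed.cost_bind, Timed.cost_pure]
    omega

theorem chunkT_cost (w : ℕ) (fl : List Bool) (ds : List ℕ) (n g L D : ℕ) (y : Bits) :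
    (chunkT w fl ds n g L D y).cost ≤ fl.length * (w + 3) + L + 3 := by
  induction fl generalizing ds n g L D y with
  | nil =>
    simp only [chunkT, Timed.cost_bind, cost_tick]
    have := chunkT_end_cost g L D y
    omega
  | cons a fl ih =>
    cases ds with
    | nil =>
      simp only [chunkT, Timed.cost_bind, cost_tick]
      have := chunkT_end_cost g L D y
      omega
    | cons d ds =>
      simp only [List.length_cons, Nat.succ_mul]
      cases a
      · simp only [chunkT, Timed.cost_bind, cost_tick]
        split
        · simp
        · simp only [Timed.cost_bind, Timed.cost_pure, splitT_val]
          have h1 := splitT_cost (L - D) y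
          have h2 := splitT_cost (min w n) (y.drop (L - D))
          have h3 := ih ds (n - w) 0 0 0 (((y.drop (L - D))).drop (min w n))
          omega
      · simp only [chunkT, Timed.cost_bind, cost_tick]
        have h3 := ih ds (n - w) (g + 1) (L + min w n) (D + d) y
        omega

/-- A measure of the size of a list of pieces. -/
def weight : List Piece → ℕ
  | [] => 0
  | Piece.known _ :: ps => 1 + weight ps
  | Piece.erased g _ :: ps => g + 1 + weight ps

theorem weight_le_of_chunkT {w : ℕ} {fl : List Bool} {ds : List ℕ} {n g L D : ℕ} {y : Bits}
    {ps : List Piece} (h : (chunkT w fl ds n g L D y).val = some ps) :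
    weight ps ≤ 2 * fl.length + g + 1 ∧ ∀ b, Piece.known b ∈ ps → b.length ≤ w := by
  have hend {L D g : ℕ} {y : Bits} {ps : List Piece}
      (h : (if L < D then (pure none : Timed (Option (List Piece))) else do
      let s ← splitT (L - D) y
      return some [Piece.erased g s.1]).val = some ps) :
      weight ps ≤ g + 1 ∧ ∀ b, Piece.known b ∈ ps → b.length ≤ w := by
    split at h
    · simp at h
    · simp only [Timed.val_bind, Timed.val_pure, Option.some.injEq] at h
      subst h
      simp [weight]
  induction fl generalizing ds n g L D y ps with
  | nil =>
    simp only [chunkT, Timed.val_bind] at h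
    simpa using hend h
  | cons a fl ih =>
    cases ds with
    | nil =>
      simp only [chunkT, Timed.val_bind] at h
      have := hend h
      exact ⟨by omega, this.2⟩
    | cons d ds =>
      cases a
      · simp only [chunkT, Timed.val_bind] at h
        split at h
        · simp at h
        · simp only [Timed.val_bind, Timed.val_pure, Option.map_eq_some_iff] at h
          obtain ⟨ps', h, rfl⟩ := h
          have h1 := ih h
          simp only [weight, List.length_cons]
          refine ⟨by omega, ?_⟩
          intro b hb
          simp only [List.mem_cons, reduceCtorEq, Piece.known.injEq, false_or] at hb
          rcases hb with rfl | hb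
          · simp only [splitT_val, List.length_take]
            omega
          · exact h1.2 b hb
      · simp only [chunkT, Timed.val_bind] at h
        have h1 := ih h
        simp only [List.length_cons]
        exact ⟨by omega, h1.2⟩

theorem zerosT_cost (l : Bits) (g : ℕ) (r : List Bits) :
    (zerosT l g r).cost = g * (l.length + 2) + 1 := by
  induction g with
  | zero => simp [zerosT]
  | succ g ih => simp [zerosT, ih]; ring

theorem knownSymbolsT_cost {w : ℕ} {l : Bits} (hl : l.length = w) (ps : List Piece) :
    (knownSymbolsT w l ps).cost ≤ weight ps * (w + 2) + 1 := by
  induction ps with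
  | nil => simp [knownSymbolsT]
  | cons p ps ih =>
    cases p with
    | known b =>
      simp only [knownSymbolsT, Timed.cost_bind, cost_tick, splitPadT_cost, Timed.cost_pure, weight]
      nlinarith
    | erased g sub =>
      simp only [knownSymbolsT, Timed.cost_bind, cost_tick, zerosT_cost, weight, hl]
      nlinarith

theorem length_flatten_le {w : ℕ} {X : List Bits} (h : ∀ b ∈ X, b.length ≤ w) :
    X.flatten.length ≤ X.length * w := by
  induction X with
  | nil => simp
  | cons b X ih =>
    simp only [List.flatten_cons, List.length_append, List.length_cons]
    have h1 := h b (by simp)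
    have h2 := ih fun b hb => h b (by simp [hb])
    nlinarith

theorem fillT_cost {w : ℕ} {ps : List Piece} (hps : ∀ b, Piece.known b ∈ ps → b.length ≤ w)
    {X : List Bits} (hX : ∀ b ∈ X, b.length ≤ w) :
    (fillT ps X).cost ≤ weight ps * (3 * w + 5) + 1 := by
  induction ps generalizing X with
  | nil => simp [fillT]
  | cons p ps ih =>
    have hps' : ∀ b, Piece.known b ∈ ps → b.length ≤ w := fun b hb => hps b (by simp [hb])
    cases p with
    | known b =>
      have h1 := ih hps' hX
      have h2 := hps b (by simp)
      simp only [fillT, Timed.cost_bind, cost_tick, weight]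
      split
      · simp only [Timed.cost_pure]; nlinarith
      · simp only [Timed.cost_bind, Timed.cost_pure, appendT_cost]; nlinarith
    | erased g sub =>
      have h1 := ih hps' (X := X.drop g) fun b hb => hX b (List.mem_of_mem_drop hb)
      have hXg : ∀ b ∈ X.take g, b.length ≤ w := fun b hb => hX b (List.mem_of_mem_take hb)
      have hg : (X.take g).length ≤ g := by simp
      have h2 := splitT_cost g X
      have h3 := flattenT_cost hXg
      have h4 := supersequenceT_cost sub (X.take g).flatten
      have h5 : (X.take g).flatten.length ≤ g * w :=
        (length_flatten_le hXg).trans (Nat.mul_le_mul_right _ hg)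
      have h6 : (X.take g).length * (w + 2) ≤ g * (w + 2) := Nat.mul_le_mul_right _ hg
      simp only [fillT, Timed.cost_bind, cost_tick, weight, splitT_val, flattenT_val]
      split
      · simp only [Timed.cost_bind]
        split
        · simp only [Timed.cost_pure]; nlinarith
        · simp only [Timed.cost_bind, Timed.cost_pure, appendT_cost]; nlinarith
      · simp only [Timed.cost_pure]; nlinarith

end GC

/-! ### The counting argument for a single wrong guess. -/

namespace GC

/-! ### Counting the messages that a wrong guess decodes to something else -/

section Counting

theorem xor_eq_false_iff {a b : Bool} : xor a b = false ↔ a = b := by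
  cases a <;> cases b <;> simp

/-- Extension of a message by a constant bit. -/
def extend {k : ℕ} (β : Bool) (u : Fin k → Bool) (i : ℕ) : Bool :=
  if h : i < k then u ⟨i, h⟩ else β

@[simp] theorem extend_val {k : ℕ} (β : Bool) (u : Fin k → Bool) (i : Fin k) :
    extend β u i = u i := by
  simp [extend]

/-- Position in the sent string of the received bit that a guess reads as bit `i` of the message,
if the positions in `E` are deleted and `sh b` deletions are guessed before block `b`. -/
noncomputable def source (E : Finset ℕ) (w : ℕ) (sh : ℕ → ℕ) (i : ℕ) : ℕ :=
  Nat.nth (· ∉ E) (i - sh (i / w))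

theorem infinite_notMem (E : Finset ℕ) : (Set.ofPred (· ∉ E)).Infinite := by
  exact E.finite_toSet.infinite_compl

theorem nth_notMem_strictMono (E : Finset ℕ) : StrictMono (Nat.nth (· ∉ E)) :=
  Nat.nth_strictMono (infinite_notMem E)

theorem nth_notMem (E : Finset ℕ) (j : ℕ) : Nat.nth (· ∉ E) j ∉ E :=
  Nat.nth_mem_of_infinite (infinite_notMem E) j

theorem count_nth_notMem (E : Finset ℕ) (j : ℕ) :
    Nat.count (· ∉ E) (Nat.nth (· ∉ E) j) = j :=
  Nat.count_nth_of_infinite (infinite_notMem E) j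

/-- The conditions on the shifts in a guess: `known b` means that block `b` is regarded as
intact. -/
structure IsShift (w : ℕ) (known : ℕ → Prop) (sh : ℕ → ℕ) : Prop where
  mono : Monotone sh
  gap : ∀ i j, i < j → known i → known j → sh j ≤ sh i + (j - i - 1) * w
  le : ∀ i, known i → sh i ≤ i * w

variable {w : ℕ} {known : ℕ → Prop} {sh : ℕ → ℕ} {E : Finset ℕ}

/-- Within a block the shift is constant. Between two intact blocks it grows by at most the total
length of the blocks strictly between them, so the reading index still advances. -/
theorem IsShift.sub_lt_sub (h : IsShift w known sh) {i j : ℕ} (hij : i < j)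
    (hi : known (i / w)) (hj : known (j / w)) : i - sh (i / w) < j - sh (j / w) := by
  have h1 := h.le _ hi
  have h2 := Nat.div_mul_le_self i w
  rcases (Nat.div_le_div_right hij.le : i / w ≤ j / w).lt_or_eq with h3 | h3
  · have h4 := h.gap _ _ h3 hi hj
    have h5 := Nat.div_mul_le_self j w
    have h7 : 0 < w := by
      rcases Nat.eq_zero_or_pos w with rfl | h7
      · simp at h3
      · exact h7
    have h6 : i < (i / w + 1) * w := by
      rw [mul_comm]; exact Nat.lt_mul_div_succ i h7
    obtain ⟨d, hd⟩ := Nat.exists_eq_add_of_lt h3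
    rw [hd] at h5 ⊢
    rw [hd] at h4
    have h8 : i / w + d + 1 - i / w - 1 = d := by omega
    rw [h8] at h4
    have h9 : (i / w + d + 1) * w = (i / w + 1) * w + d * w := by ring
    omega
  · rw [← h3]; omega

/-- The index advances by at least one by `sub_lt_sub` and by at most one because `sh` is monotone.
Reading is thus contiguous even across the border of two intact blocks. -/
theorem IsShift.sub_succ (h : IsShift w known sh) {i : ℕ}
    (hi : known (i / w)) (hj : known ((i + 1) / w)) :
    i + 1 - sh ((i + 1) / w) = i - sh (i / w) + 1 := by
  have h1 := h.sub_lt_sub (Nat.lt_add_one i) hi hj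
  have h2 := h.mono (Nat.div_le_div_right (Nat.le_add_right i 1) : i / w ≤ (i + 1) / w)
  have h3 := h.le _ hi
  have h4 := Nat.div_mul_le_self i w
  omega

theorem IsShift.source_lt_source (h : IsShift w known sh) {i j : ℕ} (hij : i < j)
    (hi : known (i / w)) (hj : known (j / w)) : source E w sh i < source E w sh j :=
  nth_notMem_strictMono E (h.sub_lt_sub hij hi hj)

/-- If `i` is read correctly, the reading index at `i` is the number of survivors before `i`. Were
`i + 1` a survivor, it would be the next one and would be read correctly too. -/
theorem IsShift.succ_mem (h : IsShift w known sh) {i : ℕ} (hi : known (i / w))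
    (hj : known ((i + 1) / w)) (h1 : source E w sh i = i) (h2 : source E w sh (i + 1) ≠ i + 1) :
    i + 1 ∈ E := by
  by_contra h3
  apply h2
  rw [source, h.sub_succ hi hj]
  have h4 := count_nth_notMem E (i - sh (i / w))
  have h5 := nth_notMem E (i - sh (i / w))
  rw [source] at h1
  rw [h1] at h4 h5
  have h6 : Nat.count (· ∉ E) (i + 1) = i - sh (i / w) + 1 := by
    rw [Nat.count_succ, h4, if_pos h5]
  rw [← h6]
  exact Nat.nth_count h3

/-- Mirror image of `succ_mem`: a surviving `i` would be the survivor just before `i + 1`, hence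
read correctly. -/
theorem IsShift.mem (h : IsShift w known sh) {i : ℕ} (hi : known (i / w))
    (hj : known ((i + 1) / w)) (h1 : source E w sh i ≠ i) (h2 : source E w sh (i + 1) = i + 1) :
    i ∈ E := by
  by_contra h3
  apply h1
  rw [source, h.sub_succ hi hj] at h2
  have h4 := count_nth_notMem E (i - sh (i / w) + 1)
  rw [h2, Nat.count_succ, if_pos h3] at h4
  rw [source, ← Nat.succ_injective h4]
  exact Nat.nth_count h3

/-- Strict monotonicity, step by step: along a stretch of intact positions the lead of `source` over
the position cannot shrink. -/
theorem IsShift.sub_le_source_sub (h : IsShift w known sh) {i j : ℕ} (hij : i ≤ j)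
    (hk : ∀ l, i ≤ l → l ≤ j → known (l / w)) :
    source E w sh i + (j - i) ≤ source E w sh j := by
  induction j, hij using Nat.le_induction with
  | base => simp
  | succ j hij ih =>
    have h1 := ih fun l h1 h2 => hk l h1 (by omega)
    have h2 : source E w sh j < source E w sh (j + 1) :=
      h.source_lt_source (Nat.lt_succ_self j) (hk j hij (by omega)) (hk _ (by omega) le_rfl)
    omega

/-- If a block contains a fixed point of the reading and another position which is not fixed, then
it contains a deletion next to the interval of fixed points. -/
theorem IsShift.exists_deletion (h : IsShift w known sh) {i p : ℕ} (hi : known (i / w))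
    (hp : p / w = i / w) (hfi : source E w sh i = i) (hfp : source E w sh p ≠ p) :
    ∃ t ∈ E, t / w = i / w ∧
      ((i < t ∧ t < source E w sh t) ∨ (t < i ∧ source E w sh t < t)) := by
  have hblock : ∀ l, min i p ≤ l → l ≤ max i p → l / w = i / w := by
    intro l h1 h2
    apply le_antisymm
    · have := (Nat.div_le_div_right h2 : l / w ≤ max i p / w)
      rcases max_cases i p with ⟨h3, -⟩ | ⟨h3, -⟩ <;> rw [h3] at this <;> omega
    · have := (Nat.div_le_div_right h1 : min i p / w ≤ l / w)
      rcases min_cases i p with ⟨h3, -⟩ | ⟨h3, -⟩ <;> rw [h3] at this <;> omega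
  have hne : p ≠ i := fun h => hfp (h ▸ hfi)
  rcases lt_or_gt_of_ne hne with hlt | hgt
  -- Walk from `p` towards `i`. At the step where the fixed points begin, `mem` (or `succ_mem` on
  -- the other side) yields the deletion, and strict monotonicity tells in which direction it is
  -- displaced.
  · induction hd : i - p using Nat.strong_induction_on generalizing p with
    | _ d ih =>
    subst hd
    have hb1 := hblock (p + 1) (by omega) (by omega)
    by_cases h1 : source E w sh (p + 1) = p + 1
    · have h2 := h.mem (hp ▸ hi) (hb1 ▸ hi) hfp h1
      have h3 : source E w sh p < source E w sh (p + 1) :=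
        h.source_lt_source (Nat.lt_succ_self p) (hp ▸ hi) (hb1 ▸ hi)
      exact ⟨p, h2, hp, Or.inr ⟨hlt, by omega⟩⟩
    · have h2 : p + 1 ≠ i := fun h' => h1 (h' ▸ hfi)
      exact ih (i - (p + 1)) (by omega) hb1 h1 (fun l h3 h4 => hblock l (by omega) (by omega)) h2
        (by omega) rfl
  · induction hd : p - i using Nat.strong_induction_on generalizing p with
    | _ d ih =>
    subst hd
    obtain ⟨p, rfl⟩ : ∃ q, p = q + 1 := ⟨p - 1, by omega⟩
    have hb1 := hblock p (by omega) (by omega)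
    by_cases h1 : source E w sh p = p
    · have h2 := h.succ_mem (hb1 ▸ hi) (hp ▸ hi) h1 hfp
      have h3 : source E w sh p < source E w sh (p + 1) :=
        h.source_lt_source (Nat.lt_succ_self p) (hb1 ▸ hi) (hp ▸ hi)
      exact ⟨p + 1, h2, hp, Or.inl ⟨hgt, by omega⟩⟩
    · have h2 : p ≠ i := fun h' => h1 (h' ▸ hfi)
      exact ih (p - i) (by omega) hb1 h1 (fun l h3 h4 => hblock l (by omega) (by omega)) h2
        (by omega) rfl

/-- The fixed points in blocks that are not entirely fixed inject into the windows. -/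
theorem IsShift.card_fixed_le (h : IsShift w known sh) (hw : 0 < w) {z : ℕ}
    {start size : Fin z → ℕ} (hsize : ∀ i, size i ≤ w)
    (hE : ∀ j ∈ E, ∃ i, j ∈ Finset.Ico (start i) (start i + size i)) {P : Finset ℕ}
    (hP : ∀ i ∈ P, known (i / w) ∧ source E w sh i = i ∧
      ∃ p, p / w = i / w ∧ source E w sh p ≠ p) :
    P.card ≤ z * w := by
  classical
  have hex : ∀ i ∈ P, ∃ t, ∃ a : Fin z, t ∈ Finset.Ico (start a) (start a + size a) ∧
      t / w = i / w ∧ ((i < t ∧ t < source E w sh t) ∨ (t < i ∧ source E w sh t < t)) := by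
    intro i hi
    obtain ⟨h1, h2, p, h3, h4⟩ := hP i hi
    obtain ⟨t, ht, h5, h6⟩ := h.exists_deletion h1 h3 h2 h4
    obtain ⟨a, ha⟩ := hE t ht
    exact ⟨t, a, ha, h5, h6⟩
  rcases P.eq_empty_or_nonempty with rfl | ⟨i0, hi0⟩
  · simp
  have : Nonempty (Fin z) := by
    obtain ⟨-, a, -⟩ := hex i0 hi0
    exact ⟨a⟩
  choose! t a ha using hex
  -- Equal residues put `i < j` into different blocks. Their deletions share a window, hence are
  -- less than `w` apart, so the blocks are neighbours and `j = i + w`.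
  have key : ∀ i ∈ P, ∀ j ∈ P, a i = a j → i % w = j % w → i < j → False := by
    intro i hi j hj h1 h2 hij
    obtain ⟨ha1, ha2, ha3⟩ := ha i hi
    obtain ⟨hb1, hb2, hb3⟩ := ha j hj
    obtain ⟨hi1, hi2, -⟩ := hP i hi
    obtain ⟨hj1, hj2, -⟩ := hP j hj
    rw [← h1, Finset.mem_Ico] at hb1
    rw [Finset.mem_Ico] at ha1
    have hs := hsize (a i)
    have ei := Nat.div_add_mod i w
    have ej := Nat.div_add_mod j w
    have eti := Nat.div_add_mod (t i) w
    have etj := Nat.div_add_mod (t j) w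
    have mi := Nat.mod_lt i hw
    have mti := Nat.mod_lt (t i) hw
    have mtj := Nat.mod_lt (t j) hw
    rw [ha2] at eti
    rw [hb2] at etj
    have hblt : i / w < j / w := by
      rcases (Nat.div_le_div_right hij.le : i / w ≤ j / w).lt_or_eq with h3 | h3
      · exact h3
      · rw [← h3, ← h2] at ej; omega
    have hb : j / w = i / w + 1 := by
      by_contra hne
      have h3 : i / w + 2 ≤ j / w := by omega
      have h4 : w * (i / w + 2) ≤ w * (j / w) := Nat.mul_le_mul_left _ h3
      have h5 : w * (i / w + 2) = w * (i / w) + w + w := by ring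
      omega
    have hjw : w * (j / w) = w * (i / w) + w := by rw [hb]; ring
    have hkn : ∀ l, i ≤ l → l < w * (j / w) + w → known (l / w) := by
      intro l h3 h4
      have h5 : i / w ≤ l / w := Nat.div_le_div_right h3
      have h6 : l / w < j / w + 1 := by
        rw [Nat.div_lt_iff_lt_mul hw, mul_comm, mul_add, mul_one]
        exact h4
      rcases (show l / w = i / w ∨ l / w = j / w by omega) with h7 | h7
      · exact h7 ▸ hi1
      · exact h7 ▸ hj1
    -- If `t i` lies to the right of `i`, it is read ahead of itself, and this lead would persist up
    -- to the fixed point `j`.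
    rcases ha3 with ⟨h3, h4⟩ | ⟨h3, -⟩
    · have := h.sub_le_source_sub (E := E) (i := t i) (j := j) (by omega)
        fun l h5 h6 => hkn l (by omega) (by omega)
      omega
    -- Now `t i < i`. If `t j > j`, the deletions are more than `w` apart. Otherwise `t j` is read
    -- behind itself, although it comes after the fixed point `i`, from which no lag can arise.
    · rcases hb3 with ⟨h5, -⟩ | ⟨h5, h6⟩
      · omega
      · have := h.sub_le_source_sub (E := E) (i := i) (j := t j) (by omega)
          fun l h5 h6 => hkn l (by omega) (by omega)
        omega
  have hinj : Set.InjOn (fun i => (a i, (⟨i % w, Nat.mod_lt i hw⟩ : Fin w))) P := by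
    intro i hi j hj hij
    simp only [Prod.mk.injEq, Fin.mk.injEq] at hij
    rcases lt_trichotomy i j with h1 | h1 | h1
    · exact (key i hi j hj hij.1 hij.2 h1).elim
    · exact h1
    · exact (key j hj i hi hij.1.symm hij.2.symm h1).elim
  have := Finset.card_le_card_of_injOn _ (t := (Finset.univ : Finset (Fin z × Fin w)))
    (fun i _ => Finset.mem_univ _) hinj
  simpa using this

theorem card_filter_div_mem {k : ℕ} (hw : 0 < w) {C : Finset ℕ} (hC : ∀ b ∈ C, b * w + w ≤ k) :
    ((Finset.range k).filter fun i => i / w ∈ C).card = C.card * w := by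
  rw [Finset.card_eq_sum_card_fiberwise (f := fun i => i / w) (t := C) (fun i hi => by
    simp only [Finset.coe_filter, Set.mem_ofPred_eq] at hi; exact hi.2)]
  rw [Finset.sum_const_nat (m := w)]
  intro b hb
  have h1 := hC b hb
  have : ({i ∈ {i ∈ Finset.range k | i / w ∈ C} | i / w = b}) = Finset.Ico (b * w) (b * w + w) := by
    ext i
    simp only [Finset.mem_filter, Finset.mem_range, Finset.mem_Ico]
    have h2 : i / w = b ↔ b * w ≤ i ∧ i < b * w + w := by
      rw [Nat.div_eq_iff hw]
      omega
    constructor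
    · rintro ⟨-, h⟩; exact h2.1 h
    · intro h
      have h3 := h2.2 h
      exact ⟨⟨by omega, h3 ▸ hb⟩, h3⟩
  rw [this]
  simp

/-- A position of disagreement is intact, moved by `source`, and sent to another position of
disagreement. A strictly increasing map of a finite set to itself is the identity, so there is no
disagreement. Reading outside the message gives `β` in both cases and stops the recursion. -/
theorem IsShift.eq_of_agree {k : ℕ} (h : IsShift w known sh) {β : Bool} {u u' : Fin k → Bool}
    (hagree : ∀ i : Fin k, ¬ known (i / w) ∨ source E w sh i = i → u i = u' i)
    (hstep : ∀ i : Fin k, known (i / w) →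
      extend β u (source E w sh i) = extend β u' (source E w sh i) → u i = u' i) : u = u' := by
  classical
  let Y : Finset ℕ := (Finset.range k).filter fun i => extend β u i ≠ extend β u' i
  have hY : ∀ i ∈ Y, known (i / w) ∧ source E w sh i ≠ i ∧ source E w sh i ∈ Y := by
    intro i hi
    obtain ⟨h1, h2⟩ := Finset.mem_filter.1 hi
    rw [Finset.mem_range] at h1
    simp only [extend, h1, dif_pos] at h2
    have h3 := mt (hagree ⟨i, h1⟩) h2
    simp only [not_or, not_not] at h3
    have h4 := mt (hstep ⟨i, h1⟩ h3.1) h2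
    refine ⟨h3.1, h3.2, Finset.mem_filter.2 ⟨?_, h4⟩⟩
    rw [Finset.mem_range]
    by_contra h5
    simp [extend, h5] at h4
  suffices hemp : Y = ∅ by
    funext i
    by_contra hne
    have : (i : ℕ) ∈ Y := Finset.mem_filter.2 ⟨Finset.mem_range.2 i.2, by simpa using hne⟩
    simp [hemp] at this
  by_contra hne
  -- The largest disagreement must move down. The least one that moves down has an image which again
  -- moves down, a contradiction.
  obtain ⟨i, hi, hmax⟩ := Y.exists_max_image id (Finset.nonempty_iff_ne_empty.2 hne)
  let Z := Y.filter fun i => source E w sh i < i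
  have hZ : Z.Nonempty := by
    refine ⟨i, Finset.mem_filter.2 ⟨hi, ?_⟩⟩
    obtain ⟨-, h2, h3⟩ := hY i hi
    exact lt_of_le_of_ne (hmax _ h3) h2
  obtain ⟨j, hj, hmin⟩ := Z.exists_min_image id hZ
  obtain ⟨hj1, hj2⟩ := Finset.mem_filter.1 hj
  obtain ⟨h1, -, h3⟩ := hY j hj1
  have h4 := (hY _ h3).1
  have : source E w sh j ∈ Z := Finset.mem_filter.2 ⟨h3, h.source_lt_source hj2 h4 h1⟩
  have := hmin _ this
  simp only [id] at this
  omega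

/-- Bound on the number of messages for which a fixed guess yields a wrong message that agrees with
the right one in the parities. -/
theorem IsShift.card_bad_le (h : IsShift w known sh) (hw : 0 < w) {k c z : ℕ}
    {start size : Fin z → ℕ} (hsize : ∀ i, size i ≤ w)
    (hE : ∀ j ∈ E, ∃ i, j ∈ Finset.Ico (start i) (start i + size i))
    {Er : Finset ℕ} (hEr : ∀ i < k, ¬ known (i / w) → i ∈ Er) (hErc : Er.card ≤ 2 * z * w)
    {Ker : Set (Fin k → Bool)}
    (hxor : ∀ a ∈ Ker, ∀ b ∈ Ker, (fun i => xor (a i) (b i)) ∈ Ker)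
    (hmds : ∀ a ∈ Ker, ∀ C : Finset ℕ, C.card ≤ c → (∀ i, a i = true → (i : ℕ) / w ∈ C) →
      ∀ i, a i = false)
    {β : Bool} {bad : Finset (Fin k → Bool)} {v : (Fin k → Bool) → Fin k → Bool}
    (hne : ∀ u ∈ bad, v u ≠ u) (hker : ∀ u ∈ bad, (fun i => xor (u i) (v u i)) ∈ Ker)
    (hv : ∀ u ∈ bad, ∀ i : Fin k, known (i / w) → v u i = extend β u (source E w sh i)) :
    bad.card * 2 ^ (c * w) ≤ 2 ^ (k + 3 * z * w) := by
  classical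
  rcases bad.eq_empty_or_nonempty with rfl | ⟨u0, hu0⟩
  · simp
  -- On `F` the guess copies the message correctly, whatever the message is; every error therefore
  -- lies in `S`.
  let F : Finset ℕ := (Finset.range k).filter fun i => known (i / w) ∧ source E w sh i = i
  let S : Finset ℕ := Finset.range k \ F
  have hsupp : ∀ u ∈ bad, ∀ i : Fin k, xor (u i) (v u i) = true → (i : ℕ) ∈ S := by
    intro u hu i hi
    simp only [S, F, Finset.mem_sdiff, Finset.mem_range, i.2, true_and, Finset.mem_filter]
    rintro ⟨h1, h2⟩
    rw [hv u hu i h1, h2] at hi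
    simp [extend] at hi
  -- If at most `c` blocks met `S`, the error of `u0` would be zero by `hmds`.
  have hN : c + 1 ≤ (S.image (· / w)).card := by
    by_contra hlt
    have h0 := hmds _ (hker u0 hu0) (S.image (· / w)) (by omega) fun i hi =>
      Finset.mem_image_of_mem _ (hsupp u0 hu0 i hi)
    apply hne u0 hu0
    funext i
    have := h0 i
    exact (xor_eq_false_iff.1 this).symm
  -- The block numbered `k / w` is discarded because it may be incomplete; at least `c` blocks
  -- remain, and these consist of exactly `w` message bits each.
  obtain ⟨C, hCsub, hCc⟩ := Finset.exists_subset_card_eq (s := (S.image (· / w)).erase (k / w))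
    (n := c) (by have := Finset.pred_card_le_card_erase (s := S.image (· / w)) (a := k / w); omega)
  have hC : ∀ b ∈ C, b * w + w ≤ k ∧ ∃ p ∈ S, p / w = b := by
    intro b hb
    obtain ⟨h1, h2⟩ := Finset.mem_erase.1 (hCsub hb)
    obtain ⟨p, hp, hpb⟩ := Finset.mem_image.1 h2
    refine ⟨?_, p, hp, hpb⟩
    have hpk : p < k := Finset.mem_range.1 (Finset.mem_sdiff.1 hp).1
    have h3 : p / w ≤ k / w := Nat.div_le_div_right hpk.le
    have h4 : b + 1 ≤ k / w := by omega
    have h5 := Nat.mul_le_mul_right w h4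
    have h6 := Nat.div_mul_le_self k w
    rw [Nat.succ_mul] at h5
    omega
  let Q : Finset ℕ := (Finset.range k).filter fun i => i / w ∈ C
  have hQc : Q.card = c * w := by rw [card_filter_div_mem hw fun b hb => (hC b hb).1, hCc]
  have hFQ : (Q ∩ F).card ≤ z * w := by
    apply h.card_fixed_le hw hsize hE
    intro i hi
    obtain ⟨h1, h2⟩ := Finset.mem_inter.1 hi
    obtain ⟨-, h3, h4⟩ := Finset.mem_filter.1 h2
    obtain ⟨p, hp, hpb⟩ := (hC _ (Finset.mem_filter.1 h1).2).2
    refine ⟨h3, h4, p, hpb, fun h5 => ?_⟩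
    obtain ⟨h6, h7⟩ := Finset.mem_sdiff.1 hp
    exact h7 (Finset.mem_filter.2 ⟨h6, hpb ▸ h3, h5⟩)
  -- `S` and `F` partition the `k` positions, and dropping `Q` from `S` saves `c * w` bits except
  -- for the at most `z * w` fixed ones in `Q`. The erased positions add at most `2 * z * w`.
  have hSQ : (S \ Q).card + (F ∪ Er).card + c * w ≤ k + 3 * z * w := by
    have h1 : S.card + F.card = k := by
      have : F ⊆ Finset.range k := Finset.filter_subset _ _
      have := Finset.card_sdiff_add_card_eq_card this
      simpa using this
    have h2 : (S \ Q).card + (Q ∩ S).card = S.card := by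
      rw [Finset.inter_comm]
      exact Finset.card_sdiff_add_card_inter S Q
    have h3 : (Q ∩ S).card + (Q ∩ F).card = Q.card := by
      have : Q ∩ S = Q \ F := by
        ext i
        simp only [S, Q, Finset.mem_inter, Finset.mem_sdiff, Finset.mem_filter]
        tauto
      rw [this]
      exact Finset.card_sdiff_add_card_inter Q F
    have h4 := Finset.card_union_le F Er
    have h5 : 3 * z * w = 2 * z * w + z * w := by ring
    omega
  -- The first component records the error outside `Q`; the second records the bits of `u` from
  -- which the recursion through `source` starts.
  let enc : (Fin k → Bool) → Finset ℕ × Finset ℕ := fun u =>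
    ((S \ Q).filter fun i => xor (extend false u i) (extend false (v u) i) = true,
      (F ∪ Er).filter fun i => extend false u i = true)
  have henc : Set.InjOn enc bad := by
    intro u hu u' hu' heq
    simp only [enc, Prod.mk.injEq] at heq
    obtain ⟨heq1, heq2⟩ := heq
    -- The sum of two errors with the same bits outside `Q` has zero parities and is supported on
    -- the `c` blocks of `C`, hence vanishes.
    have hd : ∀ i : Fin k, xor (u i) (v u i) = xor (u' i) (v u' i) := by
      have h1 := hxor _ (hker u hu) _ (hker u' hu')
      have h2 := hmds _ h1 C hCc.le (by
        intro i hi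
        by_contra hiC
        have hiQ : (i : ℕ) ∉ Q := fun h => hiC (Finset.mem_filter.1 h).2
        by_cases hiS : (i : ℕ) ∈ S
        · have := Finset.ext_iff.1 heq1 i
          simp only [Finset.mem_filter, Finset.mem_sdiff, hiS, hiQ, not_false_eq_true, and_self,
            true_and, extend_val] at this
          have h3 := Bool.eq_iff_iff.2 this
          simp [h3] at hi
        · have h3 := mt (hsupp u hu i) hiS
          have h4 := mt (hsupp u' hu' i) hiS
          simp only [Bool.not_eq_true] at h3 h4
          simp [h3, h4] at hi)
      intro i
      have := h2 i
      exact xor_eq_false_iff.1 this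
    apply h.eq_of_agree (E := E) (β := β)
    · intro i hi
      have hiR : (i : ℕ) ∈ F ∪ Er := by
        by_cases hk : known (i / w)
        · refine Finset.mem_union_left _ (Finset.mem_filter.2 ⟨Finset.mem_range.2 i.2, hk, ?_⟩)
          exact hi.resolve_left (not_not.2 hk)
        · exact Finset.mem_union_right _ (hEr i i.2 hk)
      have := Finset.ext_iff.1 heq2 i
      simp only [Finset.mem_filter, hiR, true_and, extend_val] at this
      exact Bool.eq_iff_iff.2 this
    · intro i hk hs
      have h1 := hd i
      rw [hv u hu i hk, hv u' hu' i hk, hs] at h1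
      simpa using h1
  have hcard : bad.card ≤ 2 ^ ((S \ Q).card + (F ∪ Er).card) := by
    have := Finset.card_le_card_of_injOn enc
      (t := (S \ Q).powerset ×ˢ (F ∪ Er).powerset) (by
        intro u _
        simp only [enc, Finset.coe_product, Set.mem_prod, Finset.mem_coe, Finset.mem_powerset]
        exact ⟨Finset.filter_subset _ _, Finset.filter_subset _ _⟩) henc
    rwa [Finset.card_product, Finset.card_powerset, Finset.card_powerset, ← pow_add] at this
  calc bad.card * 2 ^ (c * w) ≤ 2 ^ ((S \ Q).card + (F ∪ Er).card) * 2 ^ (c * w) :=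
        Nat.mul_le_mul_right _ hcard
    _ = 2 ^ ((S \ Q).card + (F ∪ Er).card + c * w) := by rw [← pow_add]
    _ ≤ 2 ^ (k + 3 * z * w) := Nat.pow_le_pow_right (by norm_num) hSQ

end Counting

end GC

/-! ### Positions of surviving bits, consequences of the MDS property, recovery of the parities. -/

namespace GC

/-! ### The string that remains after deletions -/

theorem count_notMem_add_card (D : Finset ℕ) (n : ℕ) :
    Nat.count (· ∉ D) n + (D ∩ Finset.range n).card = n := by
  rw [Nat.count_eq_card_filter_range, ← Finset.sdiff_eq_filter, Finset.inter_comm]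
  simp [Finset.card_sdiff_add_card_inter]

theorem length_deleteAt (D : Finset ℕ) (x : Bits) :
    (deleteAt D x).length = Nat.count (· ∉ D) x.length := by
  have h1 := length_deleteFrom D 0 x
  have h2 := count_notMem_add_card D x.length
  rw [zero_add, ← Finset.range_eq_Ico] at h1
  rw [deleteAt_eq]
  omega

/-- Survivors are counted in all of `ℕ` and not only inside the string, so an index past the end
gives `none` on both sides. -/
theorem getElem?_deleteAt (D : Finset ℕ) (x : Bits) (j : ℕ) :
    (deleteAt D x)[j]? = x[Nat.nth (· ∉ D) j]? := by
  have hmono := nth_notMem_strictMono D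
  induction x using List.reverseRecOn with
  | nil => simp [deleteAt]
  | append_singleton x b ih =>
    have hlen := length_deleteAt D x
    rw [deleteAt_eq] at ih hlen ⊢
    rw [deleteFrom_append, deleteFrom_singleton, zero_add]
    have hj := count_nth_notMem D j
    have hnj := nth_notMem D j
    rcases lt_trichotomy (Nat.nth (· ∉ D) j) x.length with h | h | h
    · have h1 : j < (deleteFrom D 0 x).length := by
        rw [hlen, ← hj]
        exact Nat.count_strict_mono hnj h
      rw [List.getElem?_append_left h1, List.getElem?_append_left h, ih]
    · have h1 : j = (deleteFrom D 0 x).length := by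
        rw [hlen, ← h, hj]
      rw [if_neg (h ▸ hnj), List.getElem?_append_right h1.ge, List.getElem?_append_right h.ge,
        ← h1, h]
      simp
    · have h1 : (deleteFrom D 0 x).length ≤ j := by
        rw [hlen, ← hj]
        exact Nat.count_monotone _ h.le
      rw [List.getElem?_append_right h1, List.getElem?_append_right h.le]
      by_cases h2 : x.length ∈ D
      · rw [if_pos h2, List.getElem?_eq_none (by simp), List.getElem?_eq_none (by simp; omega)]
      · have h3 : (deleteFrom D 0 x).length < j := by
          rw [hlen, ← hj]
          exact Nat.count_strict_mono h2 h
        rw [if_neg h2, List.getElem?_eq_none (by simp; omega),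
          List.getElem?_eq_none (by simp; omega)]

theorem nth_notMem_le (D : Finset ℕ) (j : ℕ) : Nat.nth (· ∉ D) j ≤ j + D.card := by
  have h1 := count_notMem_add_card D (Nat.nth (· ∉ D) j)
  rw [count_nth_notMem] at h1
  have : (D ∩ Finset.range (Nat.nth (· ∉ D) j)).card ≤ D.card :=
    Finset.card_le_card Finset.inter_subset_left
  omega

theorem le_nth_notMem (D : Finset ℕ) (j : ℕ) : j ≤ Nat.nth (· ∉ D) j :=
  (nth_notMem_strictMono D).le_apply

theorem card_le_of_windows {z w : ℕ} {D : Finset ℕ} {start size : Fin z → ℕ}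
    (hsize : ∀ i, size i ≤ w)
    (hD : ∀ j ∈ D, ∃ i, j ∈ Finset.Ico (start i) (start i + size i)) : D.card ≤ z * w := by
  classical
  have h1 : D ⊆ Finset.univ.biUnion fun i => Finset.Ico (start i) (start i + size i) := by
    intro j hj
    obtain ⟨i, hi⟩ := hD j hj
    exact Finset.mem_biUnion.2 ⟨i, Finset.mem_univ _, hi⟩
  refine (Finset.card_le_card h1).trans ?_
  have := Finset.card_biUnion_le_card_mul (Finset.univ : Finset (Fin z))
    (fun i => Finset.Ico (start i) (start i + size i)) w (by simpa using hsize)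
  simpa using this

/-! ### Lists of symbols -/

theorem zipWith_ofFn {α β γ : Type} {n : ℕ} (f : α → β → γ) (a : Fin n → α) (b : Fin n → β) :
    List.zipWith f (List.ofFn a) (List.ofFn b) = List.ofFn fun i => f (a i) (b i) := by
  apply List.ext_getElem <;> simp

theorem sum_selected_ofFn {R : Type} [AddCommMonoid R] {n : ℕ} (a : Fin n → Bool) (f : Fin n → R) :
    (selected (List.ofFn a) (List.ofFn f)).sum = ∑ i, if a i then f i else 0 := by
  induction n with
  | zero => simp [selected]
  | succ n ih =>
    rw [List.ofFn_succ, List.ofFn_succ, Fin.sum_univ_succ, ← ih]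
    simp only [selected]
    split <;> simp

theorem count_ofFn {n : ℕ} (a : Fin n → Bool) :
    (List.ofFn a).count true = (Finset.univ.filter fun i => a i = true).card := by
  induction n with
  | zero => simp
  | succ n ih =>
    rw [List.ofFn_succ, List.count_cons, ih, Fin.card_filter_univ_succ]
    cases a 0 <;> simp

theorem getElem?_flatten_replicate (N : ℕ) (l : Bits) (i r : ℕ) (hr : r < N) :
    ((l.map (List.replicate N)).flatten)[N * i + r]? = l[i]? := by
  induction l generalizing i with
  | nil => simp
  | cons b l ih =>
    rw [List.map_cons, List.flatten_cons]
    cases i with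
    | zero => rw [List.getElem?_append_left (by simp; omega)]; simp [hr]
    | succ i =>
      rw [List.getElem?_append_right (by simp; nlinarith), List.getElem?_cons_succ, ← ih i]
      congr 1
      rw [List.length_replicate, Nat.mul_succ]
      omega

theorem blocksT_flatten {w : ℕ} {P : List Bits} (hP : ∀ b ∈ P, b.length = w) :
    (blocksT w P.length P.flatten).val = P := by
  induction P with
  | nil => simp [blocksT]
  | cons b P ih =>
    have hb := hP b (by simp)
    simp only [blocksT, List.length_cons, Timed.val_bind, Timed.val_pure, splitPadT_val,
      List.flatten_cons]
    rw [show (b ++ P.flatten).drop w = P.flatten by rw [← hb]; simp,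
      ih fun b hb => hP b (by simp [hb])]
    congr 1
    subst hb
    apply List.ext_getElem
    · simp
    · intro i h1 h2
      simp [List.getElem?_append_left h2, List.getElem?_eq_getElem h2]

/-! ### The number of blocks -/

theorem le_numBlocks_mul {k w : ℕ} (hw : 1 ≤ w) : k ≤ numBlocks k w * w := by
  have h := Nat.lt_mul_div_succ (k + w - 1) hw
  rw [numBlocks]
  have : w * ((k + w - 1) / w + 1) = (k + w - 1) / w * w + w := by ring
  omega

theorem numBlocks_mul_lt {k w : ℕ} (hw : 1 ≤ w) : numBlocks k w * w < k + w := by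
  have h := Nat.div_mul_le_self (k + w - 1) w
  rw [numBlocks]
  omega

theorem div_lt_numBlocks {k w i : ℕ} (hw : 1 ≤ w) (hi : i < k) : i / w < numBlocks k w := by
  rw [Nat.div_lt_iff_lt_mul hw]
  exact hi.trans_le (le_numBlocks_mul hw)

theorem numBlocks_pos {k w : ℕ} (hw : 1 ≤ w) (hk : 1 ≤ k) : 0 < numBlocks k w :=
  (Nat.zero_le _).trans_lt (div_lt_numBlocks hw (Nat.lt_of_lt_of_le Nat.zero_lt_one hk))

/-! ### MDS codes -/

/-- A nonzero such `U` would give a codeword of weight at most `C.card + (c - R.card) ≤ c`. -/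
theorem IsSystematicMDS.eq_zero {F : Type} [CommRing F] {K c : ℕ} {P : Matrix (Fin c) (Fin K) F}
    (hP : IsSystematicMDS P) {U : Fin K → F} {C : Finset (Fin K)} {R : Finset (Fin c)}
    (hU : ∀ i ∉ C, U i = 0) (hPU : ∀ r ∈ R, P.mulVec U r = 0) (hc : C.card ≤ R.card) : U = 0 := by
  classical
  by_contra hne
  have h := hP U 0 hne
  rw [Matrix.mulVec_zero] at h
  have h1 : hammingDist U 0 ≤ C.card := by
    unfold hammingDist
    apply Finset.card_le_card
    intro i hi
    by_contra hiC
    simp [hU i hiC] at hi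
  have h2 : hammingDist (P.mulVec U) 0 ≤ Rᶜ.card := by
    unfold hammingDist
    apply Finset.card_le_card
    intro r hr
    rw [Finset.mem_compl]
    intro hrR
    simp [hPU r hrR] at hr
  rw [Finset.card_compl, Fintype.card_fin] at h2
  have h3 : R.card ≤ c := by simpa using Finset.card_le_univ R
  have h4 : c + 1 ≤ C.card + (c - R.card) := by
    refine le_trans ?_ (add_le_add h1 h2)
    convert h
  omega

/-- A kernel vector of the minor, placed in the columns `σ`, has at most `e` nonzero symbols and `e`
vanishing parities, so `IsSystematicMDS.eq_zero` applies. Hence the first `e` parities always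
suffice for `e` erasures. -/
theorem IsSystematicMDS.det_ne_zero {F : Type} [Field F] {K c e : ℕ}
    {P : Matrix (Fin c) (Fin K) F} (hP : IsSystematicMDS P) (he : e ≤ c) {σ : Fin e → Fin K}
    (hσ : Function.Injective σ) :
    (Matrix.of fun i j : Fin e => P (Fin.castLE he i) (σ j)).det ≠ 0 := by
  classical
  intro hdet
  obtain ⟨x, hx0, hx⟩ := Matrix.exists_mulVec_eq_zero_iff.2 hdet
  apply hx0
  have hU := hP.eq_zero (U := fun i => ∑ j, if σ j = i then x j else 0)
    (C := Finset.univ.image σ) (R := Finset.univ.map (Fin.castLEEmb he)) (by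
      intro i hi
      apply Finset.sum_eq_zero
      intro j _
      rw [if_neg]
      rintro rfl
      exact hi (Finset.mem_image_of_mem _ (Finset.mem_univ _))) (by
      intro r hr
      obtain ⟨i, -, rfl⟩ := Finset.mem_map.1 hr
      refine Eq.trans ?_ (congrFun hx i)
      simp only [Matrix.mulVec, dotProduct, Finset.mul_sum, mul_ite, mul_zero, Matrix.of_apply]
      rw [Finset.sum_comm]
      simp) (by
      rw [Finset.card_map]
      exact Finset.card_image_le)
  funext j
  have := congrFun hU (σ j)
  simpa [hσ.eq_iff] using this

namespace Code

variable {k w c : ℕ} (C : Code k w c)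

/-- The matrix of the parity coefficients. -/
noncomputable def parityMatrix :
    Matrix (Fin c) (Fin (numBlocks k w)) (AdjoinRoot (modulusPoly C.modulus)) :=
  Matrix.of fun r i => symbol C.modulus (C.coeff r i)

/-- The parity symbols of a string, as the encoder computes them. -/
def parities (v : Bits) : List Bits :=
  (paritiesT C.modulusBits C.coeffBits (blocksT w (numBlocks k w) v).val).val

theorem modulusBits_length : C.modulusBits.length = w := by simp [modulusBits]

theorem coeffBits_length : C.coeffBits.length = c := by simp [coeffBits]

theorem mem_coeffBits {g : List Bits} (hg : g ∈ C.coeffBits) :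
    g.length = numBlocks k w ∧ ∀ b ∈ g, b.length = w := by
  simp only [coeffBits, List.mem_ofFn] at hg
  obtain ⟨r, rfl⟩ := hg
  refine ⟨by simp, ?_⟩
  simp only [List.mem_ofFn]
  rintro b ⟨i, rfl⟩
  simp

theorem length_of_mem_blocksT {K : ℕ} {v b : Bits} (hb : b ∈ (blocksT w K v).val) :
    b.length = w := by
  rw [blocksT_val, List.mem_ofFn] at hb
  obtain ⟨i, rfl⟩ := hb
  simp

theorem parities_length (v : Bits) : (C.parities v).length = c := by
  simp [parities, paritiesT_val, coeffBits_length]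

theorem length_of_mem_parities {v b : Bits} (hb : b ∈ C.parities v) : b.length = w := by
  rw [parities, paritiesT_val, List.mem_map] at hb
  obtain ⟨g, -, rfl⟩ := hb
  rw [dotT_length_eq]
  · exact C.modulusBits_length
  · intro u hu
    rw [length_of_mem_blocksT hu, modulusBits_length]

theorem sym_dotT_ofFn (r : Fin c) (U : Fin (numBlocks k w) → Bits) (hU : ∀ i, (U i).length = w) :
    sym C.modulus (dotT C.modulusBits (List.ofFn fun i => List.ofFn (C.coeff r i))
      (List.ofFn U)).val = ∑ i, C.parityMatrix r i * sym C.modulus (U i) := by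
  rw [modulusBits, sym_dotT, zipWith_ofFn, List.sum_ofFn]
  · refine Finset.sum_congr rfl fun i _ => ?_
    rw [parityMatrix, Matrix.of_apply, symbol_eq_sym]
  · simp only [List.mem_ofFn]
    rintro u ⟨i, rfl⟩
    exact hU i

theorem messageSymbol_eq (u : Fin k → Bool) (i : Fin (numBlocks k w)) :
    C.messageSymbol u i =
      sym C.modulus (List.ofFn fun j : Fin w => (List.ofFn u).getD (i * w + j) false) := by
  rw [messageSymbol, symbol_eq_sym]
  congr 2
  funext j
  rw [List.getD_eq_getElem?_getD, List.getElem?_ofFn]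
  split <;> rfl

theorem sym_parities (u : Fin k → Bool) (r : Fin c) :
    sym C.modulus ((C.parities (List.ofFn u)).getD r []) =
      C.parityMatrix.mulVec (C.messageSymbol u) r := by
  have h : (C.parities (List.ofFn u)).getD r [] =
      (dotT C.modulusBits (List.ofFn fun i => List.ofFn (C.coeff r i))
        (blocksT w (numBlocks k w) (List.ofFn u)).val).val := by
    simp [parities, paritiesT_val, coeffBits, List.getD_eq_getElem?_getD]
  rw [h, blocksT_val, sym_dotT_ofFn _ _ _ (by simp)]
  simp only [Matrix.mulVec, dotProduct, messageSymbol_eq]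

theorem parities_eq_ofFn (v : Bits) :
    C.parities v = List.ofFn fun r : Fin c =>
      List.ofFn fun j : Fin w => ((C.parities v).getD r []).getD j false := by
  apply List.ext_getElem
  · simp [parities_length]
  · intro r h1 h2
    have h3 := C.length_of_mem_parities (List.getElem_mem h1)
    apply List.ext_getElem
    · simp [h3]
    · intro j h4 h5
      simp [h1, h4]

/-! ### The encoder -/

theorem encode_val (z : ℕ) (u : Bits) :
    (C.encode z u).val =
      u ++ ((C.parities u).flatten.map (List.replicate (z * w + 1))).flatten := by
  simp [encode, parities]

theorem length_flatten_parities (v : Bits) : (C.parities v).flatten.length = c * w := by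
  rw [length_flatten_of_forall fun b hb => C.length_of_mem_parities hb, parities_length]

theorem encode_length (z : ℕ) (u : Fin k → Bool) :
    (C.encode z (List.ofFn u)).val.length = k + c * (z * w + 1) * w := by
  rw [encode_val, List.length_append, List.length_ofFn,
    length_flatten_of_forall (w := z * w + 1) (by
      intro b hb
      obtain ⟨a, -, rfl⟩ := List.mem_map.1 hb
      simp), List.length_map,
    length_flatten_parities]
  ring

theorem isCodeword_encode (z : ℕ) (u : Fin k → Bool) :
    C.IsCodeword z u (C.encode z (List.ofFn u)).val := by
  refine ⟨fun r j => ((C.parities (List.ofFn u)).getD r []).getD j false, ?_, ?_⟩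
  · intro r
    rw [symbol_eq_sym]
    have h := C.sym_parities u r
    have h1 : (C.parities (List.ofFn u)).getD r [] = List.ofFn fun j : Fin w =>
        ((C.parities (List.ofFn u)).getD r []).getD j false := by
      have h2 := congrArg (fun l : List Bits => l.getD r []) (C.parities_eq_ofFn (List.ofFn u))
      refine h2.trans ?_
      rw [List.getD_eq_getElem?_getD, List.getElem?_ofFn]
      simp
    rw [← h1, h]
    rfl
  · rw [encode_val]
    congr 1
    conv_lhs => rw [C.parities_eq_ofFn (List.ofFn u)]
    rw [List.map_flatten, List.flatten_flatten, List.map_ofFn, List.map_ofFn]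
    congr 1
    congr 1
    funext r
    simp only [Function.comp, List.map_ofFn]
    rfl

/-! ### Recovery of the parities -/

theorem received_length (z : ℕ) (D : Finset ℕ) (hD : D ⊆ Finset.range (k + c * (z * w + 1) * w))
    (u : Fin k → Bool) :
    (C.received z D u).length + D.card = k + c * (z * w + 1) * w := by
  have h1 := count_notMem_add_card D (k + c * (z * w + 1) * w)
  rw [received, length_deleteAt, encode_length]
  rwa [Finset.inter_eq_left.2 hD] at h1

theorem getElem?_received (z : ℕ) (D : Finset ℕ) (u : Fin k → Bool) (j : ℕ) :
    (C.received z D u)[j]? = (C.encode z (List.ofFn u)).val[Nat.nth (· ∉ D) j]? :=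
  getElem?_deleteAt _ _ _

theorem getElem?_encode_parity (z : ℕ) (u : Fin k → Bool) {i r : ℕ} (hr : r < z * w + 1) :
    (C.encode z (List.ofFn u)).val[k + ((z * w + 1) * i + r)]? =
      (C.parities (List.ofFn u)).flatten[i]? := by
  rw [encode_val, List.getElem?_append_right (by simp), List.length_ofFn, Nat.add_sub_cancel_left,
    getElem?_flatten_replicate _ _ _ _ hr]

/-- The repetition code protects the parities. -/
theorem recovered_parities (z : ℕ) {D : Finset ℕ}
    (hD : D ⊆ Finset.range (k + c * (z * w + 1) * w)) (hDc : D.card ≤ z * w) (u : Fin k → Bool) :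
    (blocksT w c (unrepeatT (z * w + 1) (c * w) (dropT k (C.received z D u)).val).val).val =
      C.parities (List.ofFn u) := by
  have hlen := C.received_length z D hD u
  have hmul : c * (z * w + 1) * w = (z * w + 1) * (c * w) := by ring
  have h : (unrepeatT (z * w + 1) (c * w) (dropT k (C.received z D u)).val).val =
      (C.parities (List.ofFn u)).flatten := by
    rw [dropT_val, unrepeatT_val _ _ _ (by rw [List.length_drop]; omega)]
    apply List.ext_getElem
    · rw [length_flatten_parities, List.length_ofFn]
    · intro i h1 h2
      rw [List.getElem_ofFn]
      simp only
      -- Deletions move the position that is read forward by some `r ≤ z * w`, which does not leave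
      -- the `z * w + 1` copies of bit `i`.
      have h3 := le_nth_notMem D (k + (z * w + 1) * i)
      have h4 := nth_notMem_le D (k + (z * w + 1) * i)
      obtain ⟨r, hr⟩ := Nat.exists_eq_add_of_le h3
      have h5 := C.getElem?_encode_parity z u (i := i) (r := r) (by omega)
      rw [← add_assoc, ← hr, ← getElem?_received, List.getElem?_eq_getElem h2] at h5
      rw [List.getD_eq_getElem?_getD, List.getElem?_drop, h5]
      rfl
  rw [h]
  have := blocksT_flatten (P := C.parities (List.ofFn u)) fun b hb => C.length_of_mem_parities hb
  rwa [parities_length] at this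

end Code

end GC

/-! ### Which strings the guesses yield, and the resulting verdict. -/

namespace GC

/-! ### Verdicts -/

theorem updateT_mem_of_some {u : Bits} (s : Verdict) :
    (updateT s (some u)).val = Verdict.unique u ∨
      (updateT s (some u)).val = Verdict.conflict := by
  cases s with
  | nothing => simp [updateT]
  | unique v =>
    simp only [updateT, Timed.val_bind, eqT_val]
    by_cases h : v = u <;> simp [h]
  | conflict => simp [updateT]

/-- Invariant once `u` has been found: later cases can only turn the verdict into a conflict. -/
theorem updateT_mem {u : Bits} {s : Verdict} (hs : s = Verdict.unique u ∨ s = Verdict.conflict)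
    (o : Option Bits) :
    (updateT s o).val = Verdict.unique u ∨ (updateT s o).val = Verdict.conflict := by
  cases o with
  | none => rcases hs with rfl | rfl <;> simp [updateT]
  | some v =>
    rcases hs with rfl | rfl
    · simp only [updateT, Timed.val_bind, eqT_val]
      by_cases h : u = v <;> simp [h]
    · simp [updateT]

/-- Invariant as long as all possible cases yield `u`: no conflict arises. -/
theorem updateT_agree {u : Bits} {s : Verdict} (hs : s = Verdict.nothing ∨ s = Verdict.unique u)
    {o : Option Bits} (ho : o = none ∨ o = some u) :
    (updateT s o).val = Verdict.nothing ∨ (updateT s o).val = Verdict.unique u := by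
  rcases ho with rfl | rfl
  · rcases hs with rfl | rfl <;> simp [updateT]
  · rcases hs with rfl | rfl <;> simp [updateT]

theorem casesT_mem {f : List ℕ → Timed (Option Bits)} {u : Bits} {dss : List (List ℕ)}
    {s : Verdict} (h : (s = Verdict.unique u ∨ s = Verdict.conflict) ∨
      ∃ ds ∈ dss, (f ds).val = some u) :
    (casesT f dss s).val = Verdict.unique u ∨ (casesT f dss s).val = Verdict.conflict := by
  induction dss generalizing s with
  | nil => simpa [casesT] using h
  | cons ds dss ih =>
    simp only [casesT, Timed.val_bind]
    apply ih
    rcases h with h | ⟨ds', h1, h2⟩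
    · exact Or.inl (updateT_mem h _)
    · rcases List.mem_cons.1 h1 with rfl | h1
      · left; rw [h2]; exact updateT_mem_of_some s
      · exact Or.inr ⟨ds', h1, h2⟩

theorem casesT_agree {f : List ℕ → Timed (Option Bits)} {u : Bits} {dss : List (List ℕ)}
    {s : Verdict} (hs : s = Verdict.nothing ∨ s = Verdict.unique u)
    (h : ∀ ds ∈ dss, (f ds).val = none ∨ (f ds).val = some u) :
    (casesT f dss s).val = Verdict.nothing ∨ (casesT f dss s).val = Verdict.unique u := by
  induction dss generalizing s with
  | nil => simpa [casesT] using hs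
  | cons ds dss ih =>
    simp only [casesT, Timed.val_bind]
    exact ih (updateT_agree hs (h ds (by simp))) fun ds hds => h ds (by simp [hds])

namespace Code

variable {k w c : ℕ} (C : Code k w c)

/-- The affected blocks in a guess. -/
def guessFlags (_C : Code k w c) (bs : List ℕ) : List Bool := (flagsT bs (numBlocks k w) 0).val

/-- The columns of the coefficients at the affected blocks, in as many rows. -/
def erasureMatrix (bs : List ℕ) : List (List Bits) :=
  (C.coeffBits.take ((C.guessFlags bs).count true)).map (selected (C.guessFlags bs))

/-- The inverse determinant with which the decoder solves for the erased symbols. -/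
def erasureDetInv (bs : List ℕ) : Bits :=
  (invT w C.modulusBits
    (detT C.modulusBits ((C.guessFlags bs).count true) (C.erasureMatrix bs)).val).val

/-- The result of a single case. -/
def guessResult (p : List Bits) (y : Bits) (bs ds : List ℕ) : Option Bits :=
  (C.caseT p y bs (C.guessFlags bs) ((C.guessFlags bs).count true)
    (C.coeffBits.take ((C.guessFlags bs).count true)) (C.erasureMatrix bs)
    (C.erasureDetInv bs) ds).val

theorem positionT_val (p : List Bits) (y : Bits) (dss : List (List ℕ)) (bs : List ℕ)
    (s : Verdict) :
    (C.positionT p y dss bs s).val =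
      (casesT (C.caseT p y bs (C.guessFlags bs) ((C.guessFlags bs).count true)
        (C.coeffBits.take ((C.guessFlags bs).count true)) (C.erasureMatrix bs)
        (C.erasureDetInv bs)) dss s).val := by
  simp only [positionT, Timed.val_bind, countT_val, splitT_val, selectColsT_val, guessFlags,
    erasureMatrix, erasureDetInv]

theorem positionsT_mem {p : List Bits} {y u : Bits} {dss bss : List (List ℕ)} {s : Verdict}
    (h : (s = Verdict.unique u ∨ s = Verdict.conflict) ∨
      ∃ bs ∈ bss, ∃ ds ∈ dss, C.guessResult p y bs ds = some u) :
    (C.positionsT p y dss bss s).val = Verdict.unique u ∨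
      (C.positionsT p y dss bss s).val = Verdict.conflict := by
  induction bss generalizing s with
  | nil => simpa [positionsT] using h
  | cons bs bss ih =>
    simp only [positionsT, Timed.val_bind]
    apply ih
    rcases h with h | ⟨bs', h1, ds, h2, h3⟩
    · left; rw [positionT_val]; exact casesT_mem (Or.inl h)
    · rcases List.mem_cons.1 h1 with rfl | h1
      · left; rw [positionT_val]; exact casesT_mem (Or.inr ⟨ds, h2, h3⟩)
      · exact Or.inr ⟨bs', h1, ds, h2, h3⟩

theorem positionsT_agree {p : List Bits} {y u : Bits} {dss bss : List (List ℕ)} {s : Verdict}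
    (hs : s = Verdict.nothing ∨ s = Verdict.unique u)
    (h : ∀ bs ∈ bss, ∀ ds ∈ dss, C.guessResult p y bs ds = none ∨
      C.guessResult p y bs ds = some u) :
    (C.positionsT p y dss bss s).val = Verdict.nothing ∨
      (C.positionsT p y dss bss s).val = Verdict.unique u := by
  induction bss generalizing s with
  | nil => simpa [positionsT] using hs
  | cons bs bss ih =>
    simp only [positionsT, Timed.val_bind]
    refine ih ?_ fun bs hbs => h bs (by simp [hbs])
    rw [positionT_val]
    exact casesT_agree hs (h bs (by simp))

/-! ### A single case -/

theorem guessFlags_eq (bs : List ℕ) :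
    C.guessFlags bs = List.ofFn fun i : Fin (numBlocks k w) =>
      bs.any fun a => ((i : ℕ) == a) || ((i : ℕ) == a + 1) := by
  simp [guessFlags, flagsT_val, affectedT_val]

theorem guessFlags_length (bs : List ℕ) : (C.guessFlags bs).length = numBlocks k w := by
  simp [guessFlags_eq]

theorem getElem?_guessFlags {bs : List ℕ} {b : ℕ} (hb : b < numBlocks k w) :
    (C.guessFlags bs)[b]? = some false ↔ ∀ a ∈ bs, b ≠ a ∧ b ≠ a + 1 := by
  simp [guessFlags_eq, hb]

/-- The guessed numbers of deletions for all the blocks. -/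
def guessDeletions (_C : Code k w c) (bs ds : List ℕ) : List ℕ :=
  (deletionsT bs ds (numBlocks k w) 0).val

theorem guessDeletions_length (bs ds : List ℕ) :
    (C.guessDeletions bs ds).length = numBlocks k w := by
  simp [guessDeletions, deletionsT_val]

theorem count_guessFlags_le (bs : List ℕ) :
    (C.guessFlags bs).count true ≤ 2 * bs.length := by
  classical
  rw [guessFlags_eq, count_ofFn]
  have h : ((Finset.univ.filter fun i : Fin (numBlocks k w) =>
      (bs.any fun a => ((i : ℕ) == a) || ((i : ℕ) == a + 1)) = true).map Fin.valEmbedding) ⊆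
      bs.toFinset ∪ (bs.map (· + 1)).toFinset := by
    intro b hb
    obtain ⟨i, hi, rfl⟩ := Finset.mem_map.1 hb
    simp only [List.any_eq_true, Bool.or_eq_true, beq_iff_eq, Finset.mem_filter,
      Finset.mem_univ, true_and] at hi
    obtain ⟨a, ha, h | h⟩ := hi
    · simp [h, ha]
    · simp [h, ha]
  have h1 := Finset.card_le_card h
  rw [Finset.card_map] at h1
  have h2 := Finset.card_union_le bs.toFinset (bs.map (· + 1)).toFinset
  have h3 := List.toFinset_card_le bs
  have h4 := List.toFinset_card_le (bs.map (· + 1))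
  rw [List.length_map] at h4
  omega

theorem consistentT_val (p : List Bits) (v : Bits) :
    (C.consistentT p v).val = decide (p.flatten = (C.parities v).flatten) := by
  simp only [consistentT, Timed.val_bind, flattenT_val, eqT_val]
  rfl

/-- The properties of the decoded string of a possible case. -/
theorem guessResult_eq_some (hw : 1 ≤ w) {p : List Bits} {y v : Bits} {bs ds : List ℕ}
    (hy : k ≤ y.length) (h : C.guessResult p y bs ds = some v) :
    IsShift w (fun b => (C.guessFlags bs)[b]? = some false)
      (guessed (C.guessFlags bs) (C.guessDeletions bs ds)) ∧
    v.length = k ∧ p.flatten = (C.parities v).flatten ∧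
    ∀ i < k, (C.guessFlags bs)[i / w]? = some false →
      v[i]? = y[i - guessed (C.guessFlags bs) (C.guessDeletions bs ds) (i / w)]? := by
  have hlen : (C.guessFlags bs).length = (C.guessDeletions bs ds).length := by
    rw [guessFlags_length, guessDeletions_length]
  simp only [guessResult, caseT, Timed.val_bind] at h
  split at h
  · simp at h
  · next ps hps =>
    simp only [Timed.val_bind] at h
    split at h
    · simp at h
    · next v' hv' =>
      simp only [Timed.val_bind, splitT_val, consistentT_val] at h
      split at h
      · next hcons =>
        simp only [Timed.val_pure, Option.some.injEq] at h
        subst h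
        obtain ⟨h1, h2⟩ := getElem?_of_fillT_chunkT hlen hps (by omega)
          (by rw [guessFlags_length]; exact le_numBlocks_mul hw)
          (fun b hb => (length_of_mem_cramerT hb).trans C.modulusBits_length)
          (by rw [cramerT_length]; omega) hv'
        refine ⟨⟨guessed_mono _ _, fun i j hij hi hj => guessed_gap_of_chunkT hlen hps hij hi hj,
          fun i hi => ?_⟩, ?_, ?_, ?_⟩
        · have := guessed_le_of_chunkT hlen hps hi
          omega
        · rw [List.length_take]; omega
        · simpa using hcons
        · intro i hi hfl
          have hdm : i / w * w + i % w = i := by rw [mul_comm]; exact Nat.div_add_mod i w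
          have := h2 (i / w) (i % w) hfl (Nat.mod_lt i hw) (by omega)
          rw [hdm, zero_mul, zero_add, zero_add] at this
          rw [List.getElem?_take, if_pos hi, this]
      · simp at h

/-- The erased symbols are the solution of the linear system that the decoder solves. -/
theorem cramerT_syndromes (hw : 1 ≤ w) (u : Fin k → Bool) {bs : List ℕ}
    (he : (C.guessFlags bs).count true ≤ c) :
    (cramerT C.modulusBits ((C.guessFlags bs).count true) (C.erasureMatrix bs)
      (C.erasureDetInv bs)
      (syndromesT C.modulusBits (C.coeffBits.take ((C.guessFlags bs).count true))
        (C.parities (List.ofFn u))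
        (List.zipWith (fun a b => if a then List.replicate w false else b) (C.guessFlags bs)
          (blocksT w (numBlocks k w) (List.ofFn u)).val)).val
      ((C.guessFlags bs).count true) 0).val =
    selected (C.guessFlags bs) (blocksT w (numBlocks k w) (List.ofFn u)).val := by
  have : Fact (Irreducible (modulusPoly C.modulus)) := ⟨C.irreducible_modulus⟩
  set fl := C.guessFlags bs with hfl
  set e := fl.count true with hedef
  set K := numBlocks k w with hK
  obtain ⟨a, ha⟩ : ∃ a : Fin K → Bool, fl = List.ofFn a := ⟨_, C.guessFlags_eq bs⟩
  set U : Fin K → Bits := fun i =>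
    List.ofFn fun j : Fin w => (List.ofFn u).getD (i * w + j) false with hU
  have hblocks : (blocksT w K (List.ofFn u)).val = List.ofFn U := blocksT_val _ _ _
  -- The affected blocks in increasing order; through `σ` they number the unknowns of the linear
  -- system.
  set idx : List (Fin K) := selected fl (List.finRange K) with hidx
  have hidxlen : idx.length = e := by
    rw [hidx, length_selected (by rw [ha]; simp)]
  have hsel {α : Type} (f : Fin K → α) : selected fl (List.ofFn f) = idx.map f := by
    rw [List.ofFn_eq_map, selected_map]
  let σ : Fin e → Fin K := fun j => idx[(j : ℕ)]'(by rw [hidxlen]; exact j.2)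
  have hσ : Function.Injective σ := by
    intro i j hij
    have hnd : idx.Nodup := (List.nodup_finRange K).sublist (selected_sublist _ _)
    exact Fin.ext ((hnd.getElem_inj_iff).1 hij)
  have hsum {R : Type} [AddCommMonoid R] (f : Fin K → R) :
      ∑ j, f (σ j) = ∑ i, if a i then f i else 0 := by
    rw [← sum_selected_ofFn, ← ha, hsel, ← List.sum_ofFn]
    congr 1
    apply List.ext_getElem
    · simp [hidxlen]
    · intro i h1 h2
      simp [σ]
  have hrows : ∀ i : Fin e, (C.erasureMatrix bs).getD i [] =
      idx.map fun l => List.ofFn (C.coeff (Fin.castLE he i) l) := by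
    intro i
    have hi : (i : ℕ) < c := i.2.trans_le he
    rw [erasureMatrix, ← hfl, ← hedef, List.getD_eq_getElem?_getD, List.getElem?_map,
      List.getElem?_take, if_pos i.2, coeffBits, List.getElem?_ofFn, dif_pos hi]
    simp only [Option.map_some, Option.getD_some]
    rw [hsel]
    rfl
  have hmat : ∀ i j, toMatrix C.modulus e (C.erasureMatrix bs) i j =
      C.parityMatrix (Fin.castLE he i) (σ j) := by
    intro i j
    have hj : (j : ℕ) < idx.length := by rw [hidxlen]; exact j.2
    simp only [toMatrix, Matrix.of_apply]
    rw [hrows, List.getD_eq_getElem?_getD, List.getElem?_map, List.getElem?_eq_getElem hj,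
      parityMatrix, Matrix.of_apply, symbol_eq_sym]
    rfl
  have hM : (C.erasureMatrix bs).length = e := by
    rw [erasureMatrix, List.length_map, List.length_take, coeffBits_length]
    exact min_eq_left he
  have hr : ∀ r ∈ C.erasureMatrix bs, r.length = e := by
    intro r hr
    obtain ⟨g, hg, rfl⟩ := List.mem_map.1 hr
    rw [length_selected]
    rw [guessFlags_length, (C.mem_coeffBits (List.mem_of_mem_take hg)).1]
  set Z : Fin K → Bits := fun i => if a i then List.replicate w false else U i with hZ
  have hzip : List.zipWith (fun a b => if a then List.replicate w false else b) fl
      (List.ofFn U) = List.ofFn Z := by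
    rw [ha, zipWith_ofFn]
  rw [hblocks, hzip, hsel]
  have hs : (syndromesT C.modulusBits (C.coeffBits.take e) (C.parities (List.ofFn u))
      (List.ofFn Z)).val.length = e := by
    have he' : e ≤ c := he
    rw [syndromesT_val, List.length_zipWith, List.length_take, coeffBits_length, parities_length,
      min_eq_left he', min_eq_left he']
  refine cramerT_eq C.modulus hw hM hr hs (by simpa using hidxlen) ?_ ?_ ?_
  · intro b hb
    obtain ⟨i, -, rfl⟩ := List.mem_map.1 hb
    simp [hU]
  · have h1 := C.mds.det_ne_zero he hσ
    have h2 : toMatrix C.modulus e (C.erasureMatrix bs) =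
        Matrix.of fun i j : Fin e => C.parityMatrix (Fin.castLE he i) (σ j) := by
      ext i j
      exact hmat i j
    rw [h2]
    exact h1
  · intro i
    have hi : (i : ℕ) < c := i.2.trans_le he
    have hZw : ∀ l, (Z l).length = w := by
      intro l
      simp only [hZ, hU]
      split <;> simp
    have hp : (C.parities (List.ofFn u)).getD i [] =
        (C.parities (List.ofFn u))[(i : ℕ)]'(by rw [parities_length]; exact hi) := by
      rw [List.getD_eq_getElem]
    have hsi : (syndromesT C.modulusBits (C.coeffBits.take e) (C.parities (List.ofFn u))
        (List.ofFn Z)).val.getD i [] = (addT ((C.parities (List.ofFn u)).getD i [])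
          (dotT C.modulusBits (List.ofFn fun l => List.ofFn (C.coeff (Fin.castLE he i) l))
            (List.ofFn Z)).val).val := by
      have h1 : (i : ℕ) < (C.parities (List.ofFn u)).length := by rw [parities_length]; exact hi
      rw [syndromesT_val, List.getD_eq_getElem?_getD, List.getElem?_zipWith, List.getElem?_take,
        if_pos i.2, List.getElem?_eq_getElem h1, hp, coeffBits, List.getElem?_ofFn, dif_pos hi]
      rfl
    rw [hsi, sym_addT, C.sym_dotT_ofFn _ _ hZw]
    · have h1 := C.sym_parities u ⟨i, hi⟩
      simp only at h1
      rw [h1]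
      have h2 : ∀ j : Fin e, toMatrix C.modulus e (C.erasureMatrix bs) i j *
          sym C.modulus ((idx.map U).getD j []) =
          (fun l => C.parityMatrix (Fin.castLE he i) l * sym C.modulus (U l)) (σ j) := by
        intro j
        have hj : (j : ℕ) < idx.length := by rw [hidxlen]; exact j.2
        rw [hmat, List.getD_eq_getElem?_getD, List.getElem?_map, List.getElem?_eq_getElem hj]
        rfl
      rw [Finset.sum_congr rfl fun j _ => h2 j,
        hsum fun l => C.parityMatrix (Fin.castLE he i) l * sym C.modulus (U l),
        Matrix.mulVec, dotProduct, ← Finset.sum_add_distrib]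
      refine Finset.sum_congr rfl fun l _ => ?_
      rw [messageSymbol_eq]
      change _ = C.parityMatrix (Fin.castLE he i) l * sym C.modulus (U l) + _
      -- The syndrome is the parity plus the contribution of the known symbols. On an affected block
      -- the latter is zero; on an intact block it cancels the term of the parity in characteristic
      -- two.
      simp only [hZ]
      split
      · simp
      · rw [sym_add_self]
    · rw [hp, C.length_of_mem_parities (List.getElem_mem _), dotT_length_eq, modulusBits_length]
      simp only [List.mem_ofFn]
      rintro b ⟨l, rfl⟩
      rw [hZw, modulusBits_length]

/-- A case in which the affected blocks and the numbers of deletions are right yields the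
message. -/
theorem guessResult_of_correct (hw : 1 ≤ w) (z : ℕ) (D : Finset ℕ) (u : Fin k → Bool)
    {bs ds : List ℕ} (hbs : 2 * bs.length ≤ c)
    (hcount : ∀ j ≤ numBlocks k w, j = numBlocks k w ∨ (C.guessFlags bs)[j]? = some false →
      guessed (C.guessFlags bs) (C.guessDeletions bs ds) j =
        (D ∩ Finset.range (min (j * w) k)).card)
    (hknown : ∀ j, (C.guessFlags bs)[j]? = some false → ∀ i ∈ D, i < k → i / w ≠ j) :
    C.guessResult (C.parities (List.ofFn u)) (C.received z D u) bs ds = some (List.ofFn u) := by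
  have hlen : (C.guessFlags bs).length = (C.guessDeletions bs ds).length := by
    rw [guessFlags_length, guessDeletions_length]
  have hy : C.received z D u = [] ++ deleteFrom D 0 (List.ofFn u) ++
      deleteFrom D (0 + (List.ofFn u).length)
        ((C.parities (List.ofFn u)).flatten.map (List.replicate (z * w + 1))).flatten := by
    rw [received, deleteAt_eq, encode_val, deleteFrom_append, List.nil_append]
  obtain ⟨ps, h1, h2, v, h3, h4⟩ := chunkT_of_correct (w := w) C.modulusBits C.modulusBits_length D
    (fl := C.guessFlags bs) (ds := C.guessDeletions bs ds) (u := List.ofFn u) (o := 0) (g := 0)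
    (L := 0) (D := 0) (acc := [])
    (tl := deleteFrom D (0 + (List.ofFn u).length)
        ((C.parities (List.ofFn u)).flatten.map (List.replicate (z * w + 1))).flatten)
    (X := []) hlen
    (by rw [guessFlags_length, List.length_ofFn]; exact le_numBlocks_mul hw) rfl (by simp)
    (by
      intro j hj hj2
      rw [guessFlags_length] at hj hj2
      have h1 := length_deleteFrom D 0 ((List.ofFn u).take (j * w))
      rw [zero_add, ← Finset.range_eq_Ico] at h1
      have h2 := hcount j hj hj2
      have h3 : ((List.ofFn u).take (j * w)).length = min (j * w) k := by simp
      rw [h3] at h1 ⊢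
      simp only [List.length_nil]
      omega)
    (by
      intro j hj
      apply deleteFrom_eq_self
      intro i hi
      by_contra hcon
      rw [not_or, not_lt, not_le, List.length_take, List.length_drop, List.length_ofFn] at hcon
      refine hknown j hj i hi (by omega) ?_
      rw [Nat.div_eq_iff hw]
      omega)
  rw [← hy, List.length_ofFn] at h1
  have h5 := C.cramerT_syndromes hw u ((C.count_guessFlags_le bs).trans hbs)
  rw [guessFlags_length] at h2 h3
  simp only [List.replicate_zero, List.nil_append, List.flatten_nil] at h2 h3
  simp only [guessDeletions] at h1
  simp only [guessResult, caseT, Timed.val_bind, h1, h2, h5, h3, splitT_val, consistentT_val]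
  have h6 : v.take k = List.ofFn u := by
    rw [List.prefix_iff_eq_take, List.length_ofFn] at h4
    exact h4.symm
  rw [h6]
  simp

/-- For localized deletions, some guess is correct. -/
theorem exists_guessResult_eq (hw : 1 ≤ w) (hwk : w ≤ k) {z : ℕ} (hz : 2 * z ≤ c) {D : Finset ℕ}
    {start size : Fin z → ℕ} (hsize : ∀ i, size i ≤ w)
    (hD : ∀ j ∈ D, ∃ i, j ∈ Finset.Ico (start i) (start i + size i)) (u : Fin k → Bool) :
    ∃ bs ∈ (tuplesT (numBlocks k w) z).val, ∃ ds ∈ (tuplesT (w + 1) z).val,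
      C.guessResult (C.parities (List.ofFn u)) (C.received z D u) bs ds =
        some (List.ofFn u) := by
  classical
  have hKpos : 0 < numBlocks k w := numBlocks_pos hw (hw.trans hwk)
  -- Windows may overlap; choosing one window for each position makes every deletion count once.
  let win : ℕ → Option (Fin z) := fun j =>
    if h : ∃ i : Fin z, j ∈ Finset.Ico (start i) (start i + size i) then some h.choose else none
  have hwin : ∀ j i, win j = some i → start i ≤ j ∧ j < start i + w := by
    intro j i hji
    simp only [win] at hji
    split at hji
    · next h =>
      have h1 := h.choose_spec
      rw [Option.some.injEq] at hji
      rw [hji, Finset.mem_Ico] at h1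
      have := hsize i
      omega
    · simp at hji
  have hwin' : ∀ j ∈ D, ∃ i, win j = some i := by
    intro j hj
    simp only [win, dif_pos (hD j hj)]
    exact ⟨_, rfl⟩
  let W : Fin z → Finset ℕ := fun i => D.filter fun j => j < k ∧ win j = some i
  have hWc : ∀ i, (W i).card ≤ w := by
    intro i
    have : W i ⊆ Finset.Ico (start i) (start i + w) := by
      intro j hj
      have := hwin j i (Finset.mem_filter.1 hj).2.2
      rw [Finset.mem_Ico]
      exact this
    simpa using Finset.card_le_card this
  -- A window that starts beyond the message contains no message bit. Block `0` is then an arbitrary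
  -- admissible choice, and the guessed number of deletions is zero because `W i` is empty.
  let b : Fin z → ℕ := fun i => if start i < k then start i / w else 0
  have hbK : ∀ i, b i < numBlocks k w := by
    intro i
    simp only [b]
    split
    · next h => exact div_lt_numBlocks hw h
    · exact hKpos
  have hWb : ∀ i, ∀ j ∈ W i, b i * w ≤ j ∧ j < b i * w + w + w := by
    intro i j hj
    obtain ⟨-, h1, h2⟩ := Finset.mem_filter.1 hj
    have h3 := hwin j i h2
    have h4 : b i = start i / w := if_pos (by omega)
    rw [h4]
    have h5 := Nat.div_mul_le_self (start i) w
    have h6 : start i < start i / w * w + w := by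
      have := Nat.lt_mul_div_succ (start i) hw
      rw [mul_comm, Nat.succ_mul] at this
      exact this
    omega
  have hfl : ∀ j < numBlocks k w, ((C.guessFlags (List.ofFn b))[j]? = some false ↔
      ∀ i, j ≠ b i ∧ j ≠ b i + 1) := by
    intro j hj
    rw [C.getElem?_guessFlags hj]
    simp [List.mem_ofFn]
  have hflK : ∀ j, (C.guessFlags (List.ofFn b))[j]? = some false → j < numBlocks k w := by
    intro j hj
    have := (List.getElem?_eq_some_iff.1 hj).1
    rwa [guessFlags_length] at this
  refine ⟨List.ofFn b, mem_tuplesT.2 ⟨by simp, ?_⟩, List.ofFn fun i => (W i).card,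
    mem_tuplesT.2 ⟨by simp, ?_⟩, C.guessResult_of_correct hw z D u (by simpa using hz) ?_ ?_⟩
  · simp only [List.mem_ofFn]
    rintro _ ⟨i, rfl⟩
    exact hbK i
  · simp only [List.mem_ofFn]
    rintro _ ⟨i, rfl⟩
    exact Nat.lt_succ_of_le (hWc i)
  · intro j hj hj2
    have h1 : guessed (C.guessFlags (List.ofFn b))
        (C.guessDeletions (List.ofFn b) (List.ofFn fun i => (W i).card)) j =
        ∑ i, if b i < j then (W i).card else 0 := by
      rw [guessed_eq_sum]
      have h2 : ∀ l ∈ Finset.range j, (if (C.guessFlags (List.ofFn b)).getD l false = true then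
          (C.guessDeletions (List.ofFn b) (List.ofFn fun i => (W i).card)).getD l 0 else 0) =
          ∑ i, if b i = l then (W i).card else 0 := by
        intro l hl
        have hlK : l < numBlocks k w := (Finset.mem_range.1 hl).trans_le hj
        have h3 : (C.guessDeletions (List.ofFn b) (List.ofFn fun i => (W i).card)).getD l 0 =
            ∑ i, if b i = l then (W i).card else 0 := by
          rw [guessDeletions, deletionsT_val, List.getD_eq_getElem?_getD, List.getElem?_ofFn,
            dif_pos hlK, Option.getD_some, deletedT_val]
          simp
        split
        · exact h3
        · next hf =>
          symm
          apply Finset.sum_eq_zero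
          intro i _
          rw [if_neg]
          intro hil
          apply hf
          rw [guessFlags_eq, List.getD_eq_getElem?_getD, List.getElem?_ofFn, dif_pos hlK,
            Option.getD_some, List.any_eq_true]
          exact ⟨b i, List.mem_ofFn.2 ⟨i, rfl⟩, by simp [hil]⟩
      rw [Finset.sum_congr rfl h2, Finset.sum_comm]
      refine Finset.sum_congr rfl fun i _ => ?_
      rw [Finset.sum_ite_eq]
      simp
    have h2 : D ∩ Finset.range (min (j * w) k) =
        Finset.univ.biUnion fun i => (W i).filter fun l => l < j * w := by
      ext l
      simp only [Finset.mem_inter, Finset.mem_range, Finset.mem_biUnion, Finset.mem_univ, true_and,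
        Finset.mem_filter, W, lt_min_iff]
      constructor
      · rintro ⟨hl, h3, h4⟩
        obtain ⟨i, hi⟩ := hwin' l hl
        exact ⟨i, ⟨hl, h4, hi⟩, h3⟩
      · rintro ⟨i, ⟨h3, h4, -⟩, h5⟩
        exact ⟨h3, h5, h4⟩
    rw [h1, h2, Finset.card_biUnion]
    · refine Finset.sum_congr rfl fun i _ => ?_
      split
      · next hij =>
        congr 1
        rw [Finset.filter_true_of_mem]
        intro l hl
        have hb := hWb i l hl
        by_cases hjK : j = numBlocks k w
        · have h5 := (Finset.mem_filter.1 hl).2.1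
          rw [hjK]
          exact h5.trans_le (le_numBlocks_mul hw)
        -- Block `j` is intact and comes after `b i`, hence `j ≥ b i + 2`, and all deletions counted
        -- for window `i` lie before block `j`.
        · have h5 := hj2.resolve_left hjK
          have h6 := ((hfl j (by omega)).1 h5) i
          have h7 : b i + 2 ≤ j := by omega
          have h8 := Nat.mul_le_mul_right w h7
          have h9 : (b i + 2) * w = b i * w + w + w := by ring
          omega
      · next hij =>
        symm
        rw [Finset.card_eq_zero, Finset.filter_eq_empty_iff]
        intro l hl
        have hb := hWb i l hl
        have h8 := Nat.mul_le_mul_right w (not_lt.1 hij)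
        omega
    · intro i _ i' _ hii'
      rw [Function.onFun, Finset.disjoint_left]
      intro l hl hl'
      have h3 := (Finset.mem_filter.1 (Finset.mem_filter.1 hl).1).2.2
      have h4 := (Finset.mem_filter.1 (Finset.mem_filter.1 hl').1).2.2
      rw [h3, Option.some.injEq] at h4
      exact hii' h4
  · intro j hj i hi hik hij
    obtain ⟨a, ha⟩ := hwin' i hi
    have h1 := hWb a i (Finset.mem_filter.2 ⟨hi, hik, ha⟩)
    have h2 := ((hfl j (hflK j hj)).1 hj) a
    rw [Nat.div_eq_iff hw] at hij
    have h3 : b a ≤ j := by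
      by_contra hcon
      have h4 := Nat.mul_le_mul_right w (show j + 1 ≤ b a by omega)
      rw [Nat.succ_mul] at h4
      omega
    have h4 : j < b a + 2 := by
      by_contra hcon
      have h5 := Nat.mul_le_mul_right w (show b a + 2 ≤ j by omega)
      have h6 : (b a + 2) * w = b a * w + w + w := by ring
      omega
    omega

/-! ### The decoder -/

theorem decode_val (z : ℕ) {D : Finset ℕ} (hD : D ⊆ Finset.range (k + c * (z * w + 1) * w))
    (hDc : D.card ≤ z * w) (u : Fin k → Bool) :
    (C.decode z (C.received z D u)).val =
      match (C.positionsT (C.parities (List.ofFn u)) (C.received z D u) (tuplesT (w + 1) z).val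
        (tuplesT (numBlocks k w) z).val Verdict.nothing).val with
      | Verdict.unique v => some v
      | _ => none := by
  simp only [decode, Timed.val_bind]
  rw [C.recovered_parities z hD hDc u]
  split <;> simp_all

/-- The correct guess puts `u` among the possible strings, so the verdict is either `u` or a
conflict. -/
theorem decode_eq_some_or_none (hw : 1 ≤ w) (hwk : w ≤ k) {z : ℕ} (hz : 2 * z ≤ c) {D : Finset ℕ}
    (hD : D ⊆ Finset.range (k + c * (z * w + 1) * w))
    {start size : Fin z → ℕ} (hsize : ∀ i, size i ≤ w)
    (hDw : ∀ j ∈ D, ∃ i, j ∈ Finset.Ico (start i) (start i + size i)) (u : Fin k → Bool) :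
    (C.decode z (C.received z D u)).val = some (List.ofFn u) ∨
      (C.decode z (C.received z D u)).val = none := by
  rw [C.decode_val z hD (card_le_of_windows hsize hDw)]
  have h := C.positionsT_mem (s := Verdict.nothing)
    (Or.inr (C.exists_guessResult_eq hw hwk hz hsize hDw u))
  rcases h with h | h <;> rw [h] <;> simp

/-- The correct guess excludes the verdict `nothing`, so a failure is a conflict, and by
`positionsT_agree` there is no conflict if all possible cases yield `u`. -/
theorem exists_wrong_of_decode_eq_none (hw : 1 ≤ w) (hwk : w ≤ k) {z : ℕ} (hz : 2 * z ≤ c)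
    {D : Finset ℕ} (hD : D ⊆ Finset.range (k + c * (z * w + 1) * w))
    {start size : Fin z → ℕ} (hsize : ∀ i, size i ≤ w)
    (hDw : ∀ j ∈ D, ∃ i, j ∈ Finset.Ico (start i) (start i + size i)) {u : Fin k → Bool}
    (hnone : (C.decode z (C.received z D u)).val = none) :
    ∃ bs ∈ (tuplesT (numBlocks k w) z).val, ∃ ds ∈ (tuplesT (w + 1) z).val, ∃ v,
      C.guessResult (C.parities (List.ofFn u)) (C.received z D u) bs ds = some v ∧
        v ≠ List.ofFn u := by
  rw [C.decode_val z hD (card_le_of_windows hsize hDw)] at hnone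
  have h := C.positionsT_mem (s := Verdict.nothing)
    (Or.inr (C.exists_guessResult_eq hw hwk hz hsize hDw u))
  by_contra hcon
  push Not at hcon
  have h2 := C.positionsT_agree (s := Verdict.nothing) (u := List.ofFn u)
    (p := C.parities (List.ofFn u)) (y := C.received z D u)
    (dss := (tuplesT (w + 1) z).val) (bss := (tuplesT (numBlocks k w) z).val)
    (Or.inl rfl) (by
      intro bs hbs ds hds
      cases hres : C.guessResult (C.parities (List.ofFn u)) (C.received z D u) bs ds with
      | none => exact Or.inl rfl
      | some v => exact Or.inr (congrArg some (hcon bs hbs ds hds v hres)))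
  rcases h with h | h
  · rw [h] at hnone; simp at hnone
  · rw [h] at h2; simp at h2

end Code

end GC

/-! ### From one guess to the probability of failure: the union bound. -/

namespace GC

namespace Code

variable {k w c : ℕ} (C : Code k w c)

/-! ### The probability of a decoding failure -/

theorem messageSymbol_xor (a b : Fin k → Bool) (i : Fin (numBlocks k w)) :
    C.messageSymbol (fun j => xor (a j) (b j)) i = C.messageSymbol a i + C.messageSymbol b i := by
  simp only [messageSymbol, symbol, ← Finset.sum_add_distrib]
  refine Finset.sum_congr rfl fun j _ => ?_
  have h (x y : Bool) (t : AdjoinRoot (modulusPoly C.modulus)) :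
      (if xor x y then t else 0) = (if x then t else 0) + (if y then t else 0) := by
    cases x <;> cases y <;> simp [sym_add_self]
  split
  · exact h _ _ _
  · simp

/-- The differences of messages with the same parities. -/
def kernel : Set (Fin k → Bool) :=
  {a | ∀ r, C.parityMatrix.mulVec (C.messageSymbol a) r = 0}

theorem xor_mem_kernel_of_eq {a b : Fin k → Bool}
    (h : ∀ r, C.parityMatrix.mulVec (C.messageSymbol a) r =
      C.parityMatrix.mulVec (C.messageSymbol b) r) :
    (fun i => xor (a i) (b i)) ∈ C.kernel := by
  intro r
  have h1 : C.messageSymbol (fun j => xor (a j) (b j)) = C.messageSymbol a + C.messageSymbol b :=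
    funext fun i => C.messageSymbol_xor a b i
  rw [h1, Matrix.mulVec_add, Pi.add_apply, h, sym_add_self]

theorem xor_mem_kernel {a b : Fin k → Bool} (ha : a ∈ C.kernel) (hb : b ∈ C.kernel) :
    (fun i => xor (a i) (b i)) ∈ C.kernel :=
  C.xor_mem_kernel_of_eq fun r => (ha r).trans (hb r).symm

/-- The MDS property in terms of bits: zero parities and at most `c` nonzero blocks make all symbols
vanish, and a zero symbol has zero bits by `symbol_injective`. -/
theorem eq_false_of_mem_kernel (hw : 1 ≤ w) {a : Fin k → Bool} (ha : a ∈ C.kernel) {B : Finset ℕ}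
    (hB : B.card ≤ c) (hsupp : ∀ i, a i = true → (i : ℕ) / w ∈ B) (i : Fin k) : a i = false := by
  classical
  have hbit : ∀ (l : Fin (numBlocks k w)) (j : Fin w), ((l : ℕ) * w + j) / w = l := by
    intro l j
    rw [mul_comm, Nat.mul_add_div hw, Nat.div_eq_of_lt j.2, add_zero]
  have h0 := IsSystematicMDS.eq_zero C.mds (U := C.messageSymbol a)
    (C := Finset.univ.filter fun l : Fin (numBlocks k w) => (l : ℕ) ∈ B) (R := Finset.univ)
    (by
      intro l hl
      simp only [Finset.mem_filter, Finset.mem_univ, true_and] at hl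
      rw [messageSymbol, symbol]
      apply Finset.sum_eq_zero
      intro j _
      rw [if_neg]
      intro hj
      split at hj
      · next h =>
        have := hsupp _ hj
        rw [hbit] at this
        exact hl this
      · simp at hj)
    (fun r _ => ha r)
    (by
      rw [Finset.card_univ, Fintype.card_fin]
      refine le_trans ?_ hB
      rw [← Finset.card_map Fin.valEmbedding]
      apply Finset.card_le_card
      intro b hb
      obtain ⟨l, hl, rfl⟩ := Finset.mem_map.1 hb
      exact (Finset.mem_filter.1 hl).2)
  have h1 := congrFun h0 ⟨i / w, div_lt_numBlocks hw i.2⟩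
  have h2 : symbol C.modulus (fun _ => false) = 0 := by simp [symbol]
  rw [messageSymbol, Pi.zero_apply, ← h2] at h1
  have h3 := congrFun (symbol_injective _ h1) ⟨i % w, Nat.mod_lt _ hw⟩
  have h4 : (i : ℕ) / w * w + i % w = i := by rw [mul_comm]; exact Nat.div_add_mod _ _
  simpa [h4] using h3

theorem parities_eq_of_flatten_eq {u v : Bits}
    (h : (C.parities u).flatten = (C.parities v).flatten) : C.parities u = C.parities v := by
  have h1 := blocksT_flatten (w := w) (P := C.parities u) fun b hb => C.length_of_mem_parities hb
  have h2 := blocksT_flatten (w := w) (P := C.parities v) fun b hb => C.length_of_mem_parities hb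
  rw [parities_length] at h1 h2
  rw [← h1, ← h2, h]

/-- Each window start erases at most two blocks; this is the summand `2 * z * w` in
`IsShift.card_bad_le`. -/
theorem card_erased_le (hw : 1 ≤ w) (bs : List ℕ) :
    ((Finset.range k).filter fun i => ¬ (C.guessFlags bs)[i / w]? = some false).card ≤
      2 * bs.length * w := by
  let B : Finset ℕ := bs.toFinset ∪ (bs.map (· + 1)).toFinset
  have hB : B.card ≤ 2 * bs.length := by
    have h2 := Finset.card_union_le bs.toFinset (bs.map (· + 1)).toFinset
    have h3 := List.toFinset_card_le bs
    have h4 := List.toFinset_card_le (bs.map (· + 1))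
    rw [List.length_map] at h4
    exact h2.trans (by omega)
  have hsub : ((Finset.range k).filter fun i => ¬ (C.guessFlags bs)[i / w]? = some false) ⊆
      B.biUnion fun b => Finset.Ico (b * w) (b * w + w) := by
    intro i hi
    obtain ⟨h1, h2⟩ := Finset.mem_filter.1 hi
    rw [C.getElem?_guessFlags (div_lt_numBlocks hw (Finset.mem_range.1 h1))] at h2
    push Not at h2
    obtain ⟨a, ha, h3⟩ := h2
    refine Finset.mem_biUnion.2 ⟨i / w, ?_, ?_⟩
    · by_cases h4 : i / w = a
      · simp [B, h4, ha]
      · simp [B, h3 h4, ha]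
    · have h4 := Nat.div_mul_le_self i w
      have h5 := Nat.lt_mul_div_succ i hw
      rw [mul_comm, Nat.succ_mul] at h5
      exact Finset.mem_Ico.2 ⟨h4, h5⟩
  have h1 := Finset.card_biUnion_le_card_mul B (fun b => Finset.Ico (b * w) (b * w + w)) w
    (by simp)
  exact (Finset.card_le_card hsub).trans (h1.trans (Nat.mul_le_mul_right _ hB))

open Classical in
/-- The number of messages for which a fixed guess is possible, but yields a wrong message. -/
theorem card_wrong_le (hw : 1 ≤ w) (hc : 1 ≤ c) {z : ℕ}
    {D : Finset ℕ} (hD : D ⊆ Finset.range (k + c * (z * w + 1) * w))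
    {start size : Fin z → ℕ} (hsize : ∀ i, size i ≤ w)
    (hDw : ∀ j ∈ D, ∃ i, j ∈ Finset.Ico (start i) (start i + size i)) {bs ds : List ℕ}
    (hbs : bs.length = z) (β : Bool) :
    (Finset.univ.filter fun u : Fin k → Bool =>
      (C.parities (List.ofFn u)).flatten[0]? = some β ∧
      ∃ v, C.guessResult (C.parities (List.ofFn u)) (C.received z D u) bs ds = some v ∧
        v ≠ List.ofFn u).card * 2 ^ (c * w) ≤ 2 ^ (k + 3 * z * w) := by
  set bad := Finset.univ.filter fun u : Fin k → Bool =>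
      (C.parities (List.ofFn u)).flatten[0]? = some β ∧
      ∃ v, C.guessResult (C.parities (List.ofFn u)) (C.received z D u) bs ds = some v ∧
        v ≠ List.ofFn u with hbad
  have hDc := card_le_of_windows hsize hDw
  have hylen : ∀ u, k ≤ (C.received z D u).length := by
    intro u
    have h1 := C.received_length z D hD u
    have h2 : z * w ≤ c * (z * w + 1) * w := by
      have h3 : 1 * (z * w + 1) * 1 ≤ c * (z * w + 1) * w :=
        Nat.mul_le_mul (Nat.mul_le_mul_right _ hc) hw
      omega
    omega
  rcases bad.eq_empty_or_nonempty with hemp | ⟨u0, hu0⟩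
  · rw [hemp]; simp
  -- The shifts depend only on the guess, so one message for which the guess is possible establishes
  -- the conditions once and for all.
  have hshift : IsShift w (fun b => (C.guessFlags bs)[b]? = some false)
      (guessed (C.guessFlags bs) (C.guessDeletions bs ds)) := by
    obtain ⟨-, -, v, hv, -⟩ := Finset.mem_filter.1 hu0
    exact (C.guessResult_eq_some hw (hylen u0) hv).1
  let v : (Fin k → Bool) → Fin k → Bool := fun u i =>
    ((C.guessResult (C.parities (List.ofFn u)) (C.received z D u) bs ds).getD []).getD i false
  have hvspec : ∀ u ∈ bad, C.guessResult (C.parities (List.ofFn u)) (C.received z D u) bs ds =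
      some (List.ofFn (v u)) ∧ List.ofFn (v u) ≠ List.ofFn u ∧
      (C.parities (List.ofFn u)).flatten[0]? = some β := by
    intro u hu
    obtain ⟨-, h0, v', hv', hne⟩ := Finset.mem_filter.1 hu
    have hl := (C.guessResult_eq_some hw (hylen u) hv').2.1
    have hvv : List.ofFn (v u) = v' := by
      subst hl
      apply List.ext_getElem
      · simp
      · intro i h1 h2
        simp [v, hv']
    rw [hvv]
    exact ⟨hv', hne, h0⟩
  refine hshift.card_bad_le (E := D) hw hsize hDw
    (Er := (Finset.range k).filter fun i => ¬ (C.guessFlags bs)[i / w]? = some false)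
    (fun i hi hk => Finset.mem_filter.2 ⟨Finset.mem_range.2 hi, hk⟩)
    (by rw [← hbs]; exact C.card_erased_le hw bs) (Ker := C.kernel)
    (fun a ha b hb => C.xor_mem_kernel ha hb)
    (fun a ha B hB hsupp => C.eq_false_of_mem_kernel hw ha hB hsupp) (β := β) (v := v)
    ?_ ?_ ?_
  · intro u hu h
    exact (hvspec u hu).2.1 (by rw [h])
  · intro u hu
    obtain ⟨h1, -, -⟩ := hvspec u hu
    have h2 := C.parities_eq_of_flatten_eq (C.guessResult_eq_some hw (hylen u) h1).2.2.1
    apply C.xor_mem_kernel_of_eq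
    intro r
    rw [← sym_parities, ← sym_parities, h2]
  · intro u hu i hi
    obtain ⟨h1, -, h0⟩ := hvspec u hu
    have h2 := (C.guessResult_eq_some hw (hylen u) h1).2.2.2 i i.2 hi
    rw [getElem?_received, List.getElem?_ofFn, dif_pos i.2] at h2
    -- At most `z * w` positions are deleted, so reading can leave the message only into the first
    -- `z * w + 1` parity positions, all of them copies of the bit `β`.
    have h3 : source D w (guessed (C.guessFlags bs) (C.guessDeletions bs ds)) i < k + z * w := by
      have := nth_notMem_le D (i - guessed (C.guessFlags bs) (C.guessDeletions bs ds) (i / w))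
      have := i.2
      simp only [source]
      omega
    change some (v u i) = (C.encode z (List.ofFn u)).val[
      source D w (guessed (C.guessFlags bs) (C.guessDeletions bs ds)) i]? at h2
    generalize source D w (guessed (C.guessFlags bs) (C.guessDeletions bs ds)) i = s at h2 h3
    by_cases hs : s < k
    · rw [encode_val, List.getElem?_append_left (by simpa using hs), List.getElem?_ofFn,
        dif_pos hs] at h2
      rw [extend, dif_pos hs]
      exact Option.some.inj h2
    · obtain ⟨r, rfl⟩ := Nat.exists_eq_add_of_le (not_lt.1 hs)
      have h4 := C.getElem?_encode_parity z u (i := 0) (r := r) (by omega)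
      rw [mul_zero, zero_add] at h4
      rw [h4, h0] at h2
      rw [extend, dif_neg hs]
      exact Option.some.inj h2

-- Union bound over the guesses; the factor `2` is for the values of the first parity bit, which has
-- to be fixed in `card_wrong_le`.
open Classical in
theorem card_failures_le (hw : 1 ≤ w) (hwk : w ≤ k) {z : ℕ} (hz : 2 * z ≤ c) (hc : 1 ≤ c)
    {D : Finset ℕ} (hD : D ⊆ Finset.range (k + c * (z * w + 1) * w))
    {start size : Fin z → ℕ} (hsize : ∀ i, size i ≤ w)
    (hDw : ∀ j ∈ D, ∃ i, j ∈ Finset.Ico (start i) (start i + size i)) :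
    (Finset.univ.filter fun u : Fin k → Bool =>
      (C.decode z (C.received z D u)).val = none).card * 2 ^ (c * w) ≤
    2 * (numBlocks k w * (w + 1)) ^ z * 2 ^ (k + 3 * z * w) := by
  let I : Finset (List ℕ × List ℕ × Bool) :=
    (tuplesT (numBlocks k w) z).val.toFinset ×ˢ ((tuplesT (w + 1) z).val.toFinset ×ˢ Finset.univ)
  have hI : I.card ≤ 2 * (numBlocks k w * (w + 1)) ^ z := by
    have h1 := List.toFinset_card_le (tuplesT (numBlocks k w) z).val
    have h2 := List.toFinset_card_le (tuplesT (w + 1) z).val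
    rw [tuplesT_length] at h1 h2
    simp only [I, Finset.card_product, Finset.card_univ, Fintype.card_bool]
    calc _ ≤ numBlocks k w ^ z * ((w + 1) ^ z * 2) := Nat.mul_le_mul h1 (Nat.mul_le_mul_right _ h2)
      _ = _ := by rw [mul_pow]; ring
  have hsub : (Finset.univ.filter fun u : Fin k → Bool =>
      (C.decode z (C.received z D u)).val = none) ⊆ I.biUnion fun t =>
        Finset.univ.filter fun u : Fin k → Bool =>
          (C.parities (List.ofFn u)).flatten[0]? = some t.2.2 ∧
          ∃ v, C.guessResult (C.parities (List.ofFn u)) (C.received z D u) t.1 t.2.1 = some v ∧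
            v ≠ List.ofFn u := by
    intro u hu
    obtain ⟨bs, hbs, ds, hds, v, hv, hne⟩ :=
      C.exists_wrong_of_decode_eq_none hw hwk hz hD hsize hDw (Finset.mem_filter.1 hu).2
    have hpos : 0 < (C.parities (List.ofFn u)).flatten.length := by
      rw [length_flatten_parities]
      exact Nat.mul_pos hc hw
    refine Finset.mem_biUnion.2 ⟨(bs, ds, (C.parities (List.ofFn u)).flatten[0]), ?_, ?_⟩
    · simp only [I, Finset.mem_product, List.mem_toFinset, Finset.mem_univ, and_true]
      exact ⟨hbs, hds⟩
    · refine Finset.mem_filter.2 ⟨Finset.mem_univ _, List.getElem?_eq_getElem hpos, v, hv, hne⟩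
  calc _ ≤ (∑ t ∈ I, (Finset.univ.filter fun u : Fin k → Bool =>
          (C.parities (List.ofFn u)).flatten[0]? = some t.2.2 ∧
          ∃ v, C.guessResult (C.parities (List.ofFn u)) (C.received z D u) t.1 t.2.1 = some v ∧
            v ≠ List.ofFn u).card) * 2 ^ (c * w) :=
        Nat.mul_le_mul_right _ ((Finset.card_le_card hsub).trans Finset.card_biUnion_le)
    _ ≤ ∑ t ∈ I, 2 ^ (k + 3 * z * w) := by
        rw [Finset.sum_mul]
        refine Finset.sum_le_sum fun t ht => ?_
        simp only [I, Finset.mem_product, List.mem_toFinset, Finset.mem_univ, and_true] at ht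
        exact C.card_wrong_le hw hc hD hsize hDw (mem_tuplesT.1 ht.1).1 _
    _ = I.card * 2 ^ (k + 3 * z * w) := by rw [Finset.sum_const, smul_eq_mul]
    _ ≤ _ := Nat.mul_le_mul_right _ hI

/-- Since `K * w < k + w ≤ 2 * k` and `K ≤ K * w`, the guess for one window has only `O(k)` values.
This gives the factor `k ^ z` both in the running time and in the failure probability. -/
theorem numBlocks_mul_succ_le (hw : 1 ≤ w) (hwk : w ≤ k) : numBlocks k w * (w + 1) ≤ 4 * k := by
  have h1 := numBlocks_mul_lt (k := k) hw
  have h2 : numBlocks k w ≤ numBlocks k w * w := Nat.le_mul_of_pos_right _ hw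
  rw [Nat.mul_succ]
  omega

theorem failureProb_le (hw : 1 ≤ w) (hwk : w ≤ k) {z : ℕ} (hz : 2 * z ≤ c) (hc : 1 ≤ c)
    {δ : ℕ} {D : Finset ℕ} (hD : Localized (k + c * (z * w + 1) * w) z w δ D) :
    C.failureProb z D ≤ 2 * 4 ^ z *
      ((k : ℝ) ^ z * (2 : ℝ) ^ (-((w : ℤ) * ((c : ℤ) - 3 * (z : ℤ))))) := by
  classical
  obtain ⟨hDr, start, size, hsize, -, hDw⟩ := hD
  have h1 := C.card_failures_le hw hwk hz hc hDr hsize hDw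
  have h2 : (numBlocks k w * (w + 1)) ^ z ≤ (4 * k) ^ z :=
    Nat.pow_le_pow_left (numBlocks_mul_succ_le hw hwk) z
  have h3 := h1.trans (Nat.mul_le_mul_right _ (Nat.mul_le_mul_left 2 h2))
  have h4 : (((Finset.univ.filter fun u : Fin k → Bool =>
      (C.decode z (C.received z D u)).val = none).card : ℕ) : ℝ) * 2 ^ (c * w) ≤
      2 * (4 * k) ^ z * 2 ^ (k + 3 * z * w) := by exact_mod_cast h3
  have h5 : (2 : ℝ) ^ (-((w : ℤ) * ((c : ℤ) - 3 * (z : ℤ)))) =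
      2 ^ (3 * z * w) / 2 ^ (c * w) := by
    rw [← zpow_natCast, ← zpow_natCast, ← zpow_sub₀ (by norm_num)]
    congr 1
    push_cast
    ring
  rw [failureProb, h5, div_le_iff₀ (by positivity)]
  calc _ = (((Finset.univ.filter fun u : Fin k → Bool =>
      (C.decode z (C.received z D u)).val = none).card : ℕ) : ℝ) * 2 ^ (c * w) / 2 ^ (c * w) := by
        rw [mul_div_cancel_right₀ _ (by positivity)]
    _ ≤ 2 * (4 * k) ^ z * 2 ^ (k + 3 * z * w) / 2 ^ (c * w) := by gcongr
    _ = _ := by rw [mul_pow, pow_add]; ring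

end Code

end GC

/-! ### The bounds `O(k w)` for encoding and `O(k^(z+1) w)` for decoding. -/

namespace GC

/-! ### Running times -/

theorem updateT_cost {k : ℕ} (s : Verdict) {o : Option Bits} (ho : ∀ v, o = some v → v.length ≤ k) :
    (updateT s o).cost ≤ k + 2 := by
  cases o with
  | none => simp [updateT]
  | some v =>
    have h := ho v rfl
    cases s with
    | nothing => simp [updateT]
    | unique v' =>
      have h1 := eqT_cost_right v' v
      simp only [updateT, Timed.cost_bind, cost_tick]
      split <;> simp only [Timed.cost_pure] <;> omega
    | conflict => simp [updateT]

theorem casesT_cost {k T : ℕ} {f : List ℕ → Timed (Option Bits)} (dss : List (List ℕ))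
    (hval : ∀ ds v, (f ds).val = some v → v.length ≤ k) (hcost : ∀ ds, (f ds).cost ≤ T)
    (s : Verdict) :
    (casesT f dss s).cost ≤ dss.length * (T + k + 3) + 1 := by
  induction dss generalizing s with
  | nil => simp [casesT]
  | cons ds dss ih =>
    have h1 := hcost ds
    have h2 := updateT_cost s (hval ds)
    have h3 := ih (updateT s (f ds).val).val
    simp only [casesT, Timed.cost_bind, cost_tick, List.length_cons]
    rw [Nat.succ_mul]
    omega

namespace Code

variable {k w c : ℕ} (C : Code k w c)

theorem numBlocks_mul_le (hwk : w ≤ k) (hw : 1 ≤ w) : numBlocks k w * w ≤ 2 * k := by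
  have := numBlocks_mul_lt (k := k) hw
  omega

/-- About `k / w` multiplications at `O(w ^ 2)` each cost `O(k * w)`; the additive `2` is absorbed
by `w ≤ k`. -/
theorem blocks_symbols_le (hwk : w ≤ k) (hw : 1 ≤ w) :
    (numBlocks k w + 2) * (14 * w ^ 2) ≤ 56 * (k * w) := by
  have h1 := numBlocks_mul_le hwk hw
  have h2 : numBlocks k w * w * w ≤ 2 * k * w := Nat.mul_le_mul_right _ h1
  have h3 : w * w ≤ k * w := Nat.mul_le_mul_right _ hwk
  calc (numBlocks k w + 2) * (14 * w ^ 2) = 14 * (numBlocks k w * w * w) + 28 * (w * w) := by ring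
    _ ≤ 14 * (2 * k * w) + 28 * (k * w) := by omega
    _ = 56 * (k * w) := by ring

theorem parities_cost (hwk : w ≤ k) (hw : 1 ≤ w) (U : List Bits) :
    (paritiesT C.modulusBits C.coeffBits U).cost ≤ c * (56 * (k * w)) + 1 := by
  have h := paritiesT_cost (N := numBlocks k w) hw C.modulusBits_length (G := C.coeffBits)
    (fun g hg => ⟨(C.mem_coeffBits hg).1.le, fun b hb => ((C.mem_coeffBits hg).2 b hb).le⟩) U
  rw [coeffBits_length] at h
  have := Nat.mul_le_mul_left c (blocks_symbols_le hwk hw)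
  omega

theorem encode_cost (hwk : w ≤ k) (hw : 1 ≤ w) (z : ℕ) (u : Fin k → Bool) :
    (C.encode z (List.ofFn u)).cost ≤ (c * (z + 62) + 14) * (k * w) := by
  have h1 := numBlocks_mul_le hwk hw
  have h2 := C.parities_cost hwk hw (blocksT w (numBlocks k w) (List.ofFn u)).val
  have h3 := flattenT_cost (W := w) (l := C.parities (List.ofFn u))
    fun b hb => (C.length_of_mem_parities hb).le
  rw [parities_length] at h3
  have hk : k ≤ k * w := Nat.le_mul_of_pos_right _ hw
  have hww : w * w ≤ k * w := Nat.mul_le_mul_right _ hwk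
  have hK : numBlocks k w ≤ numBlocks k w * w := Nat.le_mul_of_pos_right _ hw
  have h4 : c * (w + 2) ≤ c * (3 * (k * w)) := Nat.mul_le_mul_left _ (by omega)
  have h5 : c * w * (z * w + 1 + 2) ≤ c * (z + 3) * (k * w) := by
    have hw2 : w ≤ w * w := Nat.le_mul_of_pos_right _ hw
    calc c * w * (z * w + 1 + 2) = c * (z * (w * w) + 3 * w) := by ring
      _ ≤ c * (z * (k * w) + 3 * (k * w)) := by gcongr; omega
      _ = _ := by ring
  simp only [encode, Timed.cost_bind, cost_tick, blocksT_cost, flattenT_val, repeatT_cost,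
    appendT_cost, List.length_ofFn]
  change 1 + (_ + (_ + ((flattenT (C.parities (List.ofFn u))).cost +
    ((C.parities (List.ofFn u)).flatten.length * _ + 1 + _)))) ≤ _
  rw [length_flatten_parities]
  have h6 : numBlocks k w * (w + 2) ≤ 6 * (k * w) := by
    rw [Nat.mul_add]; omega
  have h7 : 1 ≤ k * w := by omega
  nlinarith

theorem consistentT_cost (hwk : w ≤ k) (hw : 1 ≤ w) {p : List Bits} (hp : p.length ≤ c)
    (hpw : ∀ b ∈ p, b.length ≤ w) (v : Bits) :
    (C.consistentT p v).cost ≤ (c * 63 + 12) * (k * w) := by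
  have h1 := numBlocks_mul_le hwk hw
  have h2 := C.parities_cost hwk hw (blocksT w (numBlocks k w) v).val
  have h3 := flattenT_cost (W := w) (l := C.parities v)
    fun b hb => (C.length_of_mem_parities hb).le
  rw [parities_length] at h3
  have h3' := flattenT_cost hpw
  have h8 := eqT_cost p.flatten (C.parities v).flatten
  have h9 : p.flatten.length ≤ c * w :=
    (length_flatten_le hpw).trans (Nat.mul_le_mul_right _ hp)
  have hk : k ≤ k * w := Nat.le_mul_of_pos_right _ hw
  have hK : numBlocks k w ≤ numBlocks k w * w := Nat.le_mul_of_pos_right _ hw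
  have h4 : c * (w + 2) ≤ c * (3 * (k * w)) := Nat.mul_le_mul_left _ (by omega)
  have h4' : p.length * (w + 2) ≤ c * (w + 2) := Nat.mul_le_mul_right _ hp
  have h5 : c * w ≤ c * (k * w) := Nat.mul_le_mul_left _ (by omega)
  simp only [consistentT, Timed.cost_bind, cost_tick, blocksT_cost, flattenT_val]
  change 1 + (_ + (_ + (_ + ((flattenT (C.parities v)).cost +
    (eqT p.flatten (C.parities v).flatten).cost)))) ≤ _
  have h6 : numBlocks k w * (w + 2) ≤ 6 * (k * w) := by
    rw [Nat.mul_add]; omega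
  have h7 : 1 ≤ k * w := by omega
  nlinarith

theorem length_of_caseT {p : List Bits} {y : Bits} {bs : List ℕ} {flags : List Bool} {e : ℕ}
    {G M : List (List Bits)} {dinv : Bits} {ds : List ℕ} {v : Bits}
    (h : (C.caseT p y bs flags e G M dinv ds).val = some v) : v.length ≤ k := by
  simp only [caseT, Timed.val_bind] at h
  split at h
  · simp at h
  · simp only [Timed.val_bind] at h
    split at h
    · simp at h
    · simp only [Timed.val_bind, splitT_val] at h
      split at h
      · simp only [Timed.val_pure, Option.some.injEq] at h
        rw [← h]
        simp
      · simp at h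

/-- A factor that bounds the cost of a single case, in terms of `k * w`. -/
def caseFactor (z c : ℕ) : ℕ :=
  (2 * z) * (2 * z * (2 * z + 2) + detFactor (2 * z) (2 * z) + 13) + 114 * z + 63 * c + 100

theorem caseT_cost (hwk : w ≤ k) (hw : 1 ≤ w) {z : ℕ} (hz : 0 < z) {p : List Bits} (y : Bits)
    {bs : List ℕ} {flags : List Bool} {e : ℕ} {G M : List (List Bits)} {dinv : Bits}
    (hp : p.length ≤ c) (hpw : ∀ b ∈ p, b.length ≤ w) (hbs : bs.length = z)
    (hflags : flags.length = numBlocks k w) (he : e ≤ 2 * z) (hGl : G.length ≤ 2 * z)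
    (hG : ∀ g ∈ G, g.length ≤ numBlocks k w ∧ ∀ b ∈ g, b.length ≤ w) (hMl : M.length ≤ 2 * z)
    (hM : ∀ r ∈ M, r.length ≤ 2 * z ∧ ∀ b ∈ r, b.length ≤ w) (hd : dinv.length ≤ w)
    (ds : List ℕ) :
    (C.caseT p y bs flags e G M dinv ds).cost ≤ caseFactor z c * (k * w) := by
  have hKw := numBlocks_mul_le hwk hw
  have hk : k ≤ k * w := Nat.le_mul_of_pos_right _ hw
  have hK : numBlocks k w ≤ numBlocks k w * w := Nat.le_mul_of_pos_right _ hw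
  have hone : 1 ≤ k * w := by omega
  have hww : w ^ 2 ≤ k * w := by rw [pow_two]; exact Nat.mul_le_mul_right _ hwk
  have h1 := deletionsT_cost bs ds (numBlocks k w) 0
  rw [hbs] at h1
  have h1' : numBlocks k w * (z + 2) ≤ (2 * z + 4) * (k * w) :=
    calc numBlocks k w * (z + 2) ≤ 2 * (k * w) * (z + 2) := Nat.mul_le_mul_right _ (by omega)
      _ = _ := by ring
  have h2 := chunkT_cost w flags (deletionsT bs ds (numBlocks k w) 0).val k 0 0 0 y
  rw [hflags] at h2
  have h2' : numBlocks k w * (w + 3) ≤ 8 * (k * w) := by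
    rw [Nat.mul_add]; omega
  simp only [caseT, Timed.cost_bind, cost_tick]
  split
  · simp only [Timed.cost_pure]
    calc _ ≤ (2 * z + 4) * (k * w) + 20 * (k * w) := by omega
      _ = (2 * z + 24) * (k * w) := by ring
      _ ≤ _ := Nat.mul_le_mul_right _ (by
        rw [caseFactor]
        have := Nat.zero_le ((2 * z) * (2 * z * (2 * z + 2) + detFactor (2 * z) (2 * z) + 13))
        omega)
  · next ps hps =>
    obtain ⟨hwt, hkn⟩ := weight_le_of_chunkT hps
    rw [hflags] at hwt
    have h3 := knownSymbolsT_cost C.modulusBits_length ps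
    have h3' : weight ps * (w + 2) ≤ 15 * (k * w) :=
      calc weight ps * (w + 2) ≤ (2 * numBlocks k w + 0 + 1) * (w + 2) :=
            Nat.mul_le_mul_right _ hwt
        _ = 2 * (numBlocks k w * w) + 4 * numBlocks k w + w + 2 := by ring
        _ ≤ _ := by omega
    have h4 := syndromesT_cost hw C.modulusBits_length hG p (knownSymbolsT w C.modulusBits ps).val
    have h4' : G.length * ((numBlocks k w + 2) * (14 * w ^ 2)) ≤ 112 * z * (k * w) :=
      calc _ ≤ 2 * z * (56 * (k * w)) := Nat.mul_le_mul hGl (blocks_symbols_le hwk hw)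
        _ = _ := by ring
    have hsw : ∀ b ∈ (syndromesT C.modulusBits G p (knownSymbolsT w C.modulusBits ps).val).val,
        b.length ≤ w := by
      intro b hb
      rw [syndromesT_val] at hb
      obtain ⟨i, hi, rfl⟩ := List.getElem_of_mem hb
      rw [List.getElem_zipWith, addT_length]
      exact (min_le_right _ _).trans ((dotT_length _ _ _).trans C.modulusBits_length.le)
    have h5 := cramerT_cost hw C.modulusBits_length e hMl hM hd hsw e 0
    have h5' : e * ((2 * z * (2 * z + 2) + detFactor (2 * z) e + 13) * w ^ 2) ≤
        (2 * z) * (2 * z * (2 * z + 2) + detFactor (2 * z) (2 * z) + 13) * (k * w) := by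
      have := detFactor_mono (N := 2 * z) (by omega) he
      calc _ ≤ 2 * z * ((2 * z * (2 * z + 2) + detFactor (2 * z) (2 * z) + 13) * (k * w)) := by
            gcongr
        _ = _ := by ring
    have h6 := fillT_cost (w := w) hkn (X := (cramerT C.modulusBits e M dinv
      (syndromesT C.modulusBits G p (knownSymbolsT w C.modulusBits ps).val).val e 0).val)
      fun b hb => ((length_of_mem_cramerT hb).trans C.modulusBits_length).le
    have h6' : weight ps * (3 * w + 5) ≤ 40 * (k * w) :=
      calc weight ps * (3 * w + 5) ≤ (2 * numBlocks k w + 0 + 1) * (3 * w + 5) :=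
            Nat.mul_le_mul_right _ hwt
        _ = 6 * (numBlocks k w * w) + 10 * numBlocks k w + 3 * w + 5 := by ring
        _ ≤ _ := by omega
    have hfac : caseFactor z c * (k * w) =
        (2 * z) * (2 * z * (2 * z + 2) + detFactor (2 * z) (2 * z) + 13) * (k * w) +
        (2 * z + 4) * (k * w) + 112 * z * (k * w) + (c * 63 + 12) * (k * w) + 84 * (k * w) := by
      rw [caseFactor]; ring
    rw [hfac]
    simp only [Timed.cost_bind]
    split
    · simp only [Timed.cost_pure]
      have := Nat.zero_le ((c * 63 + 12) * (k * w))
      omega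
    · next v hv =>
      have h7 := splitT_cost k v
      have h8 := C.consistentT_cost hwk hw hp hpw (v.take k)
      simp only [Timed.cost_bind, splitT_val]
      split <;> simp only [Timed.cost_pure] <;> omega

/-- A factor that bounds the cost of all the cases for a fixed position of the windows. -/
def positionFactor (z c : ℕ) : ℕ :=
  caseFactor z c + detFactor (2 * z) (2 * z) + 12 * z + 50

/-- The inversion costs `O(w ^ 3)`, which need not be `O(k * w)`. It is done once for `(w + 1) ^ z`
cases, and `z ≥ 2` gives `w ^ 3 ≤ (w + 1) ^ z * (k * w)`. -/
theorem positionT_cost (hwk : w ≤ k) (hw : 1 ≤ w) {z : ℕ} (hz : 2 ≤ z) {p : List Bits} (y : Bits)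
    {bs : List ℕ} (hp : p.length ≤ c) (hpw : ∀ b ∈ p, b.length ≤ w) (hbs : bs.length = z)
    (dss : List (List ℕ)) (hdss : dss.length = (w + 1) ^ z) (s : Verdict) :
    (C.positionT p y dss bs s).cost ≤ positionFactor z c * ((w + 1) ^ z * (k * w)) := by
  have hKw := numBlocks_mul_le hwk hw
  have hk : k ≤ k * w := Nat.le_mul_of_pos_right _ hw
  have hK : numBlocks k w ≤ numBlocks k w * w := Nat.le_mul_of_pos_right _ hw
  have hone : 1 ≤ k * w := by omega
  have hww : w ^ 2 ≤ k * w := by rw [pow_two]; exact Nat.mul_le_mul_right _ hwk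
  have he : (C.guessFlags bs).count true ≤ 2 * z := hbs ▸ C.count_guessFlags_le bs
  have hGl : (C.coeffBits.take ((C.guessFlags bs).count true)).length ≤ 2 * z :=
    (List.length_take_le _ _).trans he
  have hMl : (C.erasureMatrix bs).length ≤ 2 * z := by
    rw [erasureMatrix, List.length_map]; exact hGl
  have hM : ∀ r ∈ C.erasureMatrix bs, r.length ≤ 2 * z ∧ ∀ b ∈ r, b.length ≤ w := by
    intro r hr
    obtain ⟨g, hg, rfl⟩ := List.mem_map.1 hr
    exact ⟨(length_selected_le _ _).trans he, fun b hb =>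
      ((C.mem_coeffBits (List.mem_of_mem_take hg)).2 b ((selected_sublist _ _).subset hb)).le⟩
  have hdl : (detT C.modulusBits ((C.guessFlags bs).count true) (C.erasureMatrix bs)).val.length =
      w := (detT_length _ _ _).trans C.modulusBits_length
  have h1 : (flagsT bs (numBlocks k w) 0).cost ≤ (2 * z + 4) * (k * w) + 1 := by
    rw [flagsT_cost, hbs]
    calc numBlocks k w * (z + 2) + 1 ≤ 2 * (k * w) * (z + 2) + 1 :=
          Nat.succ_le_succ (Nat.mul_le_mul_right _ (by omega))
      _ = _ := by ring
  have h2 := countT_cost (C.guessFlags bs)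
  rw [guessFlags_length] at h2
  have h3 := splitT_cost ((C.guessFlags bs).count true) C.coeffBits
  have h3' : 2 * z ≤ 2 * z * (k * w) := Nat.le_mul_of_pos_right _ hone
  have h4 := selectColsT_cost (C.guessFlags bs) (C.coeffBits.take ((C.guessFlags bs).count true))
  rw [guessFlags_length] at h4
  have h4' : (C.coeffBits.take ((C.guessFlags bs).count true)).length * (numBlocks k w + 2) ≤
      8 * z * (k * w) :=
    calc _ ≤ 2 * z * (4 * (k * w)) := Nat.mul_le_mul hGl (by omega)
      _ = _ := by ring
  have h5 := detT_cost hw C.modulusBits_length ((C.guessFlags bs).count true) hMl hM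
  have h5' : detFactor (2 * z) ((C.guessFlags bs).count true) * w ^ 2 ≤
      detFactor (2 * z) (2 * z) * (k * w) :=
    Nat.mul_le_mul (detFactor_mono (by omega) he) hww
  have h6 := invT_cost hw C.modulusBits_length hdl.le
  have hpow : w ^ 2 ≤ (w + 1) ^ z :=
    (Nat.pow_le_pow_left (Nat.le_succ w) 2).trans (Nat.pow_le_pow_right (by omega) hz)
  have h6' : w ^ 3 ≤ (w + 1) ^ z * (k * w) :=
    calc w ^ 3 = w ^ 2 * w := by ring
      _ ≤ _ := Nat.mul_le_mul hpow (by omega)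
  have h7 := casesT_cost (k := k) (T := caseFactor z c * (k * w))
    (f := C.caseT p y bs (C.guessFlags bs) ((C.guessFlags bs).count true)
        (C.coeffBits.take ((C.guessFlags bs).count true)) (C.erasureMatrix bs)
        (C.erasureDetInv bs)) dss (fun ds v h => C.length_of_caseT h)
    (C.caseT_cost hwk hw (by omega) y hp hpw hbs (C.guessFlags_length bs) he hGl
      (fun g hg => ⟨(C.mem_coeffBits (List.mem_of_mem_take hg)).1.le,
        fun b hb => ((C.mem_coeffBits (List.mem_of_mem_take hg)).2 b hb).le⟩) hMl hM
      ((invT_length (hdl.trans C.modulusBits_length.symm)).trans C.modulusBits_length).le) s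
  rw [hdss] at h7
  have h7' : (w + 1) ^ z * (caseFactor z c * (k * w) + k + 3) ≤
      (caseFactor z c + 4) * ((w + 1) ^ z * (k * w)) :=
    calc _ ≤ (w + 1) ^ z * (caseFactor z c * (k * w) + 4 * (k * w)) :=
          Nat.mul_le_mul_left _ (by omega)
      _ = _ := by ring
  have hT : k * w ≤ (w + 1) ^ z * (k * w) := Nat.le_mul_of_pos_left _ (by positivity)
  have hsum : (C.positionT p y dss bs s).cost = 1 + ((flagsT bs (numBlocks k w) 0).cost +
      ((countT (C.guessFlags bs)).cost + ((splitT ((C.guessFlags bs).count true) C.coeffBits).cost +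
      ((selectColsT (C.guessFlags bs) (C.coeffBits.take ((C.guessFlags bs).count true))).cost +
      ((detT C.modulusBits ((C.guessFlags bs).count true) (C.erasureMatrix bs)).cost +
      ((invT w C.modulusBits (detT C.modulusBits ((C.guessFlags bs).count true)
        (C.erasureMatrix bs)).val).cost +
      (casesT (C.caseT p y bs (C.guessFlags bs) ((C.guessFlags bs).count true)
        (C.coeffBits.take ((C.guessFlags bs).count true)) (C.erasureMatrix bs)
        (C.erasureDetInv bs)) dss s).cost)))))) := by
    simp only [positionT, Timed.cost_bind, cost_tick, countT_val, splitT_val, selectColsT_val,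
      guessFlags, erasureMatrix, erasureDetInv]
  rw [hsum]
  have h8 : (detFactor (2 * z) (2 * z) + 12 * z + 18) * (k * w) ≤
      (detFactor (2 * z) (2 * z) + 12 * z + 18) * ((w + 1) ^ z * (k * w)) :=
    Nat.mul_le_mul_left _ hT
  have h9 : (detFactor (2 * z) (2 * z) + 12 * z + 18) * (k * w) =
      detFactor (2 * z) (2 * z) * (k * w) + (2 * z + 4) * (k * w) + 2 * z * (k * w) +
      8 * z * (k * w) + 14 * (k * w) := by ring
  have h10 : positionFactor z c * ((w + 1) ^ z * (k * w)) =
      (detFactor (2 * z) (2 * z) + 12 * z + 18) * ((w + 1) ^ z * (k * w)) +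
      (caseFactor z c + 4) * ((w + 1) ^ z * (k * w)) + 28 * ((w + 1) ^ z * (k * w)) := by
    rw [positionFactor]; ring
  rw [h10]
  omega

theorem positionsT_cost {T z : ℕ} {p : List Bits} {y : Bits} {dss : List (List ℕ)}
    (h : ∀ bs s, bs.length = z → (C.positionT p y dss bs s).cost ≤ T) {bss : List (List ℕ)}
    (hbss : ∀ bs ∈ bss, bs.length = z) (s : Verdict) :
    (C.positionsT p y dss bss s).cost ≤ bss.length * (T + 1) + 1 := by
  induction bss generalizing s with
  | nil => simp [positionsT]
  | cons bs bss ih =>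
    have h1 := h bs s (hbss bs (by simp))
    have h2 := ih (fun bs hbs => hbss bs (by simp [hbs])) (C.positionT p y dss bs s).val
    simp only [positionsT, Timed.cost_bind, cost_tick, List.length_cons]
    rw [Nat.succ_mul]
    omega

/-- There are `K ^ z` positions with `(w + 1) ^ z` cases each, together at most `(4 * k) ^ z`, and a
case costs `O(k * w)`. Recovering the parities and listing the guesses is of no higher order. -/
theorem decode_cost (hwk : w ≤ k) (hw : 1 ≤ w) {z : ℕ} (hz : 2 ≤ z) (y : Bits) :
    (C.decode z y).cost ≤
      (positionFactor z c + c * (z + 6) + 10 * z + 20) * ((4 * k) ^ z * (k * w)) := by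
  have hk : k ≤ k * w := Nat.le_mul_of_pos_right _ hw
  have hone : 1 ≤ k * w := by omega
  have hww : w * w ≤ k * w := Nat.mul_le_mul_right _ hwk
  have hKpos : 0 < numBlocks k w := numBlocks_pos hw (hw.trans hwk)
  set t := (dropT k y).val
  set pb := (unrepeatT (z * w + 1) (c * w) t).val
  set p := (blocksT w c pb).val with hpdef
  have hpl : p.length = c := by rw [hpdef, blocksT_val, List.length_ofFn]
  have hpw : ∀ b ∈ p, b.length ≤ w := fun b hb => (length_of_mem_blocksT hb).le
  have h1 := dropT_cost k y
  have h2 := unrepeatT_cost (z * w + 1) (c * w) t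
  have h2' : c * w * (z * w + 1 + 2) ≤ c * (z + 3) * (k * w) :=
    calc c * w * (z * w + 1 + 2) = c * (z * (w * w) + 3 * w) := by ring
      _ ≤ c * (z * (k * w) + 3 * (k * w)) := by gcongr; omega
      _ = _ := by ring
  have h3 := blocksT_cost w c pb
  have h3' : c * (w + 2) ≤ c * 3 * (k * w) := by
    rw [mul_assoc]
    exact Nat.mul_le_mul_left _ (by omega)
  have h4 := tuplesT_cost hKpos z
  have h5 := tuplesT_cost (N := w + 1) (Nat.succ_pos w) z
  have hN : numBlocks k w ^ z * (w + 1) ^ z ≤ (4 * k) ^ z := by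
    rw [← mul_pow]
    exact Nat.pow_le_pow_left (numBlocks_mul_succ_le hw hwk) z
  have hNpos : 0 < numBlocks k w ^ z := by positivity
  have hwpos : 0 < (w + 1) ^ z := by positivity
  have hN1 : numBlocks k w ^ z ≤ (4 * k) ^ z := (Nat.le_mul_of_pos_right _ hwpos).trans hN
  have hN2 : (w + 1) ^ z ≤ (4 * k) ^ z := (Nat.le_mul_of_pos_left _ hNpos).trans hN
  have hQ : (4 * k) ^ z ≤ (4 * k) ^ z * (k * w) := Nat.le_mul_of_pos_right _ hone
  have hT : k * w ≤ (4 * k) ^ z * (k * w) := Nat.le_mul_of_pos_left _ (Nat.pow_pos (by omega))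
  have h4' : (5 * z + 1) * numBlocks k w ^ z ≤ (5 * z + 1) * ((4 * k) ^ z * (k * w)) :=
    Nat.mul_le_mul_left _ (hN1.trans hQ)
  have h5' : (5 * z + 1) * (w + 1) ^ z ≤ (5 * z + 1) * ((4 * k) ^ z * (k * w)) :=
    Nat.mul_le_mul_left _ (hN2.trans hQ)
  have h6 := C.positionsT_cost (z := z) (p := p) (y := y)
    (fun bs s hbs => C.positionT_cost hwk hw hz y hpl.le hpw hbs (tuplesT (w + 1) z).val
      (tuplesT_length _ _) s) (fun bs hbs => (mem_tuplesT.1 hbs).1)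
    (bss := (tuplesT (numBlocks k w) z).val) Verdict.nothing
  rw [tuplesT_length] at h6
  have h6' : numBlocks k w ^ z * (positionFactor z c * ((w + 1) ^ z * (k * w)) + 1) ≤
      (positionFactor z c + 1) * ((4 * k) ^ z * (k * w)) :=
    calc _ = positionFactor z c * (numBlocks k w ^ z * (w + 1) ^ z * (k * w)) +
          numBlocks k w ^ z := by ring
      _ ≤ positionFactor z c * ((4 * k) ^ z * (k * w)) + (4 * k) ^ z * (k * w) :=
          Nat.add_le_add (Nat.mul_le_mul_left _ (Nat.mul_le_mul_right _ hN)) (hN1.trans hQ)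
      _ = _ := by ring
  have hsum : (C.decode z y).cost = 1 + ((dropT k y).cost +
      ((unrepeatT (z * w + 1) (c * w) t).cost + ((blocksT w c pb).cost +
      ((tuplesT (numBlocks k w) z).cost + ((tuplesT (w + 1) z).cost +
      (C.positionsT p y (tuplesT (w + 1) z).val (tuplesT (numBlocks k w) z).val
        Verdict.nothing).cost))))) := by
    simp only [decode, Timed.cost_bind, cost_tick]
    split <;> rfl
  rw [hsum]
  have h7 : c * (z + 3) * (k * w) + c * 3 * (k * w) ≤ c * (z + 6) * ((4 * k) ^ z * (k * w)) :=
    calc _ = c * (z + 6) * (k * w) := by ring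
      _ ≤ _ := Nat.mul_le_mul_left _ hT
  have h8 : (positionFactor z c + c * (z + 6) + 10 * z + 20) * ((4 * k) ^ z * (k * w)) =
      (positionFactor z c + 1) * ((4 * k) ^ z * (k * w)) +
      c * (z + 6) * ((4 * k) ^ z * (k * w)) + (5 * z + 1) * ((4 * k) ^ z * (k * w)) +
      (5 * z + 1) * ((4 * k) ^ z * (k * w)) + 17 * ((4 * k) ^ z * (k * w)) := by ring
  rw [h8]
  omega

end Code

end GC

/-! ### Cauchy matrices are MDS, and such codes exist. -/

namespace GC

/-! ### Existence of codes with Cauchy coefficients -/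

/-- Clearing denominators turns an agreement of parity `r` into a zero at `y r` of a polynomial of
degree less than the number of differing symbols. With as many agreements as differing symbols the
polynomial would be zero; but at `-x i` only the summand of `i` survives, which forces `U i = V i`.
-/
theorem isSystematicMDS_of_cauchy {F : Type} [Field F] {K c : ℕ} {x : Fin K → F} {y : Fin c → F}
    (hx : Function.Injective x) (hy : Function.Injective y) {P : Matrix (Fin c) (Fin K) F}
    (hP : ∀ r i, P r i * (x i + y r) = 1) : IsSystematicMDS P := by
  classical
  intro U V hUV
  have key : (Finset.univ.filter fun r => P.mulVec U r = P.mulVec V r).card <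
      (Finset.univ.filter fun i => U i ≠ V i).card := by
    by_contra hle
    set T := Finset.univ.filter fun i => U i ≠ V i with hT
    set R := Finset.univ.filter fun r => P.mulVec U r = P.mulVec V r with hR
    let Q : F[X] := ∑ i ∈ T, C (U i - V i) * ∏ j ∈ T.erase i, (X + C (x j))
    have hdeg : Q.degree < R.card := by
      refine (degree_sum_le _ _).trans_lt ?_
      refine (Finset.sup_lt_iff (WithBot.bot_lt_coe _)).2 fun i hi => ?_
      have h1 : (C (U i - V i) * ∏ j ∈ T.erase i, (X + C (x j))).degree ≤ (T.erase i).card := by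
        rw [degree_C_mul (sub_ne_zero.2 (Finset.mem_filter.1 hi).2), degree_prod]
        simp
      refine h1.trans_lt (WithBot.coe_lt_coe.2 ?_)
      exact (Finset.card_erase_lt_of_mem hi).trans_le (not_lt.1 hle)
    have heval : ∀ r ∈ R, Q.eval (y r) = 0 := by
      intro r hr
      have h1 : ∑ i, P r i * (U i - V i) = 0 := by
        have h2 := (Finset.mem_filter.1 hr).2
        simp only [Matrix.mulVec, dotProduct] at h2
        simp only [mul_sub, Finset.sum_sub_distrib, h2, sub_self]
      have h2 : ∑ i ∈ T, P r i * (U i - V i) = 0 := by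
        rw [← h1]
        apply Finset.sum_subset (Finset.subset_univ _)
        intro i _ hi
        simp only [hT, Finset.mem_filter, Finset.mem_univ, true_and, not_not] at hi
        rw [hi, sub_self, mul_zero]
      calc Q.eval (y r) = ∑ i ∈ T, (U i - V i) * ∏ j ∈ T.erase i, (x j + y r) := by
            simp [Q, eval_finsetSum, eval_prod, add_comm]
        _ = ∑ i ∈ T, (P r i * (U i - V i)) * ∏ j ∈ T, (x j + y r) := by
            refine Finset.sum_congr rfl fun i hi => ?_
            rw [← Finset.mul_prod_erase T _ hi]
            linear_combination -(U i - V i) * (∏ j ∈ T.erase i, (x j + y r)) * hP r i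
        _ = 0 := by rw [← Finset.sum_mul, h2, zero_mul]
    have hQ : Q = 0 := eq_zero_of_degree_lt_of_eval_index_eq_zero R hy.injOn hdeg heval
    obtain ⟨i, hi⟩ := Function.ne_iff.1 hUV
    have hiT : i ∈ T := Finset.mem_filter.2 ⟨Finset.mem_univ _, hi⟩
    have h1 : Q.eval (-x i) = (U i - V i) * ∏ j ∈ T.erase i, (x j - x i) := by
      have h2 : Q.eval (-x i) = ∑ l ∈ T, (U l - V l) * ∏ j ∈ T.erase l, (x j - x i) := by
        simp [Q, eval_finsetSum, eval_prod, neg_add_eq_sub]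
      rw [h2]
      apply Finset.sum_eq_single_of_mem i hiT
      intro l hl hli
      rw [Finset.prod_eq_zero (Finset.mem_erase.2 ⟨hli.symm, hiT⟩) (sub_self _), mul_zero]
    rw [hQ, eval_zero] at h1
    rcases mul_eq_zero.1 h1.symm with h2 | h2
    · exact hi (sub_eq_zero.1 h2)
    · obtain ⟨j, hj, h3⟩ := Finset.prod_eq_zero_iff.1 h2
      exact (Finset.mem_erase.1 hj).1 (hx (sub_eq_zero.1 h3))
  have hsplit := Finset.card_filter_add_card_filter_not (s := (Finset.univ : Finset (Fin c)))
    (p := fun r => P.mulVec U r = P.mulVec V r)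
  rw [Finset.card_univ, Fintype.card_fin] at hsplit
  have h1 : hammingDist U V = (Finset.univ.filter fun i => U i ≠ V i).card := by
    unfold hammingDist; congr!
  have h2 : hammingDist (P.mulVec U) (P.mulVec V) =
      (Finset.univ.filter fun r => ¬ P.mulVec U r = P.mulVec V r).card := by
    unfold hammingDist; congr!
  have h3 : c + 1 ≤ hammingDist U V + hammingDist (P.mulVec U) (P.mulVec V) := by
    rw [h1, h2]; omega
  convert h3

/-- The minimal polynomial over `ZMod 2` of a primitive element of the field with `2 ^ w` elements
is irreducible of degree `w`. -/
theorem exists_irreducible_modulusPoly {w : ℕ} (hw : 1 ≤ w) :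
    ∃ m : Fin w → Bool, Irreducible (modulusPoly m) := by
  have : Fact (Nat.Prime 2) := ⟨Nat.prime_two⟩
  obtain ⟨α, hα⟩ := Field.exists_primitive_element (ZMod 2) (GaloisField 2 w)
  have hint : IsIntegral (ZMod 2) α := Algebra.IsIntegral.isIntegral α
  have hdeg : (minpoly (ZMod 2) α).natDegree = w := by
    rw [(Field.primitive_element_iff_minpoly_natDegree_eq (ZMod 2) α).1 hα,
      GaloisField.finrank 2 (by omega)]
  have hmonic := minpoly.monic hint
  set p := minpoly (ZMod 2) α with hp
  have hlt : (p - X ^ w).degree < (w : WithBot ℕ) := by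
    have h1 : p.degree = w := by rw [degree_eq_natDegree hmonic.ne_zero, hdeg]
    have := degree_sub_lt_left (p := p) (q := X ^ w) (by rw [h1, degree_X_pow]) hmonic.ne_zero
      (by rw [hmonic.leadingCoeff, leadingCoeff_X_pow])
    rwa [h1] at this
  refine ⟨fun i => decide ((p - X ^ w).coeff i ≠ 0), ?_⟩
  rw [modulusPoly, lower_eq_of_degree_lt hlt, add_sub_cancel]
  exact minpoly.irreducible hint

theorem exists_isCauchy {k w c : ℕ} (hw : 1 ≤ w) (h : numBlocks k w + c ≤ 2 ^ w) :
    ∃ C : Code k w c, C.IsCauchy := by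
  obtain ⟨m, hm⟩ := exists_irreducible_modulusPoly hw
  have : Fact (Irreducible (modulusPoly m)) := ⟨hm⟩
  have : Finite (AdjoinRoot (modulusPoly m)) := Finite.of_surjective _ (symbol_surjective m)
  have := Fintype.ofFinite (AdjoinRoot (modulusPoly m))
  have hcard : Fintype.card (Fin (numBlocks k w + c)) ≤
      Fintype.card (AdjoinRoot (modulusPoly m)) := by
    rw [Fintype.card_fin, ← Nat.card_eq_fintype_card, natCard_adjoinRoot]
    exact h
  obtain ⟨f⟩ := Function.Embedding.nonempty_of_card_le hcard
  let x : Fin (numBlocks k w) → AdjoinRoot (modulusPoly m) := fun i => f (Fin.castAdd c i)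
  -- The minus sign makes `x i + y r` a difference of two distinct values of the injection `f`,
  -- hence invertible.
  let y : Fin c → AdjoinRoot (modulusPoly m) := fun r => -f (Fin.natAdd (numBlocks k w) r)
  have hx : Function.Injective x := f.injective.comp (Fin.castAdd_injective _ _)
  have hy : Function.Injective y :=
    neg_injective.comp (f.injective.comp (Fin.natAdd_injective _ _))
  have hxy : ∀ r i, x i + y r ≠ 0 := by
    intro r i h0
    have h1 := f.injective (add_neg_eq_zero.1 h0)
    have h2 := congrArg Fin.val h1
    have := i.2
    simp only [Fin.val_castAdd, Fin.val_natAdd] at h2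
    omega
  choose bits hbits using symbol_surjective m
  have hP : ∀ r i, symbol m (bits (x i + y r)⁻¹) * (x i + y r) = 1 := fun r i => by
    rw [hbits, inv_mul_cancel₀ (hxy r i)]
  exact ⟨⟨m, hm, fun r i => bits (x i + y r)⁻¹, isSystematicMDS_of_cauchy hx hy hP⟩,
    x, y, hx, hy, hP⟩

end GC

theorem theorem4 (z c : ℕ) (hz : 1 < z) (hc : 2 * z ≤ c) (A : ℝ) (hA : 0 < A) :
    ∃ B : ℝ, 0 < B ∧ ∀ k w : ℕ, 1 ≤ w → w ≤ k → A * Real.logb 2 k ≤ w →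
      (GC.numBlocks k w + c ≤ 2 ^ w → ∃ C : GC.Code k w c, C.IsCauchy) ∧
      ∀ C : GC.Code k w c,
        (∀ u : Fin k → Bool,
          C.IsCodeword z u (C.encode z (List.ofFn u)).val ∧
          (C.encode z (List.ofFn u)).val.length = k + c * (z * w + 1) * w ∧
          ((C.encode z (List.ofFn u)).cost : ℝ) ≤ B * (k * w)) ∧
        ∀ δ : ℕ, δ ≤ w → ∀ D : Finset ℕ,
          GC.Localized (k + c * (z * w + 1) * w) z w δ D →
            (∀ u : Fin k → Bool,
              ((C.decode z (C.received z D u)).val = some (List.ofFn u) ∨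
                (C.decode z (C.received z D u)).val = none) ∧
              ((C.decode z (C.received z D u)).cost : ℝ) ≤ B * ((k : ℝ) ^ (z + 1) * w)) ∧
            C.failureProb z D ≤
              B * ((k : ℝ) ^ z * (2 : ℝ) ^ (-((w : ℤ) * ((c : ℤ) - 3 * (z : ℤ))))) := by
  -- One constant each for encoding, decoding and the failure probability; the factors `4 ^ z` come
  -- from `(4 * k) ^ z`, and the sum serves for all three bounds.
  let B₁ : ℕ := c * (z + 62) + 14
  let B₂ : ℕ := (GC.Code.positionFactor z c + c * (z + 6) + 10 * z + 20) * 4 ^ z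
  let B₃ : ℕ := 2 * 4 ^ z
  refine ⟨((B₁ + B₂ + B₃ : ℕ) : ℝ), ?_, ?_⟩
  · have : 0 < B₁ + B₂ + B₃ := by
      simp only [B₁]
      omega
    exact_mod_cast this
  intro k w hw hwk _
  refine ⟨GC.exists_isCauchy hw, fun C => ⟨fun u => ⟨C.isCodeword_encode z u, C.encode_length z u,
    ?_⟩, fun δ _ D hD => ⟨fun u => ⟨?_, ?_⟩, ?_⟩⟩⟩
  · have h := (C.encode_cost hwk hw z u).trans
      (Nat.mul_le_mul_right (k * w) (show B₁ ≤ B₁ + B₂ + B₃ by omega))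
    exact_mod_cast h
  · obtain ⟨hDr, start, size, hsize, -, hDw⟩ := hD
    exact C.decode_eq_some_or_none hw hwk hc hDr hsize hDw u
  · have h := C.decode_cost hwk hw hz (C.received z D u)
    have h2 : (C.decode z (C.received z D u)).cost ≤ (B₁ + B₂ + B₃) * (k ^ (z + 1) * w) :=
      calc _ ≤ B₂ * (k ^ (z + 1) * w) := by
            refine h.trans_eq ?_
            simp only [B₂]
            rw [mul_pow]
            ring
        _ ≤ _ := Nat.mul_le_mul_right _ (by omega)
    exact_mod_cast h2
  · refine (C.failureProb_le hw hwk hc (by omega) hD).trans ?_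
    have h : (2 * 4 ^ z : ℝ) ≤ ((B₁ + B₂ + B₃ : ℕ) : ℝ) := by
      have : 2 * 4 ^ z ≤ B₁ + B₂ + B₃ := by simp only [B₃]; omega
      exact_mod_cast this
    exact mul_le_mul_of_nonneg_right h (by positivity)
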